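/- Let $n\ge 2$, and let $\mathbb{H}^n$ and $\mathbb{S}^n$ be the hyperbolic space of constant curvature $-1$ and the unit sphere of constant curvature $1$, each of dimension $n$. Let $\lambda(r)$ denote the first eigenvalue of $-\Delta$ (with $\Delta$ the Laplace–Beltrami operator) with Dirichlet boundary conditions on a geodesic ball $B(r)$ of radius $r$, that is, $$\lambda(r)=\inf_{0\ne u\in C_c^\infty(B(r))}\frac{\int_{B(r)}|\nabla u|^2\,dV}{\int_{B(r)}u^2\,dV},$$ where $r>0$ in the case of $\mathbb{H}^n$ and $0<r<\pi$ in the case of $\mathbb{S}^n$. Let $j_{\nu,1}$ denote the first positive zero of the Bessel function $J_\nu$ of the first kind. Put $\mathrm{s}=\sinh$ for $\mathbb{H}^n$ and $\mathrm{s}=\sin$ for $\mathbb{S}^n$, and in every $\pm$ below take the plus sign for $\mathbb{H}^n$ and the minus sign for $\mathbb{S}^n$. Then: - if $n=2$, $$\frac{j_{0,1}^2}{r^2}+\frac14\left[\frac1{r^2}-\frac1{\mathrm{s}^2(r)}\pm1\right]\le\lambda(r)\le\frac{j_{0,1}^2}{r^2}\pm\frac13;$$ - if $n=3$, $$\lambda(r)=\frac{\pi^2}{r^2}\pm1;$$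 - if $n\ge4$, $$\frac{j_{\frac{n-2}2,1}^2}{r^2}\pm\frac{n(n-1)}6\le\lambda(r)\le\frac{j_{\frac{n-2}2,1}^2}{r^2}\pm\frac{(n-1)^2}4+\frac{(n-1)(n-3)}4\left[\frac1{\mathrm{s}^2(r)}-\frac1{r^2}\right].$$ -/

import Mathlib

open Real Set MeasureTheory
open scoped ContDiff

noncomputable section

namespace SpaceForm

/-- The ambient space `ℝ^{n+1}` of the two models; its coordinates are indexed by `0, …, n`. -/
abbrev Ambient (n : ℕ) : Type := EuclideanSpace ℝ (Fin (n + 1))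

/-! ### Bessel functions and their first zeros -/

/-- The Bessel function of the first kind `J_ν (x)`, for `0 ≤ ν` and `0 < x`. -/
def besselJ (ν x : ℝ) : ℝ :=
  ∑' m : ℕ, (-1 : ℝ) ^ m / ((m.factorial : ℝ) * Real.Gamma ((m : ℝ) + ν + 1)) *
    (x / 2) ^ (2 * (m : ℝ) + ν)

/-- The first positive zero `j_{ν,1}` of `J_ν`. -/
def besselZero (ν : ℝ) : ℝ := sInf {x : ℝ | 0 < x ∧ besselJ ν x = 0}

/-! ### The first Dirichlet eigenvalue of a domain in a closed submanifold of `ℝ^{n+1}` -/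

/-- `u` represents a nonzero element of `C_c^∞(Ω)`, for a domain `Ω` of the closed embedded
submanifold `M` of the ambient space: the restriction of the smooth function `u` to `M` has compact
support in `Ω` and is not identically zero. (Every smooth function on `M` is the restriction of a
smooth function on the ambient space, so all of `C_c^∞(Ω)` is obtained.) -/
structure IsTestFunction {n : ℕ} (M Ω : Set (Ambient n)) (u : Ambient n → ℝ) : Prop where
  smooth : ContDiff ℝ ∞ u
  compact_support : IsCompact (closure {x | x ∈ M ∧ u x ≠ 0})
  support_subset : closure {x | x ∈ M ∧ u x ≠ 0} ⊆ Ω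
  nonzero : ∃ x ∈ M, u x ≠ 0

/-- The first eigenvalue of minus the Laplace-Beltrami operator on `Ω ⊆ M` with Dirichlet boundary
conditions: the infimum of the Rayleigh quotient `∫ |grad u|² dV / ∫ u² dV` over the nonzero
functions in `C_c^∞(Ω)`. Here `vol` is the Riemannian measure of `M` and `gradSq u x` is the squared
Riemannian norm at `x ∈ M` of the gradient of the restriction of `u` to `M`. -/
def firstDirichletEigenvalue {n : ℕ} (M : Set (Ambient n)) (vol : Measure (Ambient n))
    (gradSq : (Ambient n → ℝ) → Ambient n → ℝ) (Ω : Set (Ambient n)) : ℝ :=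
  sInf {q : ℝ | ∃ u : Ambient n → ℝ, IsTestFunction M Ω u ∧
    q = (∫ x, gradSq u x ∂vol) / ∫ x, u x ^ 2 ∂vol}

/-! ### The unit sphere `S^n` -/

/-- `S^n`, as the set of unit vectors of `ℝ^{n+1}`. -/
def sph (n : ℕ) : Set (Ambient n) := Metric.sphere 0 1

/-- The open geodesic ball of `S^n` with centre `p` and radius `r`; the geodesic distance is the
angle. -/
def sphBall (n : ℕ) (p : Ambient n) (r : ℝ) : Set (Ambient n) :=
  {x | x ∈ sph n ∧ InnerProductGeometry.angle p x < r}

/-- The `n`-dimensional surface measure of `S^n`, as a measure on the ambient space. -/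
def sphVolume (n : ℕ) : Measure (Ambient n) :=
  ((volume : Measure (Ambient n)).toSphere).map Subtype.val

/-- The Riemannian gradient of `u` on `S^n`: the orthogonal projection of the ambient gradient to
the tangent space `x^⊥`. -/
def sphGrad {n : ℕ} (u : Ambient n → ℝ) (x : Ambient n) : Ambient n :=
  gradient u x - (inner ℝ (gradient u x) x : ℝ) • x

/-- The first Dirichlet eigenvalue of the geodesic ball with centre `p` and radius `r` in `S^n`. -/
def sphEigenvalue (n : ℕ) (p : Ambient n) (r : ℝ) : ℝ :=
  firstDirichletEigenvalue (sph n) (sphVolume n) (fun u x => ‖sphGrad u x‖ ^ 2) (sphBall n p r)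

/-! ### Hyperbolic space `H^n` (hyperboloid model) -/

/-- The Lorentz form `-x₀y₀ + x₁y₁ + ⋯ + x_ny_n`. -/
def lorentz {n : ℕ} (x y : Ambient n) : ℝ :=
  (∑ i : Fin n, x i.succ * y i.succ) - x 0 * y 0

/-- `H^n`, as the upper sheet of the hyperboloid `⟨x, x⟩ = -1`, with the metric induced by the
Lorentz form. -/
def hyp (n : ℕ) : Set (Ambient n) := {x | lorentz x x = -1 ∧ 0 < x 0}

/-- The open geodesic ball of `H^n` with centre `p` and radius `r`; the geodesic distance `d` is
given by `cosh d(p, x) = -⟨p, x⟩`. -/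
def hypBall (n : ℕ) (p : Ambient n) (r : ℝ) : Set (Ambient n) :=
  {x | x ∈ hyp n ∧ Real.arcosh (-lorentz p x) < r}

/-- The parametrization `y ↦ (√(1 + |y|²), y)` of `H^n` by `ℝ^n`. -/
def hypParam (n : ℕ) (y : EuclideanSpace ℝ (Fin n)) : Ambient n :=
  WithLp.toLp 2 (Fin.cons (√(1 + ‖y‖ ^ 2)) (fun i => y i))

/-- The Riemannian measure of `H^n`. In the parametrization `hypParam` the induced metric is
`I - y yᵀ / (1 + |y|²)`, whose determinant is `1 / (1 + |y|²)`, so that the measure is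
`dy / √(1 + |y|²)`. -/
def hypVolume (n : ℕ) : Measure (Ambient n) :=
  ((volume : Measure (EuclideanSpace ℝ (Fin n))).withDensity
    (fun y => ENNReal.ofReal (1 / √(1 + ‖y‖ ^ 2)))).map (hypParam n)

/-- The gradient of `u` with respect to the Lorentz form: `⟨lorentzGrad u x, v⟩ = du_x(v)`. -/
def lorentzGrad {n : ℕ} (u : Ambient n → ℝ) (x : Ambient n) : Ambient n :=
  WithLp.toLp 2 (Fin.cons (-(gradient u x 0)) (fun i => gradient u x i.succ))

/-- The Riemannian gradient of `u` on `H^n`: the Lorentz-orthogonal projection of the ambient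
Lorentz gradient to the tangent space `{v | ⟨x, v⟩ = 0}` (recall that `⟨x, x⟩ = -1`). -/
def hypGrad {n : ℕ} (u : Ambient n → ℝ) (x : Ambient n) : Ambient n :=
  lorentzGrad u x + lorentz (lorentzGrad u x) x • x

/-- The first Dirichlet eigenvalue of the geodesic ball with centre `p` and radius `r` in `H^n`. -/
def hypEigenvalue (n : ℕ) (p : Ambient n) (r : ℝ) : ℝ :=
  firstDirichletEigenvalue (hyp n) (hypVolume n)
    (fun u x => lorentz (hypGrad u x) (hypGrad u x)) (hypBall n p r)

end SpaceForm

end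

/-!
In geodesic polar coordinates about `p` the two space forms have the metric `dt² + s(t)² dω²`, with
`s = sinh` and `ε = 1` or `s = sin` and `ε = -1`. Put `a = (n - 1) / 2`. The substitution
`φ = s^{-a} G` turns the radial part `s^{1-n} (s^{n-1} φ')'` of the Laplacian into a Bessel operator
plus a bounded potential. If `G = √t J_ν(j t / r)` with `ν = a - 1/2 = (n - 2) / 2` and
`j = j_{ν,1}`, so that `-G'' + a (a - 1) G / t² = (j² / r²) G` with `G` positive on `(0, r)` and
`G(r) = 0`, then `φ` is positive in the ball, vanishes on its boundary, and satisfies `-Δφ = q φ`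
with
`q(t) = j² / r² + a (a - 1) (1 / s(t)² - 1 / t²) + ε a²` (`radialPotential`).

By Barta's principle the first eigenvalue lies between the infimum and the supremum of `q`
(`IsPolarModel.eigenvalue_bounds`). For the lower bound, `∫ f'² s^{n-1} ≥ inf q ∫ f² s^{n-1}` on
every ray, because with `H = φ' / φ` the derivative of `H s^{n-1} f²` is
`(f'² - q f² - (f' - H f)²) s^{n-1}` (`mul_integral_sq_le`); this is integrated over the directions,
and the square of the radial derivative is at most that of the gradient. For the upper bound, `φ` cut off near the centre
and near the boundary is a radial trial function (`exists_trial_function`); cutting off at scale `k`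
in the coordinate `log (t / (r - t))` costs only `O (1 / k)` of energy.

The stated bounds are the extreme values of `q`. The function `1 / s² - 1 / t²` increases on
`(0, r]`, as `s³ ≥ c t³` with `c = s'` (`IsWarp.c_mul_cube_le`), and its limit at `0` is `-ε / 3`,
for which the bound `IsWarp.neg_third_le_inv_sq_sub` is proved directly. The coefficient
`a (a - 1) = (n - 1) (n - 3) / 4` is negative for `n = 2`, zero for `n = 3`, where `ν = 1/2` and
`G = sin (π t / r)`, and positive for `n ≥ 4`.

The properties of `j_{ν,1}` follow from the power series `J_ν(x) = (x/2)^ν E_ν(-x²/4)`: Bessel's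
equation comes from a contiguity relation of the `E_ν`, and a positive zero exists by Sturm
comparison (`exists_besselEntire_eq_zero`).

Polar coordinates for the given measures are obtained from Lebesgue measure of the ambient space:
the integral over `S^n`, or over `H^n`, is a multiple of the integral of the homogeneous extension
over the truncated cone. This shows that the measures are invariant under linear isometries and
Lorentz transformations, which move `p` to the pole `(1, 0)`. At the pole, polar coordinates on
`S^n` come from those of half-planes bounded by the axis, and on `H^n` from the parametrization
defining the measure.
-/

open Filter Topology
open scoped ENNReal

namespace SpaceForm

/-! ### Bessel functions and their ground states on an interval -/

/-- The entire function `E_ν(z) = ∑ z^m / (m! Γ(m + ν + 1))`, for which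
`J_ν(x) = (x/2)^ν E_ν(-x²/4)`. -/
noncomputable def besselSeries (ν z : ℝ) : ℝ :=
  ∑' m : ℕ, z ^ m / ((m.factorial : ℝ) * Real.Gamma ((m : ℝ) + ν + 1))

theorem gamma_shift_pos {ν : ℝ} (hν : 0 ≤ ν) (m : ℕ) : 0 < Real.Gamma ((m : ℝ) + ν + 1) :=
  Real.Gamma_pos_of_pos (by positivity)

theorem gamma_le_gamma_shift {ν : ℝ} (hν : 0 ≤ ν) (m : ℕ) :
    Real.Gamma (ν + 1) ≤ Real.Gamma ((m : ℝ) + ν + 1) := by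
  induction m with
  | zero => simp
  | succ k ih =>
    have h1 : ((k + 1 : ℕ) : ℝ) + ν + 1 = ((k : ℝ) + ν + 1) + 1 := by push_cast; ring
    rw [h1, Real.Gamma_add_one (s := (k : ℝ) + ν + 1) (by positivity)]
    refine ih.trans (le_mul_of_one_le_left (gamma_shift_pos hν k).le ?_)
    have : (0 : ℝ) ≤ k := by positivity
    linarith

theorem summable_besselSeries {ν : ℝ} (hν : 0 ≤ ν) (z : ℝ) :
    Summable fun m : ℕ => z ^ m / ((m.factorial : ℝ) * Real.Gamma ((m : ℝ) + ν + 1)) := by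
  have h0 : 0 < Real.Gamma (ν + 1) := Real.Gamma_pos_of_pos (by positivity)
  refine Summable.of_norm_bounded
    (g := fun m : ℕ => |z| ^ m / (m.factorial : ℝ) / Real.Gamma (ν + 1))
    ((Real.summable_pow_div_factorial |z|).div_const _) fun m => ?_
  have hp := gamma_shift_pos hν m
  rw [Real.norm_eq_abs, abs_div, abs_pow, abs_mul, Nat.abs_cast, abs_of_pos hp, div_div]
  gcongr
  exact gamma_le_gamma_shift hν m

theorem hasDerivAt_besselSeries {ν : ℝ} (hν : 0 ≤ ν) (z : ℝ) :
    HasDerivAt (besselSeries ν) (besselSeries (ν + 1) z) z := by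
  have h0 : 0 < Real.Gamma (ν + 1) := Real.Gamma_pos_of_pos (by positivity)
  set R := |z| + 1 with hR
  set g' : ℕ → ℝ → ℝ := fun m y =>
    m * y ^ (m - 1) / ((m.factorial : ℝ) * Real.Gamma ((m : ℝ) + ν + 1)) with hg'
  have hshift : ∀ (m : ℕ) (y : ℝ), g' (m + 1) y
      = y ^ m / ((m.factorial : ℝ) * Real.Gamma ((m : ℝ) + (ν + 1) + 1)) := by
    intro m y
    have hm : (m.factorial : ℝ) ≠ 0 := by positivity
    have hm1 : ((m : ℝ) + 1) ≠ 0 := by positivity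
    have hG : Real.Gamma ((m : ℝ) + (ν + 1) + 1) ≠ 0 :=
      (gamma_shift_pos (by linarith : 0 ≤ ν + 1) m).ne'
    have e : ((m + 1 : ℕ) : ℝ) + ν + 1 = (m : ℝ) + (ν + 1) + 1 := by push_cast; ring
    simp only [hg', e, Nat.factorial_succ, Nat.add_sub_cancel]
    push_cast
    field_simp
  have hu : Summable fun m : ℕ => m * R ^ (m - 1) / ((m.factorial : ℝ) * Real.Gamma (ν + 1)) := by
    rw [← summable_nat_add_iff 1]
    refine ((Real.summable_pow_div_factorial R).div_const (Real.Gamma (ν + 1))).congr fun m => ?_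
    have hm : (m.factorial : ℝ) ≠ 0 := by positivity
    have hm1 : ((m : ℝ) + 1) ≠ 0 := by positivity
    simp only [Nat.factorial_succ, Nat.add_sub_cancel]
    push_cast
    field_simp
  have key := hasDerivAt_tsum_of_isPreconnected (t := Metric.ball (0 : ℝ) R) (y₀ := 0) (y := z)
    (g := fun (m : ℕ) y => y ^ m / ((m.factorial : ℝ) * Real.Gamma ((m : ℝ) + ν + 1)))
    (g' := g') hu Metric.isOpen_ball (convex_ball 0 R).isPreconnected
    (fun m y _ => (hasDerivAt_pow m y).div_const _)
    (fun m y hy => by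
      have hp := gamma_shift_pos hν m
      have hy' : |y| ≤ R := by simpa using (mem_ball_zero_iff.1 hy).le
      simp only [hg']
      rw [Real.norm_eq_abs, abs_div, abs_mul, abs_pow, abs_mul, Nat.abs_cast, Nat.abs_cast,
        abs_of_pos hp]
      gcongr
      exact gamma_le_gamma_shift hν m)
    (Metric.mem_ball_self (by positivity)) (summable_besselSeries hν 0)
    (by simp [hR])
  have hval : ∑' m, g' m z = besselSeries (ν + 1) z := by
    have hs : Summable fun m => g' m z := by
      rw [← summable_nat_add_iff 1]
      exact (summable_besselSeries (by linarith : 0 ≤ ν + 1) z).congr fun m => (hshift m z).symm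
    rw [hs.tsum_eq_zero_add]
    simp only [hshift]
    simp [hg', besselSeries]
  rw [hval] at key
  exact key

theorem besselSeries_recurrence {ν : ℝ} (hν : 0 ≤ ν) (z : ℝ) :
    besselSeries ν z = (ν + 1) * besselSeries (ν + 1) z + z * besselSeries (ν + 2) z := by
  have h1 : 0 ≤ ν + 1 := by linarith
  have h2 : 0 ≤ ν + 2 := by linarith
  have hs := summable_besselSeries hν z
  have hs1 := (summable_besselSeries h1 z)
  have hs2 := (summable_besselSeries h2 z)
  unfold besselSeries
  have hA : HasSum (fun m : ℕ => (m : ℝ) *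
      (z ^ m / ((m.factorial : ℝ) * Real.Gamma ((m : ℝ) + (ν + 1) + 1))))
      (z * ∑' m : ℕ, z ^ m / ((m.factorial : ℝ) * Real.Gamma ((m : ℝ) + (ν + 2) + 1))) := by
    rw [← hasSum_nat_add_iff' 1]
    have := hs2.hasSum.mul_left z
    simp only [Finset.range_one, Finset.sum_singleton, CharP.cast_eq_zero, zero_mul, sub_zero]
    refine this.congr_fun ?_
    intro m
    have hm : (m.factorial : ℝ) ≠ 0 := by positivity
    have hm1 : ((m : ℝ) + 1) ≠ 0 := by positivity
    have e : ((m + 1 : ℕ) : ℝ) + (ν + 1) + 1 = (m : ℝ) + (ν + 2) + 1 := by push_cast; ring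
    have hG := (gamma_shift_pos h2 m).ne'
    rw [e, Nat.factorial_succ, pow_succ]
    push_cast
    field_simp
  have hB := (hs1.hasSum.mul_left (ν + 1)).add hA
  refine hs.hasSum.unique (hB.congr_fun ?_)
  intro m
  have hm : (m.factorial : ℝ) ≠ 0 := by positivity
  have hG := (gamma_shift_pos hν m).ne'
  have hp : (m : ℝ) + ν + 1 ≠ 0 := by positivity
  have e : (m : ℝ) + (ν + 1) + 1 = ((m : ℝ) + ν + 1) + 1 := by ring
  rw [e, Real.Gamma_add_one hp]
  field_simp
  ring

theorem besselSeries_zero_pos {ν : ℝ} (hν : 0 ≤ ν) : 0 < besselSeries ν 0 := by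
  unfold besselSeries
  rw [tsum_eq_single 0 (fun m hm => by simp [hm])]
  have := gamma_shift_pos hν 0
  simp only [Nat.cast_zero, pow_zero, Nat.factorial_zero, Nat.cast_one, one_mul] at *
  positivity

/-- The entire part `E_ν(-x²/4)` of the Bessel function. -/
noncomputable def besselEntire (ν x : ℝ) : ℝ := besselSeries ν (-x ^ 2 / 4)

theorem hasDerivAt_besselEntire {ν : ℝ} (hν : 0 ≤ ν) (x : ℝ) :
    HasDerivAt (besselEntire ν) (-(x / 2) * besselEntire (ν + 1) x) x := by
  have h1 : HasDerivAt (fun x : ℝ => -x ^ 2 / 4) (-(x / 2)) x := by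
    have := ((hasDerivAt_pow 2 x).neg).div_const 4
    exact this.congr_deriv (by push_cast; ring)
  have := (hasDerivAt_besselSeries hν (-x ^ 2 / 4)).comp x h1
  rw [mul_comm] at this
  exact this

theorem besselEntire_recurrence {ν : ℝ} (hν : 0 ≤ ν) (x : ℝ) :
    besselEntire ν x
      = (ν + 1) * besselEntire (ν + 1) x - x ^ 2 / 4 * besselEntire (ν + 2) x := by
  rw [besselEntire, besselSeries_recurrence hν]
  simp only [besselEntire]; ring

theorem besselEntire_zero_pos {ν : ℝ} (hν : 0 ≤ ν) : 0 < besselEntire ν 0 := by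
  simpa [besselEntire] using besselSeries_zero_pos hν

theorem besselJ_eq {ν x : ℝ} (hx : 0 < x) :
    besselJ ν x = (x / 2) ^ ν * besselEntire ν x := by
  unfold besselJ besselEntire besselSeries
  rw [← tsum_mul_left]
  refine tsum_congr fun m => ?_
  have h : 0 < x / 2 := by positivity
  rw [Real.rpow_add h, show (2 * (m : ℝ)) = ((2 * m : ℕ) : ℝ) by push_cast; ring,
    Real.rpow_natCast, pow_mul, show -x ^ 2 / 4 = (-1) * (x / 2) ^ 2 by ring, mul_pow]
  ring

theorem besselJ_eq_zero_iff {ν x : ℝ} (hx : 0 < x) :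
    besselJ ν x = 0 ↔ besselEntire ν x = 0 := by
  rw [besselJ_eq hx, mul_eq_zero, or_iff_right (by positivity)]

/-- The Liouville normal form `x^a E_ν(-x²/4)`, `a = ν + 1/2`, of the Bessel function. -/
noncomputable def besselNormal (ν x : ℝ) : ℝ := x ^ (ν + 1 / 2) * besselEntire ν x

/-- The derivative of `besselNormal`. -/
noncomputable def besselNormalDeriv (ν x : ℝ) : ℝ :=
  x ^ (ν + 1 / 2) * ((ν + 1 / 2) / x * besselEntire ν x - x / 2 * besselEntire (ν + 1) x)

theorem hasDerivAt_rpow_div (a : ℝ) {x : ℝ} (hx : 0 < x) :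
    HasDerivAt (fun x : ℝ => x ^ a) (x ^ a * (a / x)) x := by
  convert Real.hasDerivAt_rpow_const (p := a) (Or.inl hx.ne') using 1
  rw [Real.rpow_sub_one hx.ne']
  ring

theorem hasDerivAt_besselNormal {ν : ℝ} (hν : 0 ≤ ν) {x : ℝ} (hx : 0 < x) :
    HasDerivAt (besselNormal ν) (besselNormalDeriv ν x) x := by
  refine ((hasDerivAt_rpow_div (ν + 1 / 2) hx).mul (hasDerivAt_besselEntire hν x)).congr_deriv ?_
  unfold besselNormalDeriv
  ring

/-- Bessel's equation in Liouville normal form: `G'' = (a (a - 1) / x² - 1) G`. -/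
theorem hasDerivAt_besselNormalDeriv {ν : ℝ} (hν : 0 ≤ ν) {x : ℝ} (hx : 0 < x) :
    HasDerivAt (besselNormalDeriv ν)
      (((ν + 1 / 2) * (ν + 1 / 2 - 1) / x ^ 2 - 1) * besselNormal ν x) x := by
  have h1 : 0 ≤ ν + 1 := by linarith
  have hE := hasDerivAt_besselEntire hν x
  have hE1 := hasDerivAt_besselEntire h1 x
  have hd : HasDerivAt (fun x : ℝ => (ν + 1 / 2) / x) (-(ν + 1 / 2) / x ^ 2) x := by
    exact ((hasDerivAt_inv hx.ne').const_mul (ν + 1 / 2)).congr_deriv (by ring)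
  have hh : HasDerivAt (fun x : ℝ => x / 2) (1 / 2) x := (hasDerivAt_id x).div_const 2
  refine ((hasDerivAt_rpow_div (ν + 1 / 2) hx).mul
    ((hd.mul hE).sub (hh.mul hE1))).congr_deriv ?_
  simp only [besselNormal, Pi.mul_apply, Pi.sub_apply]
  rw [show ν + 1 + 1 = ν + 2 by ring, besselEntire_recurrence hν x]
  field_simp
  ring

/-- `J_ν` has a positive zero, by Sturm comparison with `sin (x / 2)`. -/
theorem exists_besselEntire_eq_zero {ν : ℝ} (hν : 0 ≤ ν) :
    ∃ x, 0 < x ∧ besselEntire ν x = 0 := by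
  by_contra! hne
  have hcont : Continuous (besselEntire ν) :=
    continuous_iff_continuousAt.2 fun x => (hasDerivAt_besselEntire hν x).continuousAt
  have hpos : ∀ x, 0 < x → 0 < besselEntire ν x := by
    intro x hx
    by_contra hneg
    obtain ⟨y, hy, hy0⟩ := intermediate_value_Icc' hx.le hcont.continuousOn
      ⟨not_lt.1 hneg, (besselEntire_zero_pos hν).le⟩
    rcases hy.1.eq_or_lt with h | h
    · rw [← h] at hy0; exact (besselEntire_zero_pos hν).ne' hy0
    · exact hne y h hy0
  have hG : ∀ x, 0 < x → 0 < besselNormal ν x := fun x hx =>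
    mul_pos (Real.rpow_pos_of_pos hx _) (hpos x hx)
  -- beyond `T` the coefficient `1 - a (a - 1) / x²` is at least `1 / 4`
  set T : ℝ := 2 * (ν + 1) with hT
  have hT0 : 0 < T := by positivity
  have hπ := Real.pi_pos
  set Wr : ℝ → ℝ := fun x => besselNormalDeriv ν x * Real.sin ((x - T) / 2)
    - besselNormal ν x * (Real.cos ((x - T) / 2) * (1 / 2)) with hWr
  have hWd : ∀ x, 0 < x → HasDerivAt Wr
      ((((ν + 1 / 2) * (ν + 1 / 2 - 1) / x ^ 2 - 1) + 1 / 4) * besselNormal ν x *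
        Real.sin ((x - T) / 2)) x := by
    intro x hx
    have hl : HasDerivAt (fun x : ℝ => (x - T) / 2) (1 / 2) x :=
      ((hasDerivAt_id x).sub_const T).div_const 2
    have := ((hasDerivAt_besselNormalDeriv hν hx).mul hl.sin).sub
      ((hasDerivAt_besselNormal hν hx).mul (hl.cos.mul_const (1 / 2)))
    exact this.congr_deriv (by ring)
  have hanti : AntitoneOn Wr (Icc T (T + 2 * π)) := by
    refine antitoneOn_of_hasDerivWithinAt_nonpos (convex_Icc _ _)
      (fun x hx => (hWd x (hT0.trans_le hx.1)).continuousAt.continuousWithinAt)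
      (fun x hx => (hWd x (hT0.trans_le (interior_subset hx).1)).hasDerivWithinAt) ?_
    intro x hx
    have hx' := interior_subset hx
    have hx0 : 0 < x := hT0.trans_le hx'.1
    have hs : 0 ≤ Real.sin ((x - T) / 2) :=
      Real.sin_nonneg_of_nonneg_of_le_pi (by linarith [hx'.1]) (by linarith [hx'.2])
    refine mul_nonpos_of_nonpos_of_nonneg (mul_nonpos_of_nonpos_of_nonneg ?_ (hG x hx0).le) hs
    have : (ν + 1 / 2) * (ν + 1 / 2 - 1) / x ^ 2 ≤ 1 / 4 := by
      rw [div_le_iff₀ (by positivity)]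
      have : T ^ 2 ≤ x ^ 2 := by gcongr; exact hx'.1
      nlinarith
    linarith
  have h := hanti (left_mem_Icc.2 (by linarith)) (right_mem_Icc.2 (by linarith))
    (by linarith : T ≤ T + 2 * π)
  have e : (T + 2 * π - T) / 2 = π := by ring
  simp only [hWr, e, sub_self, zero_div, Real.sin_zero, Real.cos_zero, Real.sin_pi,
    Real.cos_pi] at h
  nlinarith [hG T hT0, hG (T + 2 * π) (by positivity)]

/-- The infimum defining `j_{ν,1}` is attained, and `E_ν(-x²/4)` is positive before it. -/
theorem besselZero_spec {ν : ℝ} (hν : 0 ≤ ν) :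
    0 < besselZero ν ∧ besselEntire ν (besselZero ν) = 0 ∧
      ∀ x, 0 ≤ x → x < besselZero ν → 0 < besselEntire ν x := by
  have hcont : Continuous (besselEntire ν) :=
    continuous_iff_continuousAt.2 fun x => (hasDerivAt_besselEntire hν x).continuousAt
  set S := {x : ℝ | 0 < x ∧ besselJ ν x = 0} with hS
  have hS' : S = {x : ℝ | 0 ≤ x ∧ besselEntire ν x = 0} := by
    ext x
    constructor
    · rintro ⟨h1, h2⟩
      exact ⟨h1.le, (besselJ_eq_zero_iff h1).1 h2⟩
    · rintro ⟨h1, h2⟩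
      have h : 0 < x := lt_of_le_of_ne h1 fun h => (besselEntire_zero_pos hν).ne' (h ▸ h2)
      exact ⟨h, (besselJ_eq_zero_iff h).2 h2⟩
  have hclosed : IsClosed S := by
    rw [hS']
    exact isClosed_Ici.inter (isClosed_eq hcont continuous_const)
  have hne : S.Nonempty := by
    obtain ⟨x, hx, h⟩ := exists_besselEntire_eq_zero hν
    exact ⟨x, hx, (besselJ_eq_zero_iff hx).2 h⟩
  have hbdd : BddBelow S := ⟨0, fun x hx => hx.1.le⟩
  have hmem : besselZero ν ∈ S := hclosed.csInf_mem hne hbdd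
  refine ⟨hmem.1, (besselJ_eq_zero_iff hmem.1).1 hmem.2, fun x hx hlt => ?_⟩
  by_contra hneg
  obtain ⟨y, hy, hy0⟩ := intermediate_value_Icc' hx hcont.continuousOn
    ⟨not_lt.1 hneg, (besselEntire_zero_pos hν).le⟩
  have hyS : y ∈ S := by rw [hS']; exact ⟨hy.1, hy0⟩
  exact absurd (csInf_le hbdd hyS) (not_le.2 (hy.2.trans_lt hlt))

/-- `G` is a Dirichlet ground state on `(0, r)`, with eigenvalue `κ`, of the Bessel operator
`-d²/dt² + a (a - 1) / t²`; `G'` is its derivative. The last two fields record that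
the logarithmic derivative of `G` is that of `t ^ a` at `0` to leading order, and that `G` is
`O (√t)` at `0` and `O (√(r - t))` at `r`; the latter is the Dirichlet condition at `r`. -/
structure IsBesselGroundState (a κ r : ℝ) (G G' : ℝ → ℝ) : Prop where
  hasDerivAt : ∀ t, 0 < t → HasDerivAt G (G' t) t
  hasDerivAt_deriv : ∀ t, 0 < t → HasDerivAt G' ((a * (a - 1) / t ^ 2 - κ) * G t) t
  pos : ∀ t ∈ Ioo 0 r, 0 < G t
  tendsto : Tendsto (fun t => t * (G' t / G t)) (𝓝[>] 0) (𝓝 a)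
  bound : ∃ C, 0 ≤ C ∧ ∀ t ∈ Ioo 0 r, G t ^ 2 ≤ C * (t * (r - t))

/-- The ground state is `√t J_ν(j t / r)` up to a constant factor, with `j = j_{ν,1}`. -/
theorem exists_isBesselGroundState {ν r : ℝ} (hν : 0 ≤ ν) (hr : 0 < r) :
    ∃ G G', IsBesselGroundState (ν + 1 / 2) (besselZero ν ^ 2 / r ^ 2) r G G' := by
  obtain ⟨hj, hj0, hjpos⟩ := besselZero_spec hν
  set j := besselZero ν with hjdef
  set b := j / r with hb
  have hb0 : 0 < b := by positivity
  have hbr : b * r = j := by rw [hb]; field_simp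
  have hlin : ∀ t : ℝ, HasDerivAt (fun t => b * t) b t := fun t => by
    simpa using (hasDerivAt_id t).const_mul b
  refine ⟨fun t => besselNormal ν (b * t), fun t => besselNormalDeriv ν (b * t) * b, ?_, ?_, ?_,
    ?_, ?_⟩
  · intro t ht
    exact (hasDerivAt_besselNormal hν (by positivity : 0 < b * t)).comp t (hlin t)
  · intro t ht
    refine (((hasDerivAt_besselNormalDeriv hν (by positivity : 0 < b * t)).comp t
      (hlin t)).mul_const b).congr_deriv ?_
    rw [← div_pow, ← hb]
    field_simp
  · intro t ht
    have : b * t < j := by rw [← hbr]; exact mul_lt_mul_of_pos_left ht.2 hb0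
    exact mul_pos (Real.rpow_pos_of_pos (mul_pos hb0 ht.1) _)
      (hjpos _ (mul_pos hb0 ht.1).le this)
  · have hlim : Tendsto (fun t : ℝ => (ν + 1 / 2) - (b * t) ^ 2 / 2 *
        (besselEntire (ν + 1) (b * t) / besselEntire ν (b * t))) (𝓝[>] 0) (𝓝 (ν + 1 / 2)) := by
      have hc0 : ContinuousAt (besselEntire ν) 0 := (hasDerivAt_besselEntire hν 0).continuousAt
      have hc1 : ContinuousAt (besselEntire (ν + 1)) 0 :=
        (hasDerivAt_besselEntire (by linarith) 0).continuousAt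
      have hl : Tendsto (fun t : ℝ => b * t) (𝓝[>] 0) (𝓝 0) := by
        have : Tendsto (fun t : ℝ => b * t) (𝓝 0) (𝓝 (b * 0)) := (hlin 0).continuousAt
        rw [mul_zero] at this
        exact this.mono_left nhdsWithin_le_nhds
      have h := (((hl.pow 2).div_const 2).mul ((hc1.tendsto.comp hl).div (hc0.tendsto.comp hl)
        (besselEntire_zero_pos hν).ne')).const_sub (ν + 1 / 2)
      simpa using h
    refine hlim.congr' ?_
    filter_upwards [Ioo_mem_nhdsGT hr] with t ht
    have hx : 0 < b * t := mul_pos hb0 ht.1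
    have hlt : b * t < j := by rw [← hbr]; exact mul_lt_mul_of_pos_left ht.2 hb0
    have hE := (hjpos _ hx.le hlt).ne'
    have hp := (Real.rpow_pos_of_pos hx (ν + 1 / 2)).ne'
    have ht0 := ht.1.ne'
    simp only [besselNormal, besselNormalDeriv]
    generalize (b * t) ^ (ν + 1 / 2) = P at hp
    generalize besselEntire ν (b * t) = E at hE
    field_simp
  · -- `G² = x^{2ν+1} E²` with `x = b t`, where `E` is Lipschitz on `[0, j]` and vanishes at `j`
    have hcd : Continuous fun x : ℝ => -(x / 2) * besselEntire (ν + 1) x := by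
      have : Continuous (besselEntire (ν + 1)) := continuous_iff_continuousAt.2 fun x =>
        (hasDerivAt_besselEntire (by linarith : 0 ≤ ν + 1) x).continuousAt
      fun_prop
    obtain ⟨K, hK⟩ := (isCompact_Icc (a := 0) (b := j)).exists_bound_of_continuousOn
      hcd.continuousOn
    have hK0 : 0 ≤ K := (norm_nonneg _).trans (hK 0 ⟨le_rfl, hj.le⟩)
    have hE : ∀ x ∈ Icc 0 j, |besselEntire ν x| ≤ K * (j - x) := by
      intro x hx
      have := (convex_Icc 0 j).norm_image_sub_le_of_norm_hasDerivWithin_le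
        (fun y _ => (hasDerivAt_besselEntire hν y).hasDerivWithinAt) hK
        (right_mem_Icc.2 hj.le) hx
      rwa [hj0, sub_zero, Real.norm_eq_abs, Real.norm_eq_abs, abs_sub_comm,
        abs_of_nonneg (by linarith [hx.2] : 0 ≤ j - x)] at this
    refine ⟨j ^ (2 * ν) * K ^ 2 * j * b ^ 2, by positivity, fun t ht => ?_⟩
    have hx : 0 < b * t := mul_pos hb0 ht.1
    have hlt : b * t < j := by rw [← hbr]; exact mul_lt_mul_of_pos_left ht.2 hb0
    have h1 : besselEntire ν (b * t) ^ 2 ≤ (K * (j - b * t)) ^ 2 := by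
      rw [← sq_abs]; gcongr; exact hE _ ⟨hx.le, hlt.le⟩
    have h2 : ((b * t) ^ (ν + 1 / 2)) ^ 2 ≤ j ^ (2 * ν) * (b * t) := by
      rw [← Real.rpow_natCast, ← Real.rpow_mul hx.le,
        show (ν + 1 / 2) * ((2 : ℕ) : ℝ) = 2 * ν + 1 by push_cast; ring,
        Real.rpow_add hx, Real.rpow_one]
      gcongr
    have h3 : (K * (j - b * t)) ^ 2 ≤ K ^ 2 * j * (j - b * t) := by
      rw [mul_pow, mul_assoc]
      have : (j - b * t) ^ 2 ≤ j * (j - b * t) := by nlinarith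
      gcongr
    calc besselNormal ν (b * t) ^ 2
        = ((b * t) ^ (ν + 1 / 2)) ^ 2 * besselEntire ν (b * t) ^ 2 := by
          rw [besselNormal, mul_pow]
      _ ≤ (j ^ (2 * ν) * (b * t)) * (K ^ 2 * j * (j - b * t)) := by
          gcongr; exact h1.trans h3
      _ = _ := by rw [← hbr]; ring

/-- For `a = 1` the Bessel operator is `-d²/dt²`. -/
theorem isBesselGroundState_sin {r : ℝ} (hr : 0 < r) :
    IsBesselGroundState 1 (π ^ 2 / r ^ 2) r (fun t => Real.sin (π / r * t))
      (fun t => Real.cos (π / r * t) * (π / r)) := by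
  have hπ := Real.pi_pos
  set b := π / r with hb
  have hb0 : 0 < b := by positivity
  have hbr : b * r = π := by rw [hb]; field_simp
  have hlin : ∀ t : ℝ, HasDerivAt (fun t => b * t) b t := fun t => by
    simpa using (hasDerivAt_id t).const_mul b
  have hlt : ∀ t ∈ Ioo 0 r, b * t < π := fun t ht => by
    rw [← hbr]; exact mul_lt_mul_of_pos_left ht.2 hb0
  refine ⟨fun t _ => (hlin t).sin, fun t _ => ?_, fun t ht => ?_, ?_, ?_⟩
  · refine ((hlin t).cos.mul_const b).congr_deriv ?_
    rw [← div_pow, ← hb]; simp; ring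
  · exact Real.sin_pos_of_pos_of_lt_pi (mul_pos hb0 ht.1) (hlt t ht)
  · have h1 : Tendsto (fun t : ℝ => t⁻¹ * Real.sin (b * t)) (𝓝[>] 0) (𝓝 b) := by
      have := ((hlin 0).sin).tendsto_slope_zero_right
      simpa using this
    have h2 : Tendsto (fun t : ℝ => Real.cos (b * t) * b) (𝓝[>] 0) (𝓝 b) := by
      have : Continuous fun t : ℝ => Real.cos (b * t) * b := by fun_prop
      have h := this.tendsto 0
      simp only [mul_zero, Real.cos_zero, one_mul] at h
      exact h.mono_left nhdsWithin_le_nhds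
    have h3 := h2.div h1 hb0.ne'
    rw [div_self hb0.ne'] at h3
    refine h3.congr fun t => ?_
    simp only [Pi.div_apply]
    rw [div_mul_eq_div_div, div_inv_eq_mul]
    ring
  · refine ⟨b ^ 2, by positivity, fun t ht => ?_⟩
    have hx : 0 < b * t := mul_pos hb0 ht.1
    have h0 := (Real.sin_pos_of_pos_of_lt_pi hx (hlt t ht)).le
    have h1 : Real.sin (b * t) ≤ b * t := Real.sin_le hx.le
    have h2 : Real.sin (b * t) ≤ b * (r - t) := by
      rw [← Real.sin_pi_sub, ← hbr, ← mul_sub]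
      exact Real.sin_le (mul_nonneg hb0.le (by linarith [ht.2]))
    calc Real.sin (b * t) ^ 2 = Real.sin (b * t) * Real.sin (b * t) := sq _
      _ ≤ (b * t) * (b * (r - t)) := mul_le_mul h1 h2 h0 hx.le
      _ = _ := by ring

/-! ### Comparison inequalities for `sin` and `sinh` -/

/-- `s` and `c = s'` solve `s'' = ε s`, `s 0 = 0`, `s' 0 = 1`: for `ε = 1` these are `sinh` and
`cosh`, for `ε = -1` they are `sin` and `cos`. The space form of curvature `-ε` has the metric
`dt² + s(t)² dω²` in geodesic polar coordinates. -/
structure IsWarp (ε : ℝ) (s c : ℝ → ℝ) : Prop where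
  hasDerivAt_s : ∀ t, HasDerivAt s (c t) t
  hasDerivAt_c : ∀ t, HasDerivAt c (ε * s t) t
  s_zero : s 0 = 0
  c_zero : c 0 = 1
  sq : ∀ t, ε * s t ^ 2 = c t ^ 2 - 1

theorem isWarp_sinh : IsWarp 1 Real.sinh Real.cosh where
  hasDerivAt_s := Real.hasDerivAt_sinh
  hasDerivAt_c t := by simpa using Real.hasDerivAt_cosh t
  s_zero := Real.sinh_zero
  c_zero := Real.cosh_zero
  sq t := by linarith [Real.cosh_sq t]

theorem isWarp_sin : IsWarp (-1) Real.sin Real.cos where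
  hasDerivAt_s := Real.hasDerivAt_sin
  hasDerivAt_c t := by simpa using Real.hasDerivAt_cos t
  s_zero := Real.sin_zero
  c_zero := Real.cos_zero
  sq t := by linarith [Real.sin_sq_add_cos_sq t]

namespace IsWarp

variable {ε : ℝ} {s c : ℝ → ℝ}

theorem continuous_s (h : IsWarp ε s c) : Continuous s :=
  continuous_iff_continuousAt.2 fun t => (h.hasDerivAt_s t).continuousAt

theorem continuous_c (h : IsWarp ε s c) : Continuous c :=
  continuous_iff_continuousAt.2 fun t => (h.hasDerivAt_c t).continuousAt

theorem tendsto_s_div (h : IsWarp ε s c) : Tendsto (fun t => s t / t) (𝓝[>] 0) (𝓝 1) := by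
  have := (h.hasDerivAt_s 0).tendsto_slope_zero_right
  simp only [zero_add, h.s_zero, sub_zero, h.c_zero, smul_eq_mul] at this
  exact this.congr fun t => by rw [div_eq_inv_mul]

/-- `s³ ≥ c t³`, the inequality of Mitrinović–Adamović for `sin` and of Lazarević for `sinh`: the
derivative of `s / c^{1/3} - t` is nonnegative by the inequality of the means. -/
theorem c_mul_cube_le (h : IsWarp ε s c) {t : ℝ} (ht : 0 < t) (hpos : ∀ x ∈ Ioc 0 t, 0 < s x) :
    c t * t ^ 3 ≤ s t ^ 3 := by
  have hst := hpos t ⟨ht, le_rfl⟩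
  rcases le_or_gt (c t) 0 with hct | hct
  · exact (mul_nonpos_of_nonpos_of_nonneg hct (by positivity)).trans (by positivity)
  have hs0 : ∀ x ∈ Icc 0 t, 0 ≤ s x := fun x hx => by
    rcases hx.1.eq_or_lt with h0 | h0
    · rw [← h0, h.s_zero]
    · exact (hpos x ⟨h0, hx.2⟩).le
  have hc : ∀ x ∈ Icc 0 t, 0 < c x := by
    intro x hx
    rcases le_total 0 ε with hε | hε
    · have hm : MonotoneOn c (Icc 0 t) := monotoneOn_of_hasDerivWithinAt_nonneg (convex_Icc _ _)
        h.continuous_c.continuousOn (fun x _ => (h.hasDerivAt_c x).hasDerivWithinAt)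
        fun x hx => mul_nonneg hε (hs0 x (interior_subset hx))
      have := hm (left_mem_Icc.2 ht.le) hx hx.1
      rw [h.c_zero] at this
      linarith
    · have hm : AntitoneOn c (Icc 0 t) := antitoneOn_of_hasDerivWithinAt_nonpos (convex_Icc _ _)
        h.continuous_c.continuousOn (fun x _ => (h.hasDerivAt_c x).hasDerivWithinAt)
        fun x hx => mul_nonpos_of_nonpos_of_nonneg hε (hs0 x (interior_subset hx))
      exact hct.trans_le (hm hx (right_mem_Icc.2 ht.le) hx.2)
  have hy : ∀ x ∈ Icc 0 t, 0 < c x ^ (1 / 3 : ℝ) ∧ (c x ^ (1 / 3 : ℝ)) ^ 3 = c x := by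
    intro x hx
    refine ⟨Real.rpow_pos_of_pos (hc x hx) _, ?_⟩
    rw [← Real.rpow_natCast, ← Real.rpow_mul (hc x hx).le]
    norm_num
  have hd : ∀ x ∈ Icc 0 t, HasDerivAt (fun x => s x / c x ^ (1 / 3 : ℝ) - x)
      ((2 * (c x ^ (1 / 3 : ℝ)) ^ 6 + 1) / (3 * (c x ^ (1 / 3 : ℝ)) ^ 4) - 1) x := by
    intro x hx
    obtain ⟨hy0, hy3⟩ := hy x hx
    have hcx := hc x hx
    have h1 : HasDerivAt (fun x => c x ^ (1 / 3 : ℝ))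
        (c x ^ (1 / 3 : ℝ) * (1 / 3 / c x) * (ε * s x)) x :=
      (hasDerivAt_rpow_div (1 / 3) hcx).comp x (h.hasDerivAt_c x)
    refine (((h.hasDerivAt_s x).div h1 hy0.ne').sub (hasDerivAt_id x)).congr_deriv ?_
    generalize c x ^ (1 / 3 : ℝ) = y at hy0 hy3
    have hsq := h.sq x
    rw [← hy3] at hsq ⊢
    have hyn := hy0.ne'
    congr 1
    field_simp
    linear_combination (-1) * hsq
  have hmono : MonotoneOn (fun x => s x / c x ^ (1 / 3 : ℝ) - x) (Icc 0 t) := by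
    refine monotoneOn_of_hasDerivWithinAt_nonneg (convex_Icc _ _)
      (fun x hx => (hd x hx).continuousAt.continuousWithinAt)
      (fun x hx => (hd x (interior_subset hx)).hasDerivWithinAt) fun x hx => ?_
    obtain ⟨hy0, -⟩ := hy x (interior_subset hx)
    generalize c x ^ (1 / 3 : ℝ) = y at hy0
    rw [sub_nonneg, le_div_iff₀ (by positivity)]
    nlinarith [mul_nonneg (sq_nonneg (y ^ 2 - 1)) (by positivity : 0 ≤ 2 * y ^ 2 + 1)]
  have := hmono (left_mem_Icc.2 ht.le) (right_mem_Icc.2 ht.le) ht.le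
  simp only [h.s_zero, zero_div, sub_zero, sub_nonneg] at this
  obtain ⟨hy0, hy3⟩ := hy t (right_mem_Icc.2 ht.le)
  rw [le_div_iff₀ hy0] at this
  calc c t * t ^ 3 = (t * c t ^ (1 / 3 : ℝ)) ^ 3 := by rw [mul_pow, hy3]; ring
    _ ≤ s t ^ 3 := by gcongr

theorem monotoneOn_inv_sq_sub (h : IsWarp ε s c) {r : ℝ} (hpos : ∀ x ∈ Ioc 0 r, 0 < s x) :
    MonotoneOn (fun t => 1 / s t ^ 2 - 1 / t ^ 2) (Ioc 0 r) := by
  have hd : ∀ t ∈ Ioc 0 r, HasDerivAt (fun t => 1 / s t ^ 2 - 1 / t ^ 2)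
      (2 / t ^ 3 - 2 * c t / s t ^ 3) t := by
    intro t ht
    have hs := (hpos t ht).ne'
    have ht0 := ht.1.ne'
    have h1 := ((h.hasDerivAt_s t).pow 2).inv (pow_ne_zero 2 hs)
    have h2 := (hasDerivAt_pow 2 t).inv (pow_ne_zero 2 ht0)
    simp only [one_div]
    refine (h1.sub h2).congr_deriv ?_
    simp only [Pi.pow_apply]
    push_cast
    field_simp
    ring
  refine monotoneOn_of_hasDerivWithinAt_nonneg (convex_Ioc _ _)
    (fun t ht => (hd t ht).continuousAt.continuousWithinAt)
    (fun t ht => (hd t (interior_subset ht)).hasDerivWithinAt) fun t ht => ?_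
  have ht' := interior_subset ht
  have hs := hpos t ht'
  have ht0 : 0 < t := ht'.1
  have := h.c_mul_cube_le ht'.1 fun x hx => hpos x ⟨hx.1, hx.2.trans ht'.2⟩
  rw [sub_nonneg, div_le_div_iff₀ (by positivity) (by positivity)]
  linarith

/-- `-ε / 3` is the limit of `1 / s² - 1 / t²` at `0`; the bound says that `t - s / √((2 + c²) / 3)`
is nonnegative, and its derivative is nonnegative by the inequality of the means. -/
theorem neg_third_le_inv_sq_sub (h : IsWarp ε s c) {t : ℝ} (ht : 0 < t)
    (hst : 0 < s t) : -(ε / 3) ≤ 1 / s t ^ 2 - 1 / t ^ 2 := by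
  set q : ℝ → ℝ := fun x => √((2 + c x ^ 2) / 3) with hq
  have hq0 : ∀ x, 0 < q x := fun x => Real.sqrt_pos.2 (by positivity)
  have hq2 : ∀ x, q x ^ 2 = (2 + c x ^ 2) / 3 := fun x => Real.sq_sqrt (by positivity)
  have hd : ∀ x, HasDerivAt (fun x => x - s x / q x) (1 - c x / q x ^ 3) x := by
    intro x
    have h1 : HasDerivAt q ((2 * c x * (ε * s x) / 3) / (2 * q x)) x := by
      have := ((((h.hasDerivAt_c x).pow 2).const_add 2).div_const 3).sqrt
        (show (2 + c x ^ 2) / 3 ≠ 0 by positivity)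
      refine this.congr_deriv ?_
      simp [hq]
    refine ((hasDerivAt_id x).sub ((h.hasDerivAt_s x).div h1 (hq0 x).ne')).congr_deriv ?_
    have hqx := (hq0 x).ne'
    congr 1
    field_simp
    linear_combination 3 * c x * hq2 x - c x * h.sq x
  have hmono : MonotoneOn (fun x => x - s x / q x) (Icc 0 t) := by
    refine monotoneOn_of_hasDerivWithinAt_nonneg (convex_Icc _ _)
      (fun x _ => (hd x).continuousAt.continuousWithinAt)
      (fun x _ => (hd x).hasDerivWithinAt) fun x _ => ?_
    rw [sub_nonneg, div_le_one (pow_pos (hq0 x) 3)]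
    refine le_of_abs_le (abs_le_of_sq_le_sq ?_ (pow_pos (hq0 x) 3).le)
    rw [← pow_mul, mul_comm 3 2, pow_mul, hq2]
    have : 0 ≤ c x ^ 2 := sq_nonneg _
    generalize c x ^ 2 = y at this
    nlinarith [mul_nonneg (sq_nonneg (y - 1)) (by linarith : 0 ≤ y + 8)]
  have := hmono (left_mem_Icc.2 ht.le) (right_mem_Icc.2 ht.le) ht.le
  simp only [h.s_zero, zero_div, sub_zero, sub_nonneg] at this
  rw [div_le_iff₀ (hq0 t)] at this
  have h2 : s t ^ 2 ≤ t ^ 2 * (1 + ε * s t ^ 2 / 3) := by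
    calc s t ^ 2 ≤ (t * q t) ^ 2 := by gcongr
      _ = _ := by rw [mul_pow, hq2, h.sq]; ring
  have h3 : 1 / t ^ 2 ≤ 1 / s t ^ 2 + ε / 3 := by
    have e : 1 / s t ^ 2 + ε / 3 = (1 + ε * s t ^ 2 / 3) / s t ^ 2 := by field_simp
    rw [e, div_le_div_iff₀ (by positivity) (by positivity)]
    linarith
  linarith

end IsWarp

/-! ### The one-dimensional problem along a ray -/

section Radial

variable {ε κ r : ℝ} {d : ℕ} {s c G G' : ℝ → ℝ}

/-- The coefficient `q` for which the positive radial function `φ = s^{-d/2} G` solves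
`-(s^d φ')' = q s^d φ`. -/
noncomputable def radialPotential (ε κ : ℝ) (d : ℕ) (s : ℝ → ℝ) (t : ℝ) : ℝ :=
  κ + (d / 2 : ℝ) * (d / 2 - 1) * (1 / s t ^ 2 - 1 / t ^ 2) + ε * (d / 2 : ℝ) ^ 2

/-- The logarithmic derivative of `s^{-d/2} G`. -/
noncomputable def radialLogDeriv (d : ℕ) (s c G G' : ℝ → ℝ) (t : ℝ) : ℝ :=
  G' t / G t - (d / 2 : ℝ) * (c t / s t)

/-- The Riccati equation of the logarithmic derivative. -/
theorem hasDerivAt_radialLogDeriv (h : IsWarp ε s c)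
    (hG : IsBesselGroundState (d / 2) κ r G G') {t : ℝ} (ht : t ∈ Ioo 0 r) (hs : s t ≠ 0) :
    HasDerivAt (radialLogDeriv d s c G G')
      (-radialPotential ε κ d s t - radialLogDeriv d s c G G' t ^ 2
        - d * (c t / s t) * radialLogDeriv d s c G G' t) t := by
  have hGt := (hG.pos t ht).ne'
  have ht0 := ht.1.ne'
  have h1 := (hG.hasDerivAt_deriv t ht.1).div (hG.hasDerivAt t ht.1) hGt
  have h2 := ((h.hasDerivAt_c t).div (h.hasDerivAt_s t) hs).const_mul (d / 2 : ℝ)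
  refine (h1.sub h2).congr_deriv ?_
  unfold radialLogDeriv radialPotential
  have hsq := h.sq t
  field_simp
  linear_combination (d ^ 2 - 2 * d) * t ^ 2 * G t ^ 2 * hsq

/-- The derivative of `H s^d f²`, where `H = φ'/φ` is the logarithmic derivative of
`φ = s^{-d/2} G`: the two terms `d (s'/s) H` cancel, and a square is completed. -/
theorem hasDerivAt_radialLogDeriv_mul (h : IsWarp ε s c)
    (hG : IsBesselGroundState (d / 2) κ r G G') (hd : 1 ≤ d) {t : ℝ} (ht : t ∈ Ioo 0 r)
    (hs : s t ≠ 0) {f : ℝ → ℝ} {f' : ℝ} (hf : HasDerivAt f f' t) :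
    HasDerivAt (fun t => radialLogDeriv d s c G G' t * s t ^ d * f t ^ 2)
      ((f' ^ 2 - radialPotential ε κ d s t * f t ^ 2
        - (f' - radialLogDeriv d s c G G' t * f t) ^ 2) * s t ^ d) t := by
  refine (((hasDerivAt_radialLogDeriv h hG ht hs).mul ((h.hasDerivAt_s t).pow d)).mul
    (hf.pow 2)).congr_deriv ?_
  obtain ⟨e, rfl⟩ : ∃ e, d = e + 1 := ⟨d - 1, by omega⟩
  simp only [Pi.mul_apply, Pi.pow_apply, Nat.add_sub_cancel]
  generalize radialLogDeriv (e + 1) s c G G' t = H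
  rw [pow_succ]
  push_cast
  field_simp
  ring

/-- Jacobi's form of the Dirichlet principle on a ray: since `H = φ'/φ` for the positive `φ`,
the derivative of `H s^d f²` is `(f'² - q f²) s^d` minus a square, and there is no contribution
from the endpoint `0`, where `t H → 0`. -/
theorem mul_integral_sq_le (h : IsWarp ε s c) (hG : IsBesselGroundState (d / 2) κ r G G')
    (hd : 1 ≤ d) (hpos : ∀ t ∈ Ioc 0 r, 0 < s t) {μ : ℝ}
    (hμ : ∀ t ∈ Ioo 0 r, μ ≤ radialPotential ε κ d s t) {f f' : ℝ → ℝ}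
    (hf : ∀ t, HasDerivAt f (f' t) t) (hf' : Continuous f') {R : ℝ} (hR : R ∈ Ioo 0 r)
    (hfR : f R = 0) :
    μ * ∫ t in (0)..R, f t ^ 2 * s t ^ d ≤ ∫ t in (0)..R, f' t ^ 2 * s t ^ d := by
  have hfc : Continuous f := continuous_iff_continuousAt.2 fun t => (hf t).continuousAt
  have hsc := h.continuous_s
  have hIoo : ∀ t ∈ Ioc 0 R, t ∈ Ioo 0 r := fun t ht => ⟨ht.1, ht.2.trans_lt hR.2⟩
  set Y : ℝ → ℝ := fun t => radialLogDeriv d s c G G' t * s t ^ d * f t ^ 2 with hY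
  have hYd : ∀ t ∈ Ioc 0 R, HasDerivAt Y ((f' t ^ 2 - radialPotential ε κ d s t * f t ^ 2
        - (f' t - radialLogDeriv d s c G G' t * f t) ^ 2) * s t ^ d) t := fun t ht =>
    hasDerivAt_radialLogDeriv_mul h hG hd (hIoo t ht) (hpos t ⟨ht.1, (hIoo t ht).2.le⟩).ne' (hf t)
  have hY0 : Y 0 = 0 := by
    simp only [hY, h.s_zero]
    rw [zero_pow (by omega)]
    simp
  have hlim : Tendsto Y (𝓝[>] 0) (𝓝 (Y 0)) := by
    rw [hY0]
    have hc0 : Tendsto c (𝓝[>] 0) (𝓝 1) := by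
      have := h.continuous_c.tendsto 0
      rw [h.c_zero] at this
      exact this.mono_left nhdsWithin_le_nhds
    have h1 := (h.tendsto_s_div.mul hG.tendsto).sub (hc0.const_mul (d / 2 : ℝ))
    have h2 : Tendsto (fun t => s t ^ (d - 1) * f t ^ 2) (𝓝[>] 0) (𝓝 (s 0 ^ (d - 1) * f 0 ^ 2)) :=
      ((by fun_prop : Continuous fun t => s t ^ (d - 1) * f t ^ 2).tendsto 0).mono_left
        nhdsWithin_le_nhds
    have h3 := h1.mul h2
    rw [one_mul, mul_one, sub_self, zero_mul] at h3
    refine h3.congr' ?_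
    filter_upwards [Ioo_mem_nhdsGT (hR.1.trans hR.2)] with t ht
    have hst := (hpos t ⟨ht.1, ht.2.le⟩).ne'
    have ht0 := ht.1.ne'
    obtain ⟨e, rfl⟩ : ∃ e, d = e + 1 := ⟨d - 1, by omega⟩
    simp only [hY, radialLogDeriv, Nat.add_sub_cancel, pow_succ _ e]
    field_simp
  have hcont : ContinuousOn Y (Icc 0 R) := by
    intro t ht
    rcases ht.1.eq_or_lt with h0 | h0
    · rw [← h0]
      have : ContinuousWithinAt Y (Ioi 0) 0 := hlim
      exact (continuousWithinAt_Ioi_iff_Ici.1 this).mono Icc_subset_Ici_self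
    · exact (hYd t ⟨h0, ht.2⟩).continuousAt.continuousWithinAt
  have hφ : Continuous fun t => f' t ^ 2 * s t ^ d - μ * (f t ^ 2 * s t ^ d) := by fun_prop
  have key := intervalIntegral.sub_le_integral_of_hasDeriv_right_of_le hR.1.le hcont
    (fun t ht => (hYd t (Ioo_subset_Ioc_self ht)).hasDerivWithinAt)
    (hφ.continuousOn.integrableOn_Icc) (fun t ht => by
      have htr := hIoo t (Ioo_subset_Ioc_self ht)
      have hst := hpos t ⟨htr.1, htr.2.le⟩
      have : μ * f t ^ 2 ≤ radialPotential ε κ d s t * f t ^ 2 := by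
        gcongr; exact hμ t htr
      rw [← mul_assoc, ← sub_mul]
      refine mul_le_mul_of_nonneg_right ?_ (by positivity)
      linarith [sq_nonneg (f' t - radialLogDeriv d s c G G' t * f t)])
  have hYR : Y R = 0 := by simp [hY, hfR]
  rw [hYR, hY0, intervalIntegral.integral_sub, intervalIntegral.integral_const_mul] at key
  · linarith
  · exact (by fun_prop : Continuous fun t => f' t ^ 2 * s t ^ d).intervalIntegrable _ _
  · exact (by fun_prop : Continuous fun t => μ * (f t ^ 2 * s t ^ d)).intervalIntegrable _ _

/-- A ground state is smooth, by bootstrapping its differential equation. -/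
theorem IsBesselGroundState.contDiffOn {a : ℝ} (hG : IsBesselGroundState a κ r G G') :
    ContDiffOn ℝ ∞ G (Ioi 0) := by
  rw [contDiffOn_infty]
  have key : ∀ n : ℕ, ContDiffOn ℝ n G (Ioi 0) ∧ ContDiffOn ℝ n G' (Ioi 0) := by
    intro n
    induction n with
    | zero =>
      exact ⟨contDiffOn_zero.2 fun t ht => (hG.hasDerivAt t ht).continuousAt.continuousWithinAt,
        contDiffOn_zero.2 fun t ht => (hG.hasDerivAt_deriv t ht).continuousAt.continuousWithinAt⟩
    | succ n ih =>
      have hcoef : ContDiffOn ℝ n (fun t : ℝ => a * (a - 1) / t ^ 2 - κ) (Ioi 0) :=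
        (contDiffOn_const.div (contDiffOn_id.pow 2)
          fun t (ht : 0 < t) => pow_ne_zero 2 ht.ne').sub contDiffOn_const
      constructor
      · push_cast
        rw [contDiffOn_succ_iff_deriv_of_isOpen isOpen_Ioi]
        refine ⟨fun t ht => (hG.hasDerivAt t ht).differentiableAt.differentiableWithinAt,
          by simp, ih.2.congr fun t ht => (hG.hasDerivAt t ht).deriv⟩
      · push_cast
        rw [contDiffOn_succ_iff_deriv_of_isOpen isOpen_Ioi]
        refine ⟨fun t ht => (hG.hasDerivAt_deriv t ht).differentiableAt.differentiableWithinAt,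
          by simp, (hcoef.mul ih.1).congr fun t ht => (hG.hasDerivAt_deriv t ht).deriv⟩
  exact fun n => (key n).1

/-- The coordinate `log (t / (r - t))` identifies `(0, r)` with the real line. -/
noncomputable def logit (r t : ℝ) : ℝ := Real.log t - Real.log (r - t)

theorem hasDerivAt_logit {t : ℝ} (ht : t ∈ Ioo 0 r) :
    HasDerivAt (logit r) (r / (t * (r - t))) t := by
  have h2 : r - t ≠ 0 := (sub_pos.2 ht.2).ne'
  have h1 := ht.1.ne'
  refine ((Real.hasDerivAt_log h1).sub
    (((hasDerivAt_id t).const_sub r).log h2)).congr_deriv ?_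
  simp only [id_eq]
  field_simp
  ring

theorem contDiffAt_logit {t : ℝ} (ht : t ∈ Ioo 0 r) : ContDiffAt ℝ ∞ (logit r) t :=
  (Real.contDiffAt_log.2 ht.1.ne').sub
    ((contDiffAt_const.sub contDiffAt_id).log (sub_pos.2 ht.2).ne')

theorem mem_Ioo_of_abs_logit_lt {t k : ℝ} (ht : t ∈ Ioo 0 r) (hk : |logit r t| < k) :
    t ∈ Ioo (r / (1 + Real.exp k)) (r - r / (1 + Real.exp k)) := by
  have hrt : 0 < r - t := sub_pos.2 ht.2
  obtain ⟨h1, h2⟩ := abs_lt.1 hk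
  unfold logit at h1 h2
  have e1 : r - t < t * Real.exp k := by
    rw [← Real.log_lt_log_iff hrt (mul_pos ht.1 (Real.exp_pos k)),
      Real.log_mul ht.1.ne' (Real.exp_pos k).ne', Real.log_exp]
    linarith
  have e2 : t < (r - t) * Real.exp k := by
    rw [← Real.log_lt_log_iff ht.1 (mul_pos hrt (Real.exp_pos k)),
      Real.log_mul hrt.ne' (Real.exp_pos k).ne', Real.log_exp]
    linarith
  have hpos : 0 < 1 + Real.exp k := by positivity
  constructor
  · rw [div_lt_iff₀ hpos]; linarith
  · rw [lt_sub_comm, div_lt_iff₀ hpos]; linarith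

theorem abs_logit_le {t k : ℝ} (hr : 0 < r)
    (ht : t ∈ Icc (r / (1 + Real.exp k)) (r - r / (1 + Real.exp k))) : |logit r t| ≤ k := by
  have hpos : 0 < 1 + Real.exp k := by positivity
  have h0 : 0 < r / (1 + Real.exp k) := by positivity
  have ht0 : 0 < t := h0.trans_le ht.1
  have hrt : 0 < r - t := by linarith [ht.2]
  have h1 := ht.1
  have h2 : r / (1 + Real.exp k) ≤ r - t := by linarith [ht.2]
  rw [div_le_iff₀ hpos] at h1 h2
  unfold logit
  have e1 : Real.log (r - t) ≤ Real.log t + k := by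
    have := Real.log_le_log hrt (by linarith : r - t ≤ t * Real.exp k)
    rwa [Real.log_mul ht0.ne' (Real.exp_pos k).ne', Real.log_exp] at this
  have e2 : Real.log t ≤ Real.log (r - t) + k := by
    have := Real.log_le_log ht0 (by linarith : t ≤ (r - t) * Real.exp k)
    rwa [Real.log_mul hrt.ne' (Real.exp_pos k).ne', Real.log_exp] at this
  rw [abs_le]
  constructor <;> linarith

/-- Trial functions: `φ = s^{-d/2} G` is cut off near both ends of `(0, r)` at scale `k` in the
coordinate `logit`. As `G² ≤ C t (r - t)`, the cut-off contributes only `O (1 / k)` to the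
energy. -/
theorem exists_trial_function (h : IsWarp ε s c) (hG : IsBesselGroundState (d / 2) κ r G G')
    (hd : 1 ≤ d) (hr : 0 < r) (hpos : ∀ t ∈ Ioc 0 r, 0 < s t) {μ : ℝ}
    (hμ : ∀ t ∈ Ioo 0 r, radialPotential ε κ d s t ≤ μ) {δ : ℝ} (hδ : 0 < δ) :
    ∃ (f : ℝ → ℝ) (t₁ t₂ : ℝ), ContDiff ℝ ∞ f ∧ 0 < t₁ ∧ t₁ < t₂ ∧ t₂ < r ∧
      (∀ t, t ∉ Ioo t₁ t₂ → f t = 0) ∧ 0 < ∫ t in t₁..t₂, f t ^ 2 * s t ^ d ∧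
      ∫ t in t₁..t₂, deriv f t ^ 2 * s t ^ d
        ≤ (μ + δ) * ∫ t in t₁..t₂, f t ^ 2 * s t ^ d := by
  have hsc := h.continuous_s
  have hGc : ∀ t ∈ Ioo 0 r, ContDiffAt ℝ ∞ G t := fun t ht =>
    hG.contDiffOn.contDiffAt (Ioi_mem_nhds ht.1)
  obtain ⟨C, hC0, hC⟩ := hG.bound
  let B : ContDiffBump (0 : ℝ) := ⟨1, 2, one_pos, one_lt_two⟩
  have hBc : ContDiff ℝ ∞ B := B.contDiff
  obtain ⟨L, hL⟩ := (hBc.continuous_deriv (by simp)).bounded_above_of_compact_support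
    B.hasCompactSupport.deriv
  have hL0 : 0 ≤ L := (norm_nonneg _).trans (hL 0)
  have hIcc : ∀ t ∈ Icc (r / 2) (2 * r / 3), t ∈ Ioo 0 r := fun t ht =>
    ⟨by linarith [ht.1], by linarith [ht.2]⟩
  -- a lower bound, independent of the cut-off, for the square norm
  set B₀ := ∫ t in (r / 2)..(2 * r / 3), G t ^ 2 with hB₀
  have hB₀pos : 0 < B₀ := by
    refine intervalIntegral.intervalIntegral_pos_of_pos_on
      (ContinuousOn.intervalIntegrable_of_Icc (by linarith) fun t ht =>
        ((hGc t (hIcc t ht)).continuousAt.pow 2).continuousWithinAt)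
      (fun t ht => pow_pos (hG.pos t (hIcc t (Ioo_subset_Icc_self ht))) 2) (by linarith)
  obtain ⟨k, hk1, hk⟩ : ∃ k : ℝ, 1 ≤ k ∧ 4 * C * L ^ 2 * r / k ≤ δ * B₀ := by
    refine ⟨max 1 (4 * C * L ^ 2 * r / (δ * B₀)), le_max_left _ _, ?_⟩
    rw [div_le_iff₀ (lt_max_of_lt_left one_pos), mul_comm (δ * B₀),
      ← div_le_iff₀ (by positivity)]
    exact le_max_right _ _
  have hk0 : 0 < k := by linarith
  set E := 1 + Real.exp (2 * k) with hE
  have hE3 : 3 ≤ E := by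
    have := Real.add_one_lt_exp (show 2 * k ≠ 0 by positivity)
    linarith
  set t₁ := r / E with ht₁
  set t₂ := r - r / E with ht₂
  have ht₁0 : 0 < t₁ := by positivity
  have ht₁3 : t₁ ≤ r / 3 := div_le_div_of_nonneg_left hr.le (by norm_num) hE3
  have hsub : ∀ t ∈ Icc t₁ t₂, t ∈ Ioo 0 r := fun t ht =>
    ⟨ht₁0.trans_le ht.1, by linarith [ht.2]⟩
  set η : ℝ → ℝ := fun t => B (logit r t / k) with hη
  set P : ℝ → ℝ := fun t => (√(s t))⁻¹ ^ d with hP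
  set f : ℝ → ℝ := (Ioo 0 r).indicator fun t => P t * G t * η t with hf
  have hfin : ∀ t ∈ Ioo 0 r, f t = P t * G t * η t := fun t ht => indicator_of_mem ht _
  have hηout : ∀ t ∈ Ioo 0 r, t ∉ Ioo t₁ t₂ → η t = 0 := by
    intro t ht hn
    refine B.zero_of_le_dist ?_
    rw [dist_zero_right, Real.norm_eq_abs, abs_div, abs_of_pos hk0]
    show 2 ≤ _
    rw [le_div_iff₀ hk0]
    by_contra hcon
    exact hn (mem_Ioo_of_abs_logit_lt ht (not_le.1 hcon))
  have hfout : ∀ t, t ∉ Ioo t₁ t₂ → f t = 0 := by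
    intro t hn
    by_cases ht : t ∈ Ioo 0 r
    · rw [hfin t ht, hηout t ht hn, mul_zero]
    · exact indicator_of_notMem ht _
  have hsr : ∀ t ∈ Ioo 0 r, 0 < s t := fun t ht => hpos t ⟨ht.1, ht.2.le⟩
  have hsC : ContDiff ℝ ∞ s := by
    rw [contDiff_infty]
    have key : ∀ n : ℕ, ContDiff ℝ n s ∧ ContDiff ℝ n c := by
      intro n
      induction n with
      | zero => exact ⟨contDiff_zero.2 h.continuous_s, contDiff_zero.2 h.continuous_c⟩
      | succ n ih =>
        constructor
        · push_cast
          rw [contDiff_succ_iff_deriv]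
          refine ⟨fun t => (h.hasDerivAt_s t).differentiableAt, by simp, ?_⟩
          rw [show deriv s = c from funext fun t => (h.hasDerivAt_s t).deriv]
          exact ih.2
        · push_cast
          rw [contDiff_succ_iff_deriv]
          refine ⟨fun t => (h.hasDerivAt_c t).differentiableAt, by simp, ?_⟩
          rw [show deriv c = fun t => ε * s t from funext fun t => (h.hasDerivAt_c t).deriv]
          exact contDiff_const.mul ih.1
    exact fun n => (key n).1
  have hηC : ∀ t ∈ Ioo 0 r, ContDiffAt ℝ ∞ η t := fun t ht =>
    hBc.contDiffAt.comp t ((contDiffAt_logit ht).div_const k)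
  have hPC : ∀ t ∈ Ioo 0 r, ContDiffAt ℝ ∞ P t := fun t ht =>
    ((hsC.contDiffAt.sqrt (hsr t ht).ne').inv (Real.sqrt_pos.2 (hsr t ht)).ne').pow d
  have hfC : ContDiff ℝ ∞ f := by
    rw [contDiff_iff_contDiffAt]
    intro t
    by_cases ht : t ∈ Icc t₁ t₂
    · have ht' := hsub t ht
      refine (((hPC t ht').mul (hGc t ht')).mul (hηC t ht')).congr_of_eventuallyEq ?_
      filter_upwards [Ioo_mem_nhds ht'.1 ht'.2] with x hx using hfin x hx
    · refine (contDiffAt_const (c := (0 : ℝ))).congr_of_eventuallyEq ?_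
      filter_upwards [isClosed_Icc.isOpen_compl.mem_nhds ht] with x hx
      exact hfout x fun hx' => hx (Ioo_subset_Icc_self hx')
  have hP2 : ∀ t ∈ Ioo 0 r, P t ^ 2 * s t ^ d = 1 := by
    intro t ht
    rw [hP, ← pow_mul, mul_comm d 2, pow_mul, inv_pow, Real.sq_sqrt (hsr t ht).le, ← mul_pow,
      inv_mul_cancel₀ (hsr t ht).ne', one_pow]
  have hPd : ∀ t ∈ Ioo 0 r, HasDerivAt P (-(d / 2 : ℝ) * (c t / s t) * P t) t := by
    intro t ht
    have hst := hsr t ht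
    have hq := (Real.sqrt_pos.2 hst).ne'
    refine ((((h.hasDerivAt_s t).sqrt hst.ne').inv hq).pow d).congr_deriv ?_
    obtain ⟨e, rfl⟩ : ∃ e, d = e + 1 := ⟨d - 1, by omega⟩
    simp only [hP, Pi.inv_apply, Nat.add_sub_cancel, pow_succ _ e]
    have hs2 : s t = √(s t) ^ 2 := (Real.sq_sqrt hst.le).symm
    generalize √(s t) = q at hq hs2
    rw [hs2]
    field_simp
  have hηd : ∀ t ∈ Ioo 0 r,
      HasDerivAt η (deriv B (logit r t / k) * (r / (t * (r - t)) / k)) t := fun t ht =>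
    ((hBc.differentiable (by simp)) _).hasDerivAt.comp t ((hasDerivAt_logit ht).div_const k)
  have hfd : ∀ t ∈ Ioo 0 r, (deriv f t - radialLogDeriv d s c G G' t * f t) ^ 2 * s t ^ d
      = G t ^ 2 * (deriv B (logit r t / k) * (r / (t * (r - t)) / k)) ^ 2 := by
    intro t ht
    have h1 := ((hPd t ht).mul (hG.hasDerivAt t ht.1)).mul (hηd t ht)
    have h2 : deriv f t = _ := (h1.congr_of_eventuallyEq (by
      filter_upwards [Ioo_mem_nhds ht.1 ht.2] with x hx using hfin x hx)).deriv
    have hGt := (hG.pos t ht).ne'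
    have h3 : deriv f t - radialLogDeriv d s c G G' t * f t
        = P t * (G t * (deriv B (logit r t / k) * (r / (t * (r - t)) / k))) := by
      rw [h2, hfin t ht, radialLogDeriv]
      simp only [Pi.mul_apply]
      generalize deriv B (logit r t / k) * (r / (t * (r - t)) / k) = D
      generalize c t / s t = X
      field_simp
      ring
    rw [h3, mul_pow, mul_right_comm, hP2 t ht, one_mul, mul_pow]
  have hfcont : Continuous f := hfC.continuous
  have hdfcont : Continuous (deriv f) := hfC.continuous_deriv (by simp)
  have hf1 : f t₁ = 0 := hfout t₁ fun hx => lt_irrefl _ hx.1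
  have hf2 : f t₂ = 0 := hfout t₂ fun hx => lt_irrefl _ hx.2
  have ht12 : t₁ < t₂ := by rw [ht₂, ← ht₁]; linarith
  -- the square norm is bounded below by `B₀`
  have hnorm : B₀ ≤ ∫ t in t₁..t₂, f t ^ 2 * s t ^ d := by
    have e : B₀ = ∫ t in (r / 2)..(2 * r / 3), f t ^ 2 * s t ^ d := by
      refine intervalIntegral.integral_congr fun t ht => ?_
      rw [uIcc_of_le (by linarith)] at ht
      have ht' := hIcc t ht
      have hη1 : η t = 1 := by
        refine B.one_of_mem_closedBall ?_
        rw [mem_closedBall_zero_iff, Real.norm_eq_abs]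
        show _ ≤ (1 : ℝ)
        rw [abs_div, abs_of_pos hk0, div_le_one hk0]
        refine le_trans ?_ hk1
        have hrt : 0 < r - t := sub_pos.2 ht'.2
        have h1 : Real.log (r - t) ≤ Real.log t := Real.log_le_log hrt (by linarith [ht.1])
        have h2 : Real.log (t / (r - t)) ≤ t / (r - t) - 1 :=
          Real.log_le_sub_one_of_pos (div_pos ht'.1 hrt)
        have h3 : t / (r - t) ≤ 2 := by rw [div_le_iff₀ hrt]; linarith [ht.2]
        rw [Real.log_div ht'.1.ne' hrt.ne'] at h2
        rw [logit, abs_of_nonneg (by linarith)]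
        linarith
      rw [hfin t ht', hη1, mul_one, mul_pow, mul_right_comm, hP2 t ht', one_mul]
    rw [e]
    refine intervalIntegral.integral_mono_interval (by linarith) (by linarith)
      (by rw [ht₂, ← ht₁]; linarith) ?_
      ((by fun_prop : Continuous fun t => f t ^ 2 * s t ^ d).intervalIntegrable _ _)
    refine (ae_restrict_mem measurableSet_Ioc).mono fun t ht => ?_
    have := hsr t (hsub t (Ioc_subset_Icc_self ht))
    show 0 ≤ f t ^ 2 * s t ^ d
    positivity
  refine ⟨f, t₁, t₂, hfC, ht₁0, ht12, by rw [ht₂, ← ht₁]; linarith, hfout,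
    hB₀pos.trans_le hnorm, ?_⟩
  set Z : ℝ → ℝ := fun t => -(radialLogDeriv d s c G G' t * s t ^ d * f t ^ 2)
    - C * L ^ 2 * r / k ^ 2 * logit r t with hZ
  have hZd : ∀ t ∈ Icc t₁ t₂, HasDerivAt Z
      (-((deriv f t ^ 2 - radialPotential ε κ d s t * f t ^ 2
        - (deriv f t - radialLogDeriv d s c G G' t * f t) ^ 2) * s t ^ d)
        - C * L ^ 2 * r / k ^ 2 * (r / (t * (r - t)))) t := fun t ht =>
    (hasDerivAt_radialLogDeriv_mul h hG hd (hsub t ht) (hsr t (hsub t ht)).ne'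
      ((hfC.differentiable (by simp)) t).hasDerivAt).neg.sub
      ((hasDerivAt_logit (hsub t ht)).const_mul _)
  have hφ : Continuous fun t => μ * (f t ^ 2 * s t ^ d) - deriv f t ^ 2 * s t ^ d := by fun_prop
  have key := intervalIntegral.sub_le_integral_of_hasDeriv_right_of_le ht12.le
    (fun t ht => (hZd t ht).continuousAt.continuousWithinAt)
    (fun t ht => (hZd t (Ioo_subset_Icc_self ht)).hasDerivWithinAt)
    (hφ.continuousOn.integrableOn_Icc) (fun t ht => by
      have htr := hsub t (Ioo_subset_Icc_self ht)
      have hst := hsr t htr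
      have hrt : 0 < r - t := sub_pos.2 htr.2
      have ht0 := htr.1
      have h1 : radialPotential ε κ d s t * f t ^ 2 * s t ^ d ≤ μ * f t ^ 2 * s t ^ d := by
        gcongr; exact hμ t htr
      have h2 : G t ^ 2 * (deriv B (logit r t / k) * (r / (t * (r - t)) / k)) ^ 2
          ≤ C * L ^ 2 * r / k ^ 2 * (r / (t * (r - t))) := by
        have hB : deriv B (logit r t / k) ^ 2 ≤ L ^ 2 := by
          rw [← sq_abs]; gcongr; exact hL _
        calc G t ^ 2 * (deriv B (logit r t / k) * (r / (t * (r - t)) / k)) ^ 2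
            ≤ (C * (t * (r - t))) * (L ^ 2 * (r / (t * (r - t)) / k) ^ 2) := by
              rw [mul_pow]
              gcongr
              exact hC t htr
          _ = _ := by field_simp
      have h3 := hfd t htr
      nlinarith)
  have hZ12 : -(4 * C * L ^ 2 * r / k) ≤ Z t₂ - Z t₁ := by
    have hl1 := (abs_le.1 (abs_logit_le hr
      (left_mem_Icc.2 ht12.le : t₁ ∈ Icc t₁ t₂))).1
    have hl2 := (abs_le.1 (abs_logit_le hr
      (right_mem_Icc.2 ht12.le : t₂ ∈ Icc t₁ t₂))).2
    have hc0 : 0 ≤ C * L ^ 2 * r / k ^ 2 := by positivity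
    have e : 4 * C * L ^ 2 * r / k = C * L ^ 2 * r / k ^ 2 * (4 * k) := by field_simp
    have := mul_le_mul_of_nonneg_left (by linarith : logit r t₂ - logit r t₁ ≤ 4 * k) hc0
    simp only [hZ, hf1, hf2]
    rw [e]
    nlinarith
  rw [intervalIntegral.integral_sub, intervalIntegral.integral_const_mul] at key
  · have := mul_le_mul_of_nonneg_left hnorm hδ.le
    rw [add_mul]
    linarith
  · exact (by fun_prop : Continuous fun t => μ * (f t ^ 2 * s t ^ d)).intervalIntegrable _ _
  · exact (by fun_prop : Continuous fun t => deriv f t ^ 2 * s t ^ d).intervalIntegrable _ _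

end Radial

/-! ### Cone measures and polar coordinates -/

/-- Integration in polar coordinates for nonnegative functions on a normed space. -/
theorem lintegral_eq_lintegral_toSphere {E : Type*} [NormedAddCommGroup E] [NormedSpace ℝ E]
    [FiniteDimensional ℝ E] [Nontrivial E] [MeasurableSpace E] [BorelSpace E] (μ : Measure E)
    [μ.IsAddHaarMeasure] {f : E → ℝ≥0∞} (hf : Measurable f) :
    ∫⁻ x, f x ∂μ = ∫⁻ θ : Metric.sphere (0 : E) 1, (∫⁻ ρ in Ioi (0 : ℝ),
      ENNReal.ofReal (ρ ^ (Module.finrank ℝ E - 1)) * f (ρ • (θ : E))) ∂μ.toSphere := by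
  have h1 : ∫⁻ x, f x ∂μ = ∫⁻ x : ({(0 : E)}ᶜ : Set E), f x ∂(μ.comap (↑)) := by
    rw [lintegral_subtype_comap (measurableSet_singleton _).compl, restrict_compl_singleton]
  have h2 := μ.measurePreserving_homeomorphUnitSphereProd.lintegral_comp_emb
    (Homeomorph.measurableEmbedding _)
    (fun p : Metric.sphere (0 : E) 1 × Ioi (0 : ℝ) => f ((p.2 : ℝ) • (p.1 : E)))
  have h3 : ∀ x : ({(0 : E)}ᶜ : Set E), (((homeomorphUnitSphereProd E x).2 : ℝ) •
      ((homeomorphUnitSphereProd E x).1 : E)) = x := by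
    intro x
    have hx : ‖(x : E)‖ ≠ 0 := norm_ne_zero_iff.2 x.2
    simp [smul_smul, hx]
  simp only [h3] at h2
  have hm : Measurable fun p : Metric.sphere (0 : E) 1 × Ioi (0 : ℝ) =>
      f ((p.2 : ℝ) • (p.1 : E)) :=
    hf.comp ((measurable_subtype_coe.comp measurable_snd).smul
      (measurable_subtype_coe.comp measurable_fst))
  rw [h1, h2, lintegral_prod _ hm.aemeasurable]
  refine lintegral_congr fun θ => ?_
  have hm2 : Measurable fun ρ : Ioi (0 : ℝ) => f ((ρ : ℝ) • (θ : E)) :=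
    hf.comp (measurable_subtype_coe.smul_const _)
  rw [Measure.volumeIoiPow, lintegral_withDensity_eq_lintegral_mul _ (by fun_prop) hm2]
  exact lintegral_subtype_comap measurableSet_Ioi (μ := (volume : Measure ℝ))
    (fun ρ : ℝ => ENNReal.ofReal (ρ ^ (Module.finrank ℝ E - 1)) * f (ρ • (θ : E)))

/-- The point `(x₀, y)` of the ambient space `ℝ × ℝⁿ`. -/
noncomputable def joinCoord {n : ℕ} (x₀ : ℝ) (y : EuclideanSpace ℝ (Fin n)) : Ambient n :=
  WithLp.toLp 2 (Fin.cons x₀ (fun i => y i))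

section

variable {n : ℕ}

@[simp] theorem joinCoord_zero (x₀ : ℝ) (y : EuclideanSpace ℝ (Fin n)) :
    joinCoord x₀ y 0 = x₀ := rfl

@[simp] theorem joinCoord_succ (x₀ : ℝ) (y : EuclideanSpace ℝ (Fin n)) (i : Fin n) :
    joinCoord x₀ y i.succ = y i := rfl

theorem smul_joinCoord (k x₀ : ℝ) (y : EuclideanSpace ℝ (Fin n)) :
    k • joinCoord x₀ y = joinCoord (k * x₀) (k • y) := by
  ext i
  refine Fin.cases ?_ (fun i => ?_) i <;> simp

theorem hypParam_eq (y : EuclideanSpace ℝ (Fin n)) :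
    hypParam n y = joinCoord (√(1 + ‖y‖ ^ 2)) y := rfl

theorem continuous_joinCoord :
    Continuous fun q : ℝ × EuclideanSpace ℝ (Fin n) => joinCoord q.1 q.2 := by
  refine (PiLp.continuous_toLp 2 _).comp (continuous_pi fun i => ?_)
  refine Fin.cases ?_ (fun i => ?_) i
  · exact continuous_fst
  · simp only [Fin.cons_succ]
    fun_prop

theorem measurable_joinCoord {α : Type*} [MeasurableSpace α] {f : α → ℝ}
    {g : α → EuclideanSpace ℝ (Fin n)} (hf : Measurable f) (hg : Measurable g) :
    Measurable fun a => joinCoord (f a) (g a) :=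
  continuous_joinCoord.measurable.comp (hf.prodMk hg)

theorem norm_joinCoord_sq (x₀ : ℝ) (y : EuclideanSpace ℝ (Fin n)) :
    ‖joinCoord x₀ y‖ ^ 2 = x₀ ^ 2 + ‖y‖ ^ 2 := by
  simp [EuclideanSpace.norm_sq_eq, Fin.sum_univ_succ]

theorem lorentz_joinCoord_self (x₀ : ℝ) (y : EuclideanSpace ℝ (Fin n)) :
    lorentz (joinCoord x₀ y) (joinCoord x₀ y) = ‖y‖ ^ 2 - x₀ ^ 2 := by
  rw [EuclideanSpace.norm_sq_eq, lorentz]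
  simp [sq]

theorem measurePreserving_joinCoord :
    MeasurePreserving (fun q : ℝ × EuclideanSpace ℝ (Fin n) => joinCoord q.1 q.2)
      (volume.prod volume) volume := by
  have h1 := (MeasurePreserving.id (volume : Measure ℝ)).prod
    (PiLp.volume_preserving_ofLp (Fin n))
  have h2 := (volume_preserving_piFinSuccAbove (fun _ : Fin (n + 1) => ℝ) 0).symm
  have h3 := PiLp.volume_preserving_toLp (Fin (n + 1))
  have e : (fun q : ℝ × EuclideanSpace ℝ (Fin n) => joinCoord q.1 q.2)
      = WithLp.toLp 2 ∘ (MeasurableEquiv.piFinSuccAbove (fun _ : Fin (n + 1) => ℝ) 0).symm ∘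
        Prod.map id WithLp.ofLp := ?_
  · rw [e]
    exact h3.comp (h2.comp h1)
  funext q
  ext i
  refine Fin.cases ?_ (fun i => ?_) i <;>
    simp [MeasurableEquiv.piFinSuccAbove, Fin.insertNthEquiv]

theorem lintegral_ambient {f : Ambient n → ℝ≥0∞} (hf : Measurable f) :
    ∫⁻ x, f x = ∫⁻ x₀ : ℝ, ∫⁻ y : EuclideanSpace ℝ (Fin n), f (joinCoord x₀ y) := by
  rw [← lintegral_prod (fun q : ℝ × EuclideanSpace ℝ (Fin n) => f (joinCoord q.1 q.2))
    (hf.comp continuous_joinCoord.measurable).aemeasurable]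
  exact (measurePreserving_joinCoord.lintegral_comp hf).symm

end

/-- The mass of `ρ^n dρ` on `(0, 1)`. -/
noncomputable def coneMass (n : ℕ) : ℝ≥0∞ := ∫⁻ ρ in Ioo (0 : ℝ) 1, ENNReal.ofReal (ρ ^ n)

theorem coneMass_ne_zero (n : ℕ) : coneMass n ≠ 0 := by
  refine ((setLIntegral_pos_iff (by fun_prop)).2 ?_).ne'
  have : Ioo (0 : ℝ) 1 ⊆ Function.support (fun ρ : ℝ => ENNReal.ofReal (ρ ^ n)) ∩ Ioo 0 1 :=
    fun ρ hρ => ⟨(ENNReal.ofReal_pos.2 (pow_pos hρ.1 n)).ne', hρ⟩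
  refine lt_of_lt_of_le ?_ (measure_mono this)
  simp

theorem coneMass_ne_top (n : ℕ) : coneMass n ≠ ⊤ := by
  have : coneMass n ≤ ∫⁻ ρ in Ioo (0 : ℝ) 1, 1 := by
    refine setLIntegral_mono measurable_const fun ρ hρ => ?_
    rw [← ENNReal.ofReal_one]
    exact ENNReal.ofReal_le_ofReal (pow_le_one₀ hρ.1.le hρ.2.le)
  refine ne_top_of_le_ne_top ?_ this
  simp

/-- The integral over `S^n` is proportional to that of the homogeneous extension over the unit
ball. -/
theorem lintegral_sphVolume_cone {n : ℕ} {F : Ambient n → ℝ≥0∞} (hF : Measurable F) :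
    ∫⁻ x in {x : Ambient n | ‖x‖ < 1}, F (‖x‖⁻¹ • x) = (∫⁻ x, F x ∂sphVolume n) * coneMass n := by
  have hS : MeasurableSet {x : Ambient n | ‖x‖ < 1} :=
    measurableSet_lt measurable_norm measurable_const
  have hm : Measurable fun x : Ambient n => F (‖x‖⁻¹ • x) :=
    hF.comp (measurable_norm.inv.smul measurable_id)
  have hFS : Measurable fun θ : Metric.sphere (0 : Ambient n) 1 => F θ :=
    hF.comp measurable_subtype_coe
  rw [← lintegral_indicator hS, lintegral_eq_lintegral_toSphere _ (hm.indicator hS), sphVolume,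
    lintegral_map hF measurable_subtype_coe,
    ← lintegral_mul_const _ hFS]
  refine lintegral_congr fun θ => ?_
  have hθ : ‖(θ : Ambient n)‖ = 1 := by simp
  rw [coneMass, ← lintegral_const_mul _ (by fun_prop), ← lintegral_indicator measurableSet_Ioi,
    ← lintegral_indicator measurableSet_Ioo]
  refine lintegral_congr fun ρ => ?_
  by_cases h0 : 0 < ρ
  · have hρ : ‖ρ • (θ : Ambient n)‖ = ρ := by rw [norm_smul, hθ, mul_one, Real.norm_of_nonneg h0.le]
    rw [indicator_of_mem (by exact h0)]
    by_cases h1 : ρ < 1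
    · rw [indicator_of_mem (by simpa [hρ] using h1),
        indicator_of_mem (show ρ ∈ Ioo 0 1 from ⟨h0, h1⟩), hρ, smul_smul, inv_mul_cancel₀ h0.ne', one_smul, mul_comm]
      simp
    · rw [indicator_of_notMem (by simpa [hρ] using h1), indicator_of_notMem
        (fun h : ρ ∈ Ioo 0 1 => h1 h.2), mul_zero]
  · rw [indicator_of_notMem (by simpa using h0), indicator_of_notMem (fun h => h0 h.1)]

/-- Polar coordinates with the angle measured from the boundary line of the half-plane. -/
theorem lintegral_upper_half_plane_polar {g : ℝ × ℝ → ℝ≥0∞} (hg : Measurable g) :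
    ∫⁻ x₀ : ℝ, ∫⁻ ρ in Ioi (0 : ℝ), g (x₀, ρ) = ∫⁻ t in Ioo 0 π, ∫⁻ R in Ioi (0 : ℝ),
      ENNReal.ofReal R * g (R * Real.cos t, R * Real.sin t) := by
  have hS : MeasurableSet {p : ℝ × ℝ | 0 < p.2} := measurableSet_lt measurable_const measurable_snd
  have h1 : ∫⁻ x₀ : ℝ, ∫⁻ ρ in Ioi (0 : ℝ), g (x₀, ρ)
      = ∫⁻ p : ℝ × ℝ, {p : ℝ × ℝ | 0 < p.2}.indicator g p := by
    rw [Measure.volume_eq_prod, lintegral_prod _ (hg.indicator hS).aemeasurable]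
    refine lintegral_congr fun x₀ => ?_
    rw [← lintegral_indicator measurableSet_Ioi]
    rfl
  have hT : polarCoord.target = Ioi (0 : ℝ) ×ˢ Ioo (-π) π := rfl
  have hm : Measurable fun p : ℝ × ℝ =>
      ENNReal.ofReal p.1 * {p : ℝ × ℝ | 0 < p.2}.indicator g (polarCoord.symm p) :=
    (by fun_prop : Measurable fun p : ℝ × ℝ => ENNReal.ofReal p.1).mul
      ((hg.indicator hS).comp continuous_polarCoord_symm.measurable)
  rw [h1, ← lintegral_comp_polarCoord_symm, hT]
  simp only [smul_eq_mul]
  rw [Measure.volume_eq_prod, ← Measure.prod_restrict, lintegral_prod_symm _ hm.aemeasurable,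
    ← lintegral_indicator measurableSet_Ioo, ← lintegral_indicator measurableSet_Ioo]
  refine lintegral_congr fun t => ?_
  by_cases ht : t ∈ Ioo 0 π
  · rw [indicator_of_mem ht, indicator_of_mem (show t ∈ Ioo (-π) π from
      ⟨by linarith [ht.1, Real.pi_pos], ht.2⟩)]
    refine setLIntegral_congr_fun measurableSet_Ioi fun R (hR : 0 < R) => ?_
    simp only [polarCoord_symm_apply]
    rw [indicator_of_mem (show (R * Real.cos t, R * Real.sin t) ∈ {p : ℝ × ℝ | 0 < p.2} from
      mul_pos hR (Real.sin_pos_of_pos_of_lt_pi ht.1 ht.2))]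
  · rw [indicator_of_notMem ht]
    by_cases ht' : t ∈ Ioo (-π) π
    · rw [indicator_of_mem ht']
      have hle : t ≤ 0 := by
        by_contra h
        exact ht ⟨not_le.1 h, ht'.2⟩
      rw [setLIntegral_congr_fun (g := fun _ => 0) measurableSet_Ioi fun R (hR : 0 < R) => ?_]
      · simp
      · simp only [polarCoord_symm_apply]
        rw [indicator_of_notMem, mul_zero]
        have := mul_nonpos_of_nonneg_of_nonpos hR.le
          (Real.sin_nonpos_of_nonpos_of_neg_pi_le hle ht'.1.le)
        exact not_lt.2 this
    · rw [indicator_of_notMem ht']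

/-- In a half-plane bounded by the axis of the pole, the homogeneous extension of `F` integrates
in polar coordinates. -/
theorem lintegral_half_plane_homogeneous {n : ℕ} (hn : 1 ≤ n) {F : Ambient n → ℝ≥0∞}
    (hF : Measurable F) {θ : EuclideanSpace ℝ (Fin n)} (hθ : ‖θ‖ = 1) :
    ∫⁻ x₀ : ℝ, ∫⁻ ρ in Ioi (0 : ℝ), ENNReal.ofReal (ρ ^ (n - 1)) *
      {x : Ambient n | ‖x‖ < 1}.indicator (fun x => F (‖x‖⁻¹ • x)) (joinCoord x₀ (ρ • θ))
      = (∫⁻ t in Ioo 0 π, ENNReal.ofReal (Real.sin t ^ (n - 1)) *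
          F (joinCoord (Real.cos t) (Real.sin t • θ))) * coneMass n := by
  have hS : MeasurableSet {x : Ambient n | ‖x‖ < 1} :=
    measurableSet_lt measurable_norm measurable_const
  have hm : Measurable fun x : Ambient n => F (‖x‖⁻¹ • x) :=
    hF.comp (measurable_norm.inv.smul measurable_id)
  have hg : Measurable fun p : ℝ × ℝ => ENNReal.ofReal (p.2 ^ (n - 1)) *
      {x : Ambient n | ‖x‖ < 1}.indicator (fun x => F (‖x‖⁻¹ • x)) (joinCoord p.1 (p.2 • θ)) :=
    (by fun_prop : Measurable fun p : ℝ × ℝ => ENNReal.ofReal (p.2 ^ (n - 1))).mul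
      ((hm.indicator hS).comp (measurable_joinCoord measurable_fst (by fun_prop)))
  have hFt : Measurable fun t : ℝ => ENNReal.ofReal (Real.sin t ^ (n - 1)) *
      F (joinCoord (Real.cos t) (Real.sin t • θ)) :=
    (by fun_prop : Measurable fun t : ℝ => ENNReal.ofReal (Real.sin t ^ (n - 1))).mul
      (hF.comp (measurable_joinCoord (by fun_prop) (by fun_prop)))
  rw [lintegral_upper_half_plane_polar hg]
  dsimp only
  rw [← lintegral_mul_const _ hFt]
  refine setLIntegral_congr_fun measurableSet_Ioo fun t ht => ?_
  rw [coneMass, ← lintegral_const_mul _ (by fun_prop), ← lintegral_indicator measurableSet_Ioi,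
    ← lintegral_indicator measurableSet_Ioo]
  refine lintegral_congr fun R => ?_
  by_cases h0 : 0 < R
  · rw [indicator_of_mem (by exact h0), mul_smul, ← smul_joinCoord]
    have h1 : ‖joinCoord (Real.cos t) (Real.sin t • θ)‖ = 1 := by
      rw [← sq_eq_sq₀ (norm_nonneg _) zero_le_one, norm_joinCoord_sq, norm_smul, hθ]
      simp
    generalize joinCoord (Real.cos t) (Real.sin t • θ) = x at h1
    have hR : ‖R • x‖ = R := by rw [norm_smul, h1, mul_one, Real.norm_of_nonneg h0.le]
    by_cases hR1 : R < 1
    · rw [indicator_of_mem (show R ∈ Ioo 0 1 from ⟨h0, hR1⟩),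
        indicator_of_mem (by simpa [hR] using hR1), hR, smul_smul, inv_mul_cancel₀ h0.ne', one_smul]
      rw [mul_pow, ENNReal.ofReal_mul (by positivity)]
      have : ENNReal.ofReal (R ^ n) = ENNReal.ofReal R * ENNReal.ofReal (R ^ (n - 1)) := by
        rw [← ENNReal.ofReal_mul h0.le, ← pow_succ', Nat.sub_add_cancel hn]
      rw [this]
      ring
    · rw [indicator_of_notMem (fun h : R ∈ Ioo 0 1 => hR1 h.2),
        indicator_of_notMem (by simpa [hR] using hR1), mul_zero, mul_zero]
  · rw [indicator_of_notMem (by simpa using h0), indicator_of_notMem (fun h => h0 h.1)]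

/-- Integration over `S^n` in geodesic polar coordinates about the pole. -/
theorem lintegral_sphVolume_polar {n : ℕ} (hn : 1 ≤ n) {F : Ambient n → ℝ≥0∞} (hF : Measurable F) :
    ∫⁻ x, F x ∂sphVolume n
      = ∫⁻ θ : Metric.sphere (0 : EuclideanSpace ℝ (Fin n)) 1, (∫⁻ t in Ioo 0 π,
        ENNReal.ofReal (Real.sin t ^ (n - 1)) *
          F (joinCoord (Real.cos t) (Real.sin t • (θ : EuclideanSpace ℝ (Fin n)))))
        ∂(volume : Measure (EuclideanSpace ℝ (Fin n))).toSphere := by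
  have : Nonempty (Fin n) := ⟨⟨0, hn⟩⟩
  have hS : MeasurableSet {x : Ambient n | ‖x‖ < 1} :=
    measurableSet_lt measurable_norm measurable_const
  have hm : Measurable fun x : Ambient n => F (‖x‖⁻¹ • x) :=
    hF.comp (measurable_norm.inv.smul measurable_id)
  obtain ⟨f, hf⟩ : ∃ f, f = {x : Ambient n | ‖x‖ < 1}.indicator
    fun x : Ambient n => F (‖x‖⁻¹ • x) := ⟨_, rfl⟩
  have hmi : Measurable f := hf ▸ hm.indicator hS
  refine (ENNReal.mul_left_inj (coneMass_ne_zero n) (coneMass_ne_top n)).1 ?_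
  rw [← lintegral_sphVolume_cone hF, ← lintegral_indicator hS, ← hf, lintegral_ambient hmi]
  have hmeas : Measurable fun q : (ℝ × Metric.sphere (0 : EuclideanSpace ℝ (Fin n)) 1) × ℝ =>
      ENNReal.ofReal (q.2 ^ (n - 1)) *
        f (joinCoord q.1.1 (q.2 • (q.1.2 : EuclideanSpace ℝ (Fin n)))) :=
    (by fun_prop : Measurable fun q : (ℝ × Metric.sphere (0 : EuclideanSpace ℝ (Fin n)) 1)
      × ℝ => ENNReal.ofReal (q.2 ^ (n - 1))).mul (hmi.comp
      (measurable_joinCoord (by fun_prop) (by fun_prop)))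
  have hpol : ∀ x₀ : ℝ, ∫⁻ y : EuclideanSpace ℝ (Fin n), f (joinCoord x₀ y) = _ := fun x₀ =>
    lintegral_eq_lintegral_toSphere volume
      (hmi.comp (measurable_joinCoord measurable_const measurable_id))
  simp only [hpol, finrank_euclideanSpace, Fintype.card_fin]
  rw [lintegral_lintegral_swap
    (Measurable.lintegral_prod_right' (ν := volume.restrict (Ioi 0)) hmeas).aemeasurable]
  have hFm : Measurable fun q : Metric.sphere (0 : EuclideanSpace ℝ (Fin n)) 1 × ℝ =>
      ENNReal.ofReal (Real.sin q.2 ^ (n - 1)) *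
          F (joinCoord (Real.cos q.2) (Real.sin q.2 • (q.1 : EuclideanSpace ℝ (Fin n)))) :=
    (by fun_prop : Measurable fun q : Metric.sphere (0 : EuclideanSpace ℝ (Fin n)) 1 × ℝ =>
      ENNReal.ofReal (Real.sin q.2 ^ (n - 1))).mul (hF.comp
      (measurable_joinCoord (by fun_prop) (by fun_prop)))
  rw [← lintegral_mul_const _ (Measurable.lintegral_prod_right' hFm)]
  refine lintegral_congr fun θ => ?_
  rw [hf]
  exact lintegral_half_plane_homogeneous hn hF (by simp)

theorem lintegral_hypVolume {n : ℕ} {F : Ambient n → ℝ≥0∞} (hF : Measurable F) :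
    ∫⁻ x, F x ∂hypVolume n = ∫⁻ y : EuclideanSpace ℝ (Fin n),
      ENNReal.ofReal (1 / √(1 + ‖y‖ ^ 2)) * F (joinCoord (√(1 + ‖y‖ ^ 2)) y) := by
  have hp : Measurable (hypParam n) := measurable_joinCoord (by fun_prop) measurable_id
  have hFp : Measurable fun y => F (hypParam n y) := hF.comp hp
  rw [hypVolume, lintegral_map hF hp,
    lintegral_withDensity_eq_lintegral_mul _ (by fun_prop) hFp]
  rfl

/-- Integration over `H^n` in geodesic polar coordinates about the pole. -/
theorem lintegral_hypVolume_polar {n : ℕ} (hn : 1 ≤ n) {F : Ambient n → ℝ≥0∞} (hF : Measurable F) :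
    ∫⁻ x, F x ∂hypVolume n
      = ∫⁻ θ : Metric.sphere (0 : EuclideanSpace ℝ (Fin n)) 1, (∫⁻ t in Ioi 0,
        ENNReal.ofReal (Real.sinh t ^ (n - 1)) *
          F (joinCoord (Real.cosh t) (Real.sinh t • (θ : EuclideanSpace ℝ (Fin n)))))
        ∂(volume : Measure (EuclideanSpace ℝ (Fin n))).toSphere := by
  have : Nonempty (Fin n) := ⟨⟨0, hn⟩⟩
  have hm : Measurable fun y : EuclideanSpace ℝ (Fin n) =>
      ENNReal.ofReal (1 / √(1 + ‖y‖ ^ 2)) * F (joinCoord (√(1 + ‖y‖ ^ 2)) y) :=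
    (by fun_prop : Measurable fun y : EuclideanSpace ℝ (Fin n) =>
      ENNReal.ofReal (1 / √(1 + ‖y‖ ^ 2))).mul
      (hF.comp (measurable_joinCoord (by fun_prop) measurable_id))
  rw [lintegral_hypVolume hF, lintegral_eq_lintegral_toSphere _ hm]
  refine lintegral_congr fun θ => ?_
  have hθ : ‖(θ : EuclideanSpace ℝ (Fin n))‖ = 1 := by simp
  have himage : Real.sinh '' Ioi 0 = Ioi 0 := by
    ext x
    constructor
    · rintro ⟨t, ht, rfl⟩
      exact Real.sinh_pos_iff.2 ht
    · intro hx
      exact ⟨Real.arsinh x, Real.arsinh_pos_iff.2 hx, Real.sinh_arsinh x⟩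
  have hcv := lintegral_image_eq_lintegral_abs_deriv_mul (measurableSet_Ioi (a := (0 : ℝ)))
    (fun t _ => (Real.hasDerivAt_sinh t).hasDerivWithinAt) Real.sinh_injective.injOn
    (fun ρ : ℝ => ENNReal.ofReal (ρ ^ (Module.finrank ℝ (EuclideanSpace ℝ (Fin n)) - 1)) *
      (ENNReal.ofReal (1 / √(1 + ‖ρ • (θ : EuclideanSpace ℝ (Fin n))‖ ^ 2)) *
        F (joinCoord (√(1 + ‖ρ • (θ : EuclideanSpace ℝ (Fin n))‖ ^ 2))
          (ρ • (θ : EuclideanSpace ℝ (Fin n))))))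
  rw [himage] at hcv
  rw [hcv]
  refine setLIntegral_congr_fun measurableSet_Ioi fun t _ => ?_
  have hc := Real.cosh_pos t
  have hn1 : √(1 + ‖Real.sinh t • (θ : EuclideanSpace ℝ (Fin n))‖ ^ 2) = Real.cosh t := by
    rw [norm_smul, hθ, mul_one, Real.norm_eq_abs, sq_abs, add_comm, ← Real.cosh_sq,
      Real.sqrt_sq hc.le]
  simp only [hn1, abs_of_pos hc, finrank_euclideanSpace, Fintype.card_fin]
  have h1 : ENNReal.ofReal (Real.cosh t) * ENNReal.ofReal (1 / Real.cosh t) = 1 := by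
    rw [← ENNReal.ofReal_mul hc.le, mul_one_div_cancel hc.ne', ENNReal.ofReal_one]
  rw [mul_left_comm, ← mul_assoc (ENNReal.ofReal (Real.cosh t)), h1, one_mul]

/-- The cone over `H^n`, truncated at Lorentz length `1`. -/
def truncatedCone (n : ℕ) : Set (Ambient n) := {x | 0 < x 0 ∧ -1 < lorentz x x ∧ lorentz x x < 0}

theorem continuous_lorentz_self {n : ℕ} : Continuous fun x : Ambient n => lorentz x x := by
  unfold lorentz
  fun_prop

theorem measurableSet_truncatedCone (n : ℕ) : MeasurableSet (truncatedCone n) := by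
  have h0 : Continuous fun x : Ambient n => x 0 := by fun_prop
  exact (measurableSet_lt measurable_const h0.measurable).inter
    ((measurableSet_lt measurable_const continuous_lorentz_self.measurable).inter
      (measurableSet_lt continuous_lorentz_self.measurable measurable_const))

theorem lintegral_comp_smul_eq {n : ℕ} {g : EuclideanSpace ℝ (Fin n) → ℝ≥0∞} (hg : Measurable g)
    {k : ℝ} (hk : 0 < k) :
    ∫⁻ y, g y = ENNReal.ofReal (k ^ n) * ∫⁻ y, g (k • y) := by
  have h := Measure.map_addHaar_smul (volume : Measure (EuclideanSpace ℝ (Fin n))) hk.ne'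
  have h2 : ∫⁻ y, g (k • y) = ENNReal.ofReal |(k ^ n)⁻¹| * ∫⁻ y, g y := by
    rw [← lintegral_map hg (measurable_const_smul k), h, lintegral_smul_measure]
    simp
  rw [h2, ← mul_assoc, ← ENNReal.ofReal_mul (by positivity), abs_of_pos (by positivity),
    mul_inv_cancel₀ (by positivity), ENNReal.ofReal_one, one_mul]

/-- The integral over `H^n` is proportional to that of the homogeneous extension over the
truncated cone. The volume of `H^n` is therefore invariant under Lorentz transformations. -/
theorem lintegral_hypVolume_cone {n : ℕ} {F : Ambient n → ℝ≥0∞} (hF : Measurable F) :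
    ∫⁻ x in truncatedCone n, F ((√(-lorentz x x))⁻¹ • x)
      = (∫⁻ x, F x ∂hypVolume n) * coneMass n := by
  have hS := measurableSet_truncatedCone n
  have hm : Measurable fun x : Ambient n => F ((√(-lorentz x x))⁻¹ • x) :=
    hF.comp ((continuous_lorentz_self.measurable.neg.sqrt.inv).smul measurable_id)
  have hmi := hm.indicator hS
  have hkm : Measurable fun q : EuclideanSpace ℝ (Fin n) × ℝ =>
      ENNReal.ofReal (q.2 / √(q.2 ^ 2 + ‖q.1‖ ^ 2)) *
        F (q.2⁻¹ • joinCoord (√(q.2 ^ 2 + ‖q.1‖ ^ 2)) q.1) :=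
    (by fun_prop : Measurable fun q : EuclideanSpace ℝ (Fin n) × ℝ =>
      ENNReal.ofReal (q.2 / √(q.2 ^ 2 + ‖q.1‖ ^ 2))).mul
      (hF.comp (measurable_snd.inv.smul (measurable_joinCoord (by fun_prop) measurable_fst)))
  -- substitute `x₀ = √(k² + |y|²)` for fixed `y`, then `y = k z` for fixed `k`
  have hinner : ∀ y : EuclideanSpace ℝ (Fin n),
      ∫⁻ x₀ : ℝ, (truncatedCone n).indicator (fun x => F ((√(-lorentz x x))⁻¹ • x))
        (joinCoord x₀ y) = ∫⁻ k in Ioo (0 : ℝ) 1, ENNReal.ofReal (k / √(k ^ 2 + ‖y‖ ^ 2)) *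
        F (k⁻¹ • joinCoord (√(k ^ 2 + ‖y‖ ^ 2)) y) := by
    intro y
    have hpos : ∀ k ∈ Ioo (0 : ℝ) 1, 0 < k ^ 2 + ‖y‖ ^ 2 := fun k hk => by
      have := hk.1; positivity
    have hmem : ∀ x₀, joinCoord x₀ y ∈ truncatedCone n ↔
        x₀ ∈ (fun k => √(k ^ 2 + ‖y‖ ^ 2)) '' Ioo (0 : ℝ) 1 := by
      intro x₀
      simp only [truncatedCone, mem_ofPred_eq, joinCoord_zero, lorentz_joinCoord_self]
      constructor
      · rintro ⟨h0, h1, h2⟩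
        refine ⟨√(x₀ ^ 2 - ‖y‖ ^ 2), ⟨Real.sqrt_pos.2 (by linarith), ?_⟩, ?_⟩
        · rw [Real.sqrt_lt' one_pos]; linarith
        · simp only
          rw [Real.sq_sqrt (by linarith), sub_add_cancel, Real.sqrt_sq h0.le]
      · rintro ⟨k, hk, rfl⟩
        have hk0 := hk.1
        simp only
        rw [Real.sq_sqrt (hpos k hk).le]
        refine ⟨Real.sqrt_pos.2 (hpos k hk), ?_, ?_⟩
        · nlinarith [hk.2]
        · nlinarith
    have hind : ∀ x₀ : ℝ, (truncatedCone n).indicator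
        (fun x => F ((√(-lorentz x x))⁻¹ • x)) (joinCoord x₀ y)
        = ((fun k => √(k ^ 2 + ‖y‖ ^ 2)) '' Ioo (0 : ℝ) 1).indicator
          (fun x₀ => F ((√(x₀ ^ 2 - ‖y‖ ^ 2))⁻¹ • joinCoord x₀ y)) x₀ := by
      intro x₀
      by_cases h : joinCoord x₀ y ∈ truncatedCone n
      · rw [indicator_of_mem h, indicator_of_mem ((hmem x₀).1 h), lorentz_joinCoord_self, neg_sub]
      · rw [indicator_of_notMem h, indicator_of_notMem fun h' => h ((hmem x₀).2 h')]
    have hder : ∀ k ∈ Ioo (0 : ℝ) 1, HasDerivWithinAt (fun k => √(k ^ 2 + ‖y‖ ^ 2))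
        (k / √(k ^ 2 + ‖y‖ ^ 2)) (Ioo (0 : ℝ) 1) k := by
      intro k hk
      refine (((hasDerivAt_pow 2 k).add_const (‖y‖ ^ 2)).sqrt
        (hpos k hk).ne').hasDerivWithinAt.congr_deriv ?_
      push_cast
      field_simp
    have hinj : InjOn (fun k => √(k ^ 2 + ‖y‖ ^ 2)) (Ioo (0 : ℝ) 1) := by
      intro k hk l hl hkl
      have := (Real.sqrt_inj (hpos k hk).le (hpos l hl).le).1 hkl
      exact (pow_left_inj₀ hk.1.le hl.1.le two_ne_zero).1 (by linarith)
    have himg : MeasurableSet ((fun k => √(k ^ 2 + ‖y‖ ^ 2)) '' Ioo (0 : ℝ) 1) := by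
      rw [show (fun k => √(k ^ 2 + ‖y‖ ^ 2)) '' Ioo (0 : ℝ) 1
        = (fun x₀ => joinCoord x₀ y) ⁻¹' truncatedCone n from Set.ext fun x₀ => (hmem x₀).symm]
      exact measurable_joinCoord measurable_id measurable_const hS
    simp only [hind]
    rw [lintegral_indicator himg,
      lintegral_image_eq_lintegral_abs_deriv_mul measurableSet_Ioo hder hinj]
    refine setLIntegral_congr_fun measurableSet_Ioo fun k hk => ?_
    have hk0 := hk.1
    rw [abs_of_nonneg (by positivity), Real.sq_sqrt (hpos k hk).le, add_sub_cancel_right,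
      Real.sqrt_sq hk.1.le]
  have hjm : Measurable fun q : ℝ × EuclideanSpace ℝ (Fin n) => (truncatedCone n).indicator
      (fun x => F ((√(-lorentz x x))⁻¹ • x)) (joinCoord q.1 q.2) :=
    hmi.comp continuous_joinCoord.measurable
  rw [← lintegral_indicator hS, lintegral_ambient hmi, lintegral_lintegral_swap hjm.aemeasurable]
  simp only [hinner]
  rw [lintegral_lintegral_swap hkm.aemeasurable, coneMass, ← lintegral_const_mul _ (by fun_prop)]
  refine setLIntegral_congr_fun measurableSet_Ioo fun k hk => ?_
  have hk0 := hk.1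
  have hkm' : Measurable fun y : EuclideanSpace ℝ (Fin n) =>
      ENNReal.ofReal (k / √(k ^ 2 + ‖y‖ ^ 2)) *
        F (k⁻¹ • joinCoord (√(k ^ 2 + ‖y‖ ^ 2)) y) :=
    hkm.comp (by fun_prop : Measurable fun y : EuclideanSpace ℝ (Fin n) => (y, k))
  rw [lintegral_comp_smul_eq hkm' hk0, mul_comm, lintegral_hypVolume hF]
  congr 1
  refine lintegral_congr fun z => ?_
  have e : √(k ^ 2 + ‖k • z‖ ^ 2) = k * √(1 + ‖z‖ ^ 2) := by
    rw [norm_smul, Real.norm_of_nonneg hk0.le, show k ^ 2 + (k * ‖z‖) ^ 2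
      = k ^ 2 * (1 + ‖z‖ ^ 2) by ring, Real.sqrt_mul (by positivity), Real.sqrt_sq hk0.le]
  rw [e, smul_joinCoord, smul_smul, inv_mul_cancel₀ hk0.ne', one_smul,
    inv_mul_cancel_left₀ hk0.ne', div_mul_eq_div_div, div_self hk0.ne']

/-- Volume preserving linear maps which preserve the Lorentz form and the upper sheet preserve the
volume of `H^n`. -/
theorem lintegral_hypVolume_comp {n : ℕ} {L : Ambient n → Ambient n}
    (hL : MeasurePreserving L volume volume) (hsmul : ∀ (k : ℝ) x, L (k • x) = k • L x)
    (hlor : ∀ x, lorentz (L x) (L x) = lorentz x x)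
    (hcone : ∀ x ∈ truncatedCone n, 0 < L x 0) (hcone' : ∀ x, L x ∈ truncatedCone n → 0 < x 0)
    {F : Ambient n → ℝ≥0∞} (hF : Measurable F) :
    ∫⁻ x, F (L x) ∂hypVolume n = ∫⁻ x, F x ∂hypVolume n := by
  refine (ENNReal.mul_left_inj (coneMass_ne_zero n) (coneMass_ne_top n)).1 ?_
  have hS := measurableSet_truncatedCone n
  have hm : Measurable fun x : Ambient n => F ((√(-lorentz x x))⁻¹ • x) :=
    hF.comp ((continuous_lorentz_self.measurable.neg.sqrt.inv).smul measurable_id)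
  rw [← lintegral_hypVolume_cone hF,
    ← lintegral_hypVolume_cone (F := fun x => F (L x)) (hF.comp hL.measurable),
    ← lintegral_indicator hS, ← lintegral_indicator hS,
    ← hL.lintegral_comp (hm.indicator hS)]
  refine lintegral_congr fun x => ?_
  have hiff : x ∈ truncatedCone n ↔ L x ∈ truncatedCone n := by
    constructor
    · intro h
      exact ⟨hcone x h, by rw [hlor]; exact h.2⟩
    · intro h
      have h2 := h.2
      rw [hlor] at h2
      exact ⟨hcone' x h, h2⟩
  by_cases h : x ∈ truncatedCone n
  · rw [indicator_of_mem h, indicator_of_mem (hiff.1 h), hlor, hsmul]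
  · rw [indicator_of_notMem h, indicator_of_notMem fun h' => h (hiff.2 h')]

theorem lintegral_sphVolume_comp {n : ℕ} (L : Ambient n ≃ₗᵢ[ℝ] Ambient n)
    {F : Ambient n → ℝ≥0∞} (hF : Measurable F) :
    ∫⁻ x, F (L x) ∂sphVolume n = ∫⁻ x, F x ∂sphVolume n := by
  refine (ENNReal.mul_left_inj (coneMass_ne_zero n) (coneMass_ne_top n)).1 ?_
  have hL : MeasurePreserving L volume volume := L.measurePreserving
  have hS : MeasurableSet {x : Ambient n | ‖x‖ < 1} :=
    measurableSet_lt measurable_norm measurable_const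
  have hm : Measurable fun x : Ambient n => F (‖x‖⁻¹ • x) :=
    hF.comp (measurable_norm.inv.smul measurable_id)
  rw [← lintegral_sphVolume_cone hF,
    ← lintegral_sphVolume_cone (F := fun x => F (L x)) (hF.comp hL.measurable),
    ← lintegral_indicator hS, ← lintegral_indicator hS,
    ← hL.lintegral_comp (hm.indicator hS)]
  refine lintegral_congr fun x => ?_
  simp [indicator]

/-! ### The eigenvalue of a ball in an abstract polar model -/

/-- The directions at the centre of a geodesic ball. -/
abbrev Direction (n : ℕ) : Type := Metric.sphere (0 : EuclideanSpace ℝ (Fin n)) 1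

/-- The uniform measure on the directions, of total mass the area of the unit sphere. -/
noncomputable abbrev dirMeasure (n : ℕ) : Measure (Direction n) :=
  (volume : Measure (EuclideanSpace ℝ (Fin n))).toSphere

/-- The point at distance `t` from `p` on the geodesic starting with the unit tangent
vector `V θ`. -/
def geodesicPoint {n : ℕ} (s c : ℝ → ℝ) (p : Ambient n) (V : Direction n → Ambient n) (t : ℝ)
    (θ : Direction n) : Ambient n :=
  c t • p + s t • V θ

/-- What the eigenvalue estimates use of the geometry of `S^n` and `H^n`. The linear function
`inner ℝ w` restricts on `M` to the function `c` of the distance to `p`, the distance is recovered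
from it by the inverse function `acc` of `c`, and `T` is the range of the radial coordinate. The
measure `vol` is `s^{n-1} dt dθ` in geodesic polar coordinates, the gradient dominates the radial
derivative (the vector `ε s p + c V θ` is the velocity of the geodesic `c p + s V θ`), and a radial
function has no other component of the gradient. -/
structure IsPolarModel {n : ℕ} (M : Set (Ambient n)) (vol : Measure (Ambient n))
    (gradSq : (Ambient n → ℝ) → Ambient n → ℝ) (ε : ℝ) (s c acc : ℝ → ℝ) (T : Set ℝ)
    (p w : Ambient n) (V : Direction n → Ambient n) : Prop where
  warp : IsWarp ε s c
  eps_sq : ε ^ 2 = 1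
  isOpen_T : IsOpen T
  Ioc_subset : ∀ r ∈ T, Ioc 0 r ⊆ T
  pos_of_mem : ∀ t ∈ T, 0 < t
  s_pos : ∀ t ∈ T, 0 < s t
  acc_c : ∀ t ∈ T, acc (c t) = t
  contDiffAt_acc : ∀ t ∈ T, ContDiffAt ℝ ∞ acc (c t)
  isOpen_image : IsOpen (c '' T)
  isClosed : IsClosed M
  isBounded : ∀ C, Bornology.IsBounded {x | x ∈ M ∧ inner ℝ w x ≤ C}
  mem : ∀ t ∈ T, ∀ θ, geodesicPoint s c p V t θ ∈ M
  inner_eq : ∀ t θ, inner ℝ w (geodesicPoint s c p V t θ) = c t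
  lintegral_eq : ∀ F : Ambient n → ℝ≥0∞, Measurable F → ∫⁻ x, F x ∂vol
    = ∫⁻ θ, (∫⁻ t in T, ENNReal.ofReal (s t ^ (n - 1)) * F (geodesicPoint s c p V t θ))
      ∂dirMeasure n
  ae_mem : ∀ᵐ x ∂vol, x ∈ M
  compact_lt_top : ∀ K, IsCompact K → vol K < ⊤
  open_ne_zero : ∀ U : Set (Ambient n), IsOpen U → (U ∩ M).Nonempty → vol U ≠ 0
  continuous_gradSq : ∀ u : Ambient n → ℝ, ContDiff ℝ ∞ u → Continuous (gradSq u)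
  gradSq_nonneg : ∀ u, ∀ x ∈ M, 0 ≤ gradSq u x
  sq_le_gradSq : ∀ u : Ambient n → ℝ, Differentiable ℝ u → ∀ t ∈ T, ∀ θ,
    fderiv ℝ u (geodesicPoint s c p V t θ) ((ε * s t) • p + c t • V θ) ^ 2
      ≤ gradSq u (geodesicPoint s c p V t θ)
  gradSq_radial : ∀ ψ : ℝ → ℝ, Differentiable ℝ ψ → ∀ t ∈ T, ∀ θ,
    gradSq (fun x => ψ (inner ℝ w x)) (geodesicPoint s c p V t θ) = (deriv ψ (c t) * s t) ^ 2
  gradSq_support : ∀ (u : Ambient n → ℝ) (Ω : Set (Ambient n)), IsTestFunction M Ω u →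
    ∃ K, IsCompact K ∧ ∀ x ∈ M, x ∉ K → gradSq u x = 0

/-- Integration along a ray of a function supported in `(a, b]`. -/
theorem lintegral_ray_eq {T : Set ℝ} (hT : MeasurableSet T) {a b : ℝ} (hab : a ≤ b)
    (hsub : Ioc a b ⊆ T) {s g : ℝ → ℝ} {d : ℕ} (hs : Continuous s) (hs0 : ∀ t ∈ T, 0 < s t)
    (hg : Continuous g) (hg0 : ∀ t, 0 ≤ g t) (hgT : ∀ t ∈ T, t ∉ Ioc a b → g t = 0) :
    ∫⁻ t in T, ENNReal.ofReal (s t ^ d) * ENNReal.ofReal (g t)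
      = ENNReal.ofReal (∫ t in a..b, g t * s t ^ d) := by
  have h1 : ∫⁻ t in T, ENNReal.ofReal (s t ^ d) * ENNReal.ofReal (g t)
      = ∫⁻ t in Ioc a b, ENNReal.ofReal (g t * s t ^ d) := by
    rw [← lintegral_indicator hT, ← lintegral_indicator measurableSet_Ioc]
    refine lintegral_congr fun t => ?_
    by_cases ht : t ∈ T
    · rw [indicator_of_mem ht]
      by_cases hab' : t ∈ Ioc a b
      · rw [indicator_of_mem hab', mul_comm, ENNReal.ofReal_mul (hg0 t)]
      · rw [indicator_of_notMem hab', hgT t ht hab']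
        simp
    · rw [indicator_of_notMem ht, indicator_of_notMem fun h => ht (hsub h)]
  have hc : Continuous fun t => g t * s t ^ d := by fun_prop
  rw [h1, intervalIntegral.integral_of_le hab, ofReal_integral_eq_lintegral_ofReal
    (hc.integrableOn_Ioc)]
  refine (ae_restrict_mem measurableSet_Ioc).mono fun t ht => ?_
  have := hs0 t (hsub ht)
  exact mul_nonneg (hg0 t) (by positivity)

namespace IsPolarModel

variable {n : ℕ} {M : Set (Ambient n)} {vol : Measure (Ambient n)}
  {gradSq : (Ambient n → ℝ) → Ambient n → ℝ} {ε : ℝ} {s c acc : ℝ → ℝ} {T : Set ℝ}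
  {p w : Ambient n} {V : Direction n → Ambient n}

/-- The open geodesic ball of radius `r` about `p`. -/
def ball (M : Set (Ambient n)) (acc : ℝ → ℝ) (w : Ambient n) (r : ℝ) : Set (Ambient n) :=
  {x | x ∈ M ∧ acc (inner ℝ w x) < r}

theorem hasDerivAt_geodesicPoint (hw : IsWarp ε s c) (t : ℝ) (θ : Direction n) :
    HasDerivAt (fun t => geodesicPoint s c p V t θ) ((ε * s t) • p + c t • V θ) t :=
  ((hw.hasDerivAt_c t).smul_const p).add ((hw.hasDerivAt_s t).smul_const (V θ))

theorem lintegral_ofReal_ne_top (h : IsPolarModel M vol gradSq ε s c acc T p w V)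
    {g : Ambient n → ℝ} (hg : Continuous g) {K : Set (Ambient n)} (hK : IsCompact K)
    (hgK : ∀ x ∈ M, x ∉ K → g x = 0) : ∫⁻ x, ENNReal.ofReal (g x) ∂vol ≠ ⊤ := by
  obtain ⟨C, hC⟩ := hK.exists_bound_of_continuousOn hg.continuousOn
  have hle : ∫⁻ x, ENNReal.ofReal (g x) ∂vol
      ≤ ∫⁻ x, K.indicator (fun _ => ENNReal.ofReal C) x ∂vol := by
    refine lintegral_mono_ae (h.ae_mem.mono fun x hx => ?_)
    by_cases hxK : x ∈ K
    · rw [indicator_of_mem hxK]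
      exact ENNReal.ofReal_le_ofReal ((le_abs_self _).trans (hC x hxK))
    · rw [hgK x hx hxK]
      simp
  rw [lintegral_indicator hK.measurableSet, setLIntegral_const] at hle
  exact ne_top_of_le_ne_top (ENNReal.mul_ne_top ENNReal.ofReal_ne_top (h.compact_lt_top K hK).ne)
    hle

theorem integral_eq_toReal (h : IsPolarModel M vol gradSq ε s c acc T p w V)
    {g : Ambient n → ℝ} (hg : Continuous g) (hg0 : ∀ x ∈ M, 0 ≤ g x) :
    ∫ x, g x ∂vol = (∫⁻ x, ENNReal.ofReal (g x) ∂vol).toReal :=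
  integral_eq_lintegral_of_nonneg_ae (h.ae_mem.mono hg0) hg.aestronglyMeasurable

/-- On every ray, a test function vanishes from some distance smaller than `r` on. -/
theorem exists_eq_zero_on_ray (h : IsPolarModel M vol gradSq ε s c acc T p w V) {r : ℝ}
    (hr : r ∈ T) {u : Ambient n → ℝ} (hu : IsTestFunction M (ball M acc w r) u)
    (θ : Direction n) :
    ∃ R ∈ Ioo 0 r, ∀ t ∈ T, R ≤ t → u (geodesicPoint s c p V t θ) = 0 := by
  have hnot : ∀ t ∈ T, r ≤ t →
      geodesicPoint s c p V t θ ∉ closure {x | x ∈ M ∧ u x ≠ 0} := by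
    intro t ht hrt hmem
    have := (hu.support_subset hmem).2
    rw [h.inner_eq, h.acc_c t ht] at this
    exact not_lt.2 hrt this
  have hcont : Continuous fun t => geodesicPoint s c p V t θ :=
    continuous_iff_continuousAt.2 fun t => (hasDerivAt_geodesicPoint h.warp t θ).continuousAt
  have hev := hcont.continuousAt.preimage_mem_nhds
    (isClosed_closure.isOpen_compl.mem_nhds (hnot r hr le_rfl))
  obtain ⟨l, hl, hsub⟩ := exists_Ioc_subset_of_mem_nhds' hev (h.pos_of_mem r hr)
  have hl0 : 0 ≤ l := hl.1
  have hlr : l < r := hl.2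
  refine ⟨(l + r) / 2, ⟨by linarith, by linarith⟩, fun t ht hRt => ?_⟩
  by_contra hne
  have hmem : geodesicPoint s c p V t θ ∈ closure {x | x ∈ M ∧ u x ≠ 0} :=
    subset_closure ⟨h.mem t ht θ, hne⟩
  rcases le_total t r with htr | htr
  · exact hsub ⟨by linarith, htr⟩ hmem
  · exact hnot t ht htr hmem

/-- The lower bound for Rayleigh quotients: on each ray the radial derivative is bounded below by
the one-dimensional inequality. -/
theorem le_rayleigh (h : IsPolarModel M vol gradSq ε s c acc T p w V) (hn : 2 ≤ n) {r : ℝ}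
    (hr : r ∈ T) {κ : ℝ} {G G' : ℝ → ℝ}
    (hG : IsBesselGroundState (((n - 1 : ℕ) : ℝ) / 2) κ r G G') {m : ℝ}
    (hm : ∀ t ∈ Ioo 0 r, m ≤ radialPotential ε κ (n - 1) s t) {u : Ambient n → ℝ}
    (hu : IsTestFunction M (ball M acc w r) u) :
    m ≤ (∫ x, gradSq u x ∂vol) / ∫ x, u x ^ 2 ∂vol := by
  have huc : Continuous u := hu.smooth.continuous
  have hud : Differentiable ℝ u := hu.smooth.differentiable (by simp)
  have hTr := h.Ioc_subset r hr
  have hsc := h.warp.continuous_s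
  have hcc := h.warp.continuous_c
  have hgc := h.continuous_gradSq u hu.smooth
  have hray : ∀ θ : Direction n, ENNReal.ofReal m * ∫⁻ t in T, ENNReal.ofReal (s t ^ (n - 1)) *
        ENNReal.ofReal (u (geodesicPoint s c p V t θ) ^ 2)
      ≤ ∫⁻ t in T, ENNReal.ofReal (s t ^ (n - 1)) *
        ENNReal.ofReal (gradSq u (geodesicPoint s c p V t θ)) := by
    intro θ
    obtain ⟨R, hR, hR0⟩ := h.exists_eq_zero_on_ray hr hu θ
    have hRT : R ∈ T := hTr ⟨hR.1, hR.2.le⟩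
    set f' : ℝ → ℝ := fun t =>
      fderiv ℝ u (geodesicPoint s c p V t θ) ((ε * s t) • p + c t • V θ) with hf'
    have hd : ∀ t, HasDerivAt (fun t => u (geodesicPoint s c p V t θ)) (f' t) t := fun t =>
      (hud _).hasFDerivAt.comp_hasDerivAt t (hasDerivAt_geodesicPoint h.warp t θ)
    have hcont : Continuous fun t => geodesicPoint s c p V t θ :=
      continuous_iff_continuousAt.2 fun t => (hasDerivAt_geodesicPoint h.warp t θ).continuousAt
    have hf'c : Continuous f' :=
      ((hu.smooth.continuous_fderiv (by simp)).comp hcont).clm_apply (by fun_prop)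
    have key := mul_integral_sq_le h.warp hG (by omega)
      (fun t ht => h.s_pos t (hTr ht)) hm hd hf'c hR (hR0 R hRT le_rfl)
    have hsub : Ioc 0 R ⊆ T := h.Ioc_subset R hRT
    rw [lintegral_ray_eq (d := n - 1) h.isOpen_T.measurableSet hR.1.le hsub hsc h.s_pos
      (g := fun t => u (geodesicPoint s c p V t θ) ^ 2) (by fun_prop) (fun t => sq_nonneg _)
      (fun t ht hnt => by
        have : R ≤ t := by
          by_contra hlt
          exact hnt ⟨h.pos_of_mem t ht, (not_le.1 hlt).le⟩
        simp [hR0 t ht this])]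
    have hpos : 0 ≤ ∫ t in (0)..R, u (geodesicPoint s c p V t θ) ^ 2 * s t ^ (n - 1) := by
      refine intervalIntegral.integral_nonneg hR.1.le fun t ht => ?_
      have : 0 ≤ s t := by
        rcases ht.1.eq_or_lt with h0 | h0
        · rw [← h0, h.warp.s_zero]
        · exact (h.s_pos t (hsub ⟨h0, ht.2⟩)).le
      positivity
    rw [← ENNReal.ofReal_mul' hpos]
    refine (ENNReal.ofReal_le_ofReal key).trans ?_
    have hc2 : Continuous fun t => f' t ^ 2 * s t ^ (n - 1) := by fun_prop
    rw [intervalIntegral.integral_of_le hR.1.le, ofReal_integral_eq_lintegral_ofReal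
      hc2.integrableOn_Ioc ((ae_restrict_mem measurableSet_Ioc).mono fun t ht => by
        have := h.s_pos t (hsub ht)
        show 0 ≤ f' t ^ 2 * s t ^ (n - 1)
        positivity)]
    refine (setLIntegral_mono' measurableSet_Ioc fun t ht => ?_).trans
      (lintegral_mono_set hsub)
    have := h.s_pos t (hsub ht)
    rw [mul_comm, ENNReal.ofReal_mul (by positivity)]
    gcongr
    exact h.sq_le_gradSq u hud t (hsub ht) θ
  set N := ∫⁻ x, ENNReal.ofReal (u x ^ 2) ∂vol with hN
  set D := ∫⁻ x, ENNReal.ofReal (gradSq u x) ∂vol with hD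
  have hND : ENNReal.ofReal m * N ≤ D := by
    rw [hN, hD, h.lintegral_eq _ (by fun_prop), h.lintegral_eq _ (by fun_prop),
      ← lintegral_const_mul' _ _ ENNReal.ofReal_ne_top]
    exact lintegral_mono hray
  have hDtop : D ≠ ⊤ := by
    obtain ⟨K, hK, hK0⟩ := h.gradSq_support u _ hu
    exact h.lintegral_ofReal_ne_top hgc hK hK0
  have hNtop : N ≠ ⊤ := by
    refine h.lintegral_ofReal_ne_top (by fun_prop) hu.compact_support fun x hx hxK => ?_
    by_contra hne
    exact hxK (subset_closure ⟨hx, fun h0 => hne (by simp [h0])⟩)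
  have hN0 : N ≠ 0 := by
    intro h0
    rw [hN, lintegral_eq_zero_iff (by fun_prop)] at h0
    obtain ⟨x, hx, hux⟩ := hu.nonzero
    refine h.open_ne_zero {x | u x ≠ 0} (isOpen_ne_fun huc continuous_const) ⟨x, hux, hx⟩ ?_
    refine measure_mono_null (fun y hy => ?_) (ae_iff.1 h0)
    have hy' : u y ≠ 0 := hy
    have : 0 < u y ^ 2 := by positivity
    simpa using hy'
  rw [h.integral_eq_toReal hgc (h.gradSq_nonneg u),
    h.integral_eq_toReal (g := fun x => u x ^ 2) (huc.pow 2) fun x _ => sq_nonneg _,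
    le_div_iff₀ (ENNReal.toReal_pos hN0 hNtop)]
  -- for `m ≤ 0` the bound `hND` reads `0 ≤ D`, which still suffices
  calc m * N.toReal ≤ (ENNReal.ofReal m).toReal * N.toReal := by
        gcongr
        rw [ENNReal.toReal_ofReal']
        exact le_max_left _ _
    _ = (ENNReal.ofReal m * N).toReal := (ENNReal.toReal_mul).symm
    _ ≤ D.toReal := ENNReal.toReal_mono hDtop hND

/-- A smooth radial profile supported in `(t₁, t₂)` is a smooth function of `c`. -/
theorem exists_comp_c_eq (h : IsPolarModel M vol gradSq ε s c acc T p w V) {t₁ t₂ : ℝ}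
    (hT : Icc t₁ t₂ ⊆ T) {f : ℝ → ℝ} (hf : ContDiff ℝ ∞ f)
    (hf0 : ∀ t, t ∉ Ioo t₁ t₂ → f t = 0) :
    ∃ ψ : ℝ → ℝ, ContDiff ℝ ∞ ψ ∧ (∀ t ∈ T, ψ (c t) = f t) ∧
      ∀ x, x ∉ c '' Icc t₁ t₂ → ψ x = 0 := by
  set ψ : ℝ → ℝ := (c '' T).indicator fun x => f (acc x) with hψ
  have hψT : ∀ t ∈ T, ψ (c t) = f t := fun t ht => by
    rw [hψ, indicator_of_mem (mem_image_of_mem c ht), h.acc_c t ht]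
  have hψ0 : ∀ x, x ∉ c '' Icc t₁ t₂ → ψ x = 0 := by
    intro x hx
    by_cases hxT : x ∈ c '' T
    · obtain ⟨t, ht, rfl⟩ := hxT
      rw [hψT t ht]
      exact hf0 t fun h' => hx (mem_image_of_mem c (Ioo_subset_Icc_self h'))
    · exact indicator_of_notMem hxT _
  refine ⟨ψ, ?_, hψT, hψ0⟩
  rw [contDiff_iff_contDiffAt]
  intro x
  by_cases hx : x ∈ c '' Icc t₁ t₂
  · obtain ⟨t, ht, rfl⟩ := hx
    refine (hf.contDiffAt.comp (c t) (h.contDiffAt_acc t (hT ht))).congr_of_eventuallyEq ?_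
    filter_upwards [h.isOpen_image.mem_nhds (mem_image_of_mem c (hT ht))] with y hy
    exact indicator_of_mem hy _
  · refine (contDiffAt_const (c := (0 : ℝ))).congr_of_eventuallyEq ?_
    filter_upwards [(isCompact_Icc.image h.warp.continuous_c).isClosed.isOpen_compl.mem_nhds hx]
      with y hy using hψ0 y hy

/-- The upper bound: the radial trial functions are test functions. -/
theorem exists_rayleigh_le (h : IsPolarModel M vol gradSq ε s c acc T p w V) (hn : 2 ≤ n) {r : ℝ}
    (hr : r ∈ T) {κ : ℝ} {G G' : ℝ → ℝ}
    (hG : IsBesselGroundState (((n - 1 : ℕ) : ℝ) / 2) κ r G G') {m : ℝ}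
    (hm : ∀ t ∈ Ioo 0 r, radialPotential ε κ (n - 1) s t ≤ m) {δ : ℝ} (hδ : 0 < δ) :
    ∃ u, IsTestFunction M (ball M acc w r) u ∧
      (∫ x, gradSq u x ∂vol) / ∫ x, u x ^ 2 ∂vol ≤ m + δ := by
  have hTr := h.Ioc_subset r hr
  have hsc := h.warp.continuous_s
  have : Nonempty (Fin n) := ⟨⟨0, by omega⟩⟩
  obtain ⟨f, t₁, t₂, hfC, ht₁, ht₁₂, ht₂, hf0, hfpos, hfle⟩ :=
    exists_trial_function h.warp hG (by omega) (h.pos_of_mem r hr)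
      (fun t ht => h.s_pos t (hTr ht)) hm hδ
  have hIcc : Icc t₁ t₂ ⊆ T := fun t ht => hTr ⟨ht₁.trans_le ht.1, ht.2.trans ht₂.le⟩
  obtain ⟨ψ, hψC, hψT, hψ0⟩ := h.exists_comp_c_eq hIcc hfC hf0
  set u : Ambient n → ℝ := fun x => ψ (inner ℝ w x) with hu
  have huC : ContDiff ℝ ∞ u := hψC.comp (contDiff_const.inner ℝ contDiff_id)
  have hfd : ∀ t ∈ T, (deriv ψ (c t) * s t) ^ 2 = deriv f t ^ 2 := by
    intro t ht
    have h1 : HasDerivAt (fun t => ψ (c t)) (deriv ψ (c t) * (ε * s t)) t :=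
      ((hψC.differentiable (by simp)) _).hasDerivAt.comp t (h.warp.hasDerivAt_c t)
    have h2 : deriv f t = deriv ψ (c t) * (ε * s t) := by
      refine (h1.congr_of_eventuallyEq ?_).deriv
      filter_upwards [h.isOpen_T.mem_nhds ht] with x hx using (hψT x hx).symm
    rw [h2, mul_left_comm, mul_pow ε, h.eps_sq, one_mul]
  have hf'0 : ∀ t, t ∉ Icc t₁ t₂ → deriv f t = 0 := by
    intro t ht
    have : f =ᶠ[𝓝 t] fun _ => (0 : ℝ) := by
      filter_upwards [isClosed_Icc.isOpen_compl.mem_nhds ht] with x hx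
      exact hf0 x fun h' => hx (Ioo_subset_Icc_self h')
    rw [this.deriv_eq]
    simp
  have hdf : Continuous (deriv f) := hfC.continuous_deriv (by simp)
  have hf't₁ : deriv f t₁ = 0 := by
    have hcl : IsClosed {t | deriv f t = 0} := isClosed_eq hdf continuous_const
    have : Iio t₁ ⊆ {t | deriv f t = 0} := fun t ht => hf'0 t fun h' => not_le.2 ht h'.1
    have h2 := closure_minimal this hcl
    rw [closure_Iio] at h2
    exact h2 self_mem_Iic
  -- the test function property
  have hK : IsCompact {x | x ∈ M ∧ inner ℝ w x ∈ c '' Icc t₁ t₂} := by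
    refine Metric.isCompact_of_isClosed_isBounded ?_ ?_
    · exact h.isClosed.inter ((isCompact_Icc.image h.warp.continuous_c).isClosed.preimage
        (by fun_prop))
    · obtain ⟨C, hC⟩ := (isCompact_Icc.image h.warp.continuous_c).bddAbove (s := c '' Icc t₁ t₂)
      exact (h.isBounded C).subset fun x hx => ⟨hx.1, hC hx.2⟩
  have hsupp : closure {x | x ∈ M ∧ u x ≠ 0} ⊆ {x | x ∈ M ∧ inner ℝ w x ∈ c '' Icc t₁ t₂} := by
    refine closure_minimal (fun x hx => ⟨hx.1, ?_⟩) hK.isClosed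
    by_contra hnot
    exact hx.2 (hψ0 _ hnot)
  have hut : ∀ t ∈ T, ∀ θ, u (geodesicPoint s c p V t θ) = f t := fun t ht θ => by
    simp only [hu]
    rw [h.inner_eq, hψT t ht]
  obtain ⟨θ₀⟩ : Nonempty (Direction n) :=
    (NormedSpace.sphere_nonempty.2 zero_le_one).to_subtype
  have htest : IsTestFunction M (ball M acc w r) u := by
    refine ⟨huC, hK.of_isClosed_subset isClosed_closure hsupp, hsupp.trans ?_, ?_⟩
    · rintro x ⟨hxM, t, ht, hxt⟩
      refine ⟨hxM, ?_⟩
      rw [← hxt, h.acc_c t (hIcc ht)]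
      exact ht.2.trans_lt ht₂
    · by_contra! hall
      refine hfpos.ne' ?_
      rw [intervalIntegral.integral_congr (g := fun _ => (0 : ℝ)) fun t ht => ?_]
      · simp
      · rw [uIcc_of_le ht₁₂.le] at ht
        have := hall _ (h.mem t (hIcc ht) θ₀)
        rw [hut t (hIcc ht)] at this
        simp [this]
  refine ⟨u, htest, ?_⟩
  -- the Rayleigh quotient
  set σ := dirMeasure n univ with hσ
  have hσ0 : σ.toReal ≠ 0 := by
    refine (ENNReal.toReal_pos ?_ (measure_ne_top _ _)).ne'
    rw [Ne, Measure.measure_univ_eq_zero]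
    exact Measure.toSphere_ne_zero _
  have hden : ∫ x, u x ^ 2 ∂vol = σ.toReal * ∫ t in t₁..t₂, f t ^ 2 * s t ^ (n - 1) := by
    rw [h.integral_eq_toReal (g := fun x => u x ^ 2) (huC.continuous.pow 2) fun x _ => sq_nonneg _,
      h.lintegral_eq _ (by have := huC.continuous; fun_prop)]
    have : ∀ θ : Direction n, ∫⁻ t in T, ENNReal.ofReal (s t ^ (n - 1)) *
        ENNReal.ofReal (u (geodesicPoint s c p V t θ) ^ 2)
        = ENNReal.ofReal (∫ t in t₁..t₂, f t ^ 2 * s t ^ (n - 1)) := by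
      intro θ
      rw [← lintegral_ray_eq h.isOpen_T.measurableSet ht₁₂.le (Ioc_subset_Icc_self.trans hIcc)
        hsc h.s_pos (g := fun t => f t ^ 2) (hfC.continuous.pow 2) (fun t => sq_nonneg _)
        (fun t _ hnt => by simp [hf0 t fun h' => hnt (Ioo_subset_Ioc_self h')])]
      exact setLIntegral_congr_fun h.isOpen_T.measurableSet fun t ht => by simp only [hut t ht]
    simp only [this, lintegral_const]
    rw [ENNReal.toReal_mul, ENNReal.toReal_ofReal hfpos.le, mul_comm]
  have hnum : ∫ x, gradSq u x ∂vol
      = σ.toReal * ∫ t in t₁..t₂, deriv f t ^ 2 * s t ^ (n - 1) := by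
    rw [h.integral_eq_toReal (h.continuous_gradSq u huC) (h.gradSq_nonneg u),
      h.lintegral_eq _ (by have := h.continuous_gradSq u huC; fun_prop)]
    have : ∀ θ : Direction n, ∫⁻ t in T, ENNReal.ofReal (s t ^ (n - 1)) *
        ENNReal.ofReal (gradSq u (geodesicPoint s c p V t θ))
        = ENNReal.ofReal (∫ t in t₁..t₂, deriv f t ^ 2 * s t ^ (n - 1)) := by
      intro θ
      rw [← lintegral_ray_eq h.isOpen_T.measurableSet ht₁₂.le (Ioc_subset_Icc_self.trans hIcc)
        hsc h.s_pos (g := fun t => deriv f t ^ 2) (hdf.pow 2) (fun t => sq_nonneg _)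
        (fun t _ hnt => by
          by_cases ht : t ∈ Icc t₁ t₂
          · have : t = t₁ := le_antisymm (not_lt.1 fun h' => hnt ⟨h', ht.2⟩) ht.1
            simp [this, hf't₁]
          · simp [hf'0 t ht])]
      refine setLIntegral_congr_fun h.isOpen_T.measurableSet fun t ht => ?_
      simp only [hu]
      rw [h.gradSq_radial ψ (hψC.differentiable (by simp)) t ht θ, hfd t ht]
    have hnn : 0 ≤ ∫ t in t₁..t₂, deriv f t ^ 2 * s t ^ (n - 1) := by
      refine intervalIntegral.integral_nonneg ht₁₂.le fun t ht => ?_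
      have := h.s_pos t (hIcc ht)
      positivity
    simp only [this, lintegral_const]
    rw [ENNReal.toReal_mul, ENNReal.toReal_ofReal hnn, mul_comm]
  rw [hnum, hden, mul_div_mul_left _ _ hσ0, div_le_iff₀ hfpos]
  exact hfle

/-- Bounds for the potential of the radial problem are bounds for the eigenvalue (Barta's
principle for the radial function `s^{-(n-1)/2} G`). -/
theorem eigenvalue_bounds (h : IsPolarModel M vol gradSq ε s c acc T p w V) (hn : 2 ≤ n) {r : ℝ}
    (hr : r ∈ T) {κ : ℝ} {G G' : ℝ → ℝ}
    (hG : IsBesselGroundState (((n - 1 : ℕ) : ℝ) / 2) κ r G G') {m₁ m₂ : ℝ}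
    (hm : ∀ t ∈ Ioo 0 r, radialPotential ε κ (n - 1) s t ∈ Icc m₁ m₂) :
    firstDirichletEigenvalue M vol gradSq (ball M acc w r) ∈ Icc m₁ m₂ := by
  have hlow : ∀ q ∈ {q : ℝ | ∃ u : Ambient n → ℝ, IsTestFunction M (ball M acc w r) u ∧
      q = (∫ x, gradSq u x ∂vol) / ∫ x, u x ^ 2 ∂vol}, m₁ ≤ q := by
    rintro q ⟨u, hu, rfl⟩
    exact h.le_rayleigh hn hr hG (fun t ht => (hm t ht).1) hu
  constructor
  · obtain ⟨u, hu, -⟩ := h.exists_rayleigh_le hn hr hG (fun t ht => (hm t ht).2) one_pos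
    exact le_csInf ⟨_, u, hu, rfl⟩ hlow
  · refine le_of_forall_pos_le_add fun δ hδ => ?_
    obtain ⟨u, hu, hle⟩ := h.exists_rayleigh_le hn hr hG (fun t ht => (hm t ht).2) hδ
    exact (csInf_le ⟨m₁, hlow⟩ ⟨u, hu, rfl⟩).trans hle

end IsPolarModel

/-! ### Polar coordinates on the sphere -/

section Gradient

variable {n : ℕ}

theorem inner_gradient (u : Ambient n → ℝ) (x v : Ambient n) :
    inner ℝ (gradient u x) v = fderiv ℝ u x v := by
  rw [gradient, InnerProductSpace.toDual_symm_apply]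

theorem continuous_gradient {u : Ambient n → ℝ} (hu : ContDiff ℝ ∞ u) : Continuous (gradient u) :=
  (InnerProductSpace.toDual ℝ (Ambient n)).symm.continuous.comp
    (hu.continuous_fderiv (by simp))

theorem gradient_comp_inner {ψ : ℝ → ℝ} (hψ : Differentiable ℝ ψ) (w x : Ambient n) :
    gradient (fun x => ψ (inner ℝ w x)) x = deriv ψ (inner ℝ w x) • w := by
  have h1 : HasFDerivAt (fun x : Ambient n => inner ℝ w x) (innerSL ℝ w) x :=
    (innerSL ℝ w).hasFDerivAt
  have h2 := (hψ (inner ℝ w x)).hasDerivAt.comp_hasFDerivAt x h1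
  refine ext_inner_right ℝ fun v => ?_
  rw [inner_gradient]
  have h3 : fderiv ℝ (fun x => ψ (inner ℝ w x)) x = deriv ψ (inner ℝ w x) • innerSL ℝ w :=
    h2.fderiv
  rw [h3, inner_smul_left]
  simp

theorem inner_joinCoord (a b : ℝ) (y z : EuclideanSpace ℝ (Fin n)) :
    inner ℝ (joinCoord a y) (joinCoord b z) = a * b + inner ℝ y z := by
  simp only [PiLp.inner_apply, Fin.sum_univ_succ]
  simp [mul_comm]

theorem joinCoord_add (a b : ℝ) (y z : EuclideanSpace ℝ (Fin n)) :
    joinCoord a y + joinCoord b z = joinCoord (a + b) (y + z) := by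
  ext i
  refine Fin.cases ?_ (fun i => ?_) i <;> simp

theorem joinCoord_eq_smul_add_smul (a b : ℝ) (y : EuclideanSpace ℝ (Fin n)) :
    joinCoord a (b • y) = a • joinCoord 1 0 + b • joinCoord 0 y := by
  rw [smul_joinCoord, smul_joinCoord, joinCoord_add]
  simp

end Gradient

section Sphere

variable {n : ℕ}

theorem exists_linearIsometryEquiv_pole {p : Ambient n} (hp : p ∈ sph n) :
    ∃ L : Ambient n ≃ₗᵢ[ℝ] Ambient n, L (joinCoord 1 0) = p := by
  have hp1 : ‖p‖ = 1 := by simpa [sph] using hp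
  obtain ⟨b, hb⟩ := Orthonormal.exists_orthonormalBasis_extension_of_card_eq (𝕜 := ℝ)
    (E := Ambient n) (ι := Fin (n + 1)) (by simp) (v := fun _ => p) (s := {0})
    (by
      refine ⟨fun i => by simpa using hp1, fun i j hij => ?_⟩
      exact absurd (Subsingleton.elim i j) hij)
  refine ⟨b.repr.symm, ?_⟩
  have : (joinCoord 1 0 : Ambient n) = EuclideanSpace.single 0 1 := by
    ext i
    refine Fin.cases ?_ (fun i => ?_) i <;> simp
  rw [this]
  simpa using hb 0 rfl

theorem inner_sphGrad {u : Ambient n → ℝ} {x v : Ambient n} (h : inner ℝ x v = 0) :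
    inner ℝ (sphGrad u x) v = fderiv ℝ u x v := by
  rw [sphGrad, inner_sub_left, inner_smul_left, h, inner_gradient]
  simp

theorem cos_image_Ioo : Real.cos '' Ioo 0 π = Ioo (-1) 1 := by
  ext x
  constructor
  · rintro ⟨t, ht, rfl⟩
    have h1 := Real.cos_lt_cos_of_nonneg_of_le_pi le_rfl ht.2.le ht.1
    have h2 := Real.cos_lt_cos_of_nonneg_of_le_pi ht.1.le le_rfl ht.2
    rw [Real.cos_zero] at h1
    rw [Real.cos_pi] at h2
    exact ⟨h2, h1⟩
  · intro hx
    refine ⟨Real.arccos x, ⟨Real.arccos_pos.2 hx.2, ?_⟩, Real.cos_arccos hx.1.le hx.2.le⟩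
    refine lt_of_le_of_ne (Real.arccos_le_pi x) fun h => ?_
    have := Real.cos_arccos hx.1.le hx.2.le
    rw [h, Real.cos_pi] at this
    linarith [hx.1]

theorem exists_isPolarModel_sph (hn : 1 ≤ n) {p : Ambient n} (hp : p ∈ sph n) :
    ∃ V, IsPolarModel (sph n) (sphVolume n) (fun u x => ‖sphGrad u x‖ ^ 2) (-1)
      Real.sin Real.cos Real.arccos (Ioo 0 π) p p V := by
  obtain ⟨L, hL⟩ := exists_linearIsometryEquiv_pole hp
  have hp1 : ‖p‖ = 1 := by simpa [sph] using hp
  have hcomb : ∀ (a b : ℝ) (θ : Direction n),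
      a • p + b • L (joinCoord 0 θ) = L (joinCoord a (b • (θ : EuclideanSpace ℝ (Fin n)))) := by
    intro a b θ
    rw [joinCoord_eq_smul_add_smul, map_add, map_smul, map_smul, hL]
  have hinner : ∀ (a b a' b' : ℝ) (θ : Direction n),
      inner ℝ (a • p + b • L (joinCoord 0 θ)) (a' • p + b' • L (joinCoord 0 θ))
        = a * a' + b * b' := by
    intro a b a' b' θ
    rw [hcomb, hcomb, L.inner_map_map, inner_joinCoord, inner_smul_left, inner_smul_right,
      real_inner_self_eq_norm_sq]
    simp
  have hinner_p : ∀ (a b : ℝ) (θ : Direction n),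
      inner ℝ p (a • p + b • L (joinCoord 0 θ)) = a := by
    intro a b θ
    simpa using hinner 1 0 a b θ
  refine ⟨fun θ => L (joinCoord 0 θ), ?_⟩
  constructor
  case warp => exact isWarp_sin
  case eps_sq => norm_num
  case isOpen_T => exact isOpen_Ioo
  case Ioc_subset => exact fun r hr t ht => ⟨ht.1, ht.2.trans_lt hr.2⟩
  case pos_of_mem => exact fun t ht => ht.1
  case s_pos => exact fun t ht => Real.sin_pos_of_pos_of_lt_pi ht.1 ht.2
  case acc_c => exact fun t ht => Real.arccos_cos ht.1.le ht.2.le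
  case contDiffAt_acc =>
    intro t ht
    have h : Real.cos t ∈ Ioo (-1 : ℝ) 1 := cos_image_Ioo ▸ mem_image_of_mem _ ht
    exact Real.contDiffAt_arccos h.1.ne' h.2.ne
  case isOpen_image => rw [cos_image_Ioo]; exact isOpen_Ioo
  case isClosed => exact Metric.isClosed_sphere
  case isBounded => exact fun C => Metric.isBounded_sphere.subset fun x hx => hx.1
  case mem =>
    intro t _ θ
    have h := hinner (Real.cos t) (Real.sin t) (Real.cos t) (Real.sin t) θ
    rw [real_inner_self_eq_norm_sq] at h
    rw [sph, mem_sphere_zero_iff_norm, geodesicPoint,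
      ← sq_eq_sq₀ (norm_nonneg _) zero_le_one, h]
    linarith [Real.sin_sq_add_cos_sq t]
  case inner_eq => exact fun t θ => hinner_p _ _ θ
  case lintegral_eq =>
    intro F hF
    rw [← lintegral_sphVolume_comp L hF,
      lintegral_sphVolume_polar hn (F := fun x => F (L x)) (hF.comp L.continuous.measurable)]
    simp only [geodesicPoint, hcomb]
  case ae_mem =>
    exact (ae_map_iff measurable_subtype_coe.aemeasurable (p := fun x => x ∈ sph n)
      Metric.isClosed_sphere.measurableSet).2 (Eventually.of_forall fun x => x.2)
  case compact_lt_top =>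
    intro K _
    unfold sphVolume
    exact measure_lt_top _ _
  case open_ne_zero =>
    rintro U hU ⟨x, hxU, hx⟩
    rw [sphVolume, Measure.map_apply measurable_subtype_coe hU.measurableSet]
    have : ((volume : Measure (Ambient n)).toSphere).IsOpenPosMeasure :=
      Measure.toSphere.instIsOpenPosMeasure volume
    exact this.open_pos _ (hU.preimage continuous_subtype_val) ⟨⟨x, hx⟩, hxU⟩
  case continuous_gradSq =>
    intro u hu
    have := continuous_gradient hu
    unfold sphGrad
    fun_prop
  case gradSq_nonneg => exact fun u x _ => sq_nonneg _
  case sq_le_gradSq =>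
    intro u _ t _ θ
    have h0 : inner ℝ (geodesicPoint Real.sin Real.cos p (fun θ => L (joinCoord 0 θ)) t θ)
        ((-1 * Real.sin t) • p + Real.cos t • L (joinCoord 0 θ)) = 0 := by
      rw [geodesicPoint, hinner]; ring
    have h1 : ‖(-1 * Real.sin t) • p + Real.cos t • L (joinCoord 0 θ)‖ = 1 := by
      rw [← sq_eq_sq₀ (norm_nonneg _) zero_le_one, ← real_inner_self_eq_norm_sq, hinner]
      linarith [Real.sin_sq_add_cos_sq t]
    rw [← inner_sphGrad h0, ← sq_abs]
    have := abs_real_inner_le_norm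
      (sphGrad u (geodesicPoint Real.sin Real.cos p (fun θ => L (joinCoord 0 θ)) t θ))
      ((-1 * Real.sin t) • p + Real.cos t • L (joinCoord 0 θ))
    rw [h1, mul_one] at this
    gcongr
  case gradSq_radial =>
    intro ψ hψ t _ θ
    have h1 := hinner_p (Real.cos t) (Real.sin t) θ
    have h2 := hinner (Real.cos t) (Real.sin t) (Real.cos t) (Real.sin t) θ
    rw [geodesicPoint]
    generalize Real.cos t • p + Real.sin t • L (joinCoord 0 θ) = x at h1 h2
    rw [sphGrad, gradient_comp_inner hψ, h1, inner_smul_left, h1, ← real_inner_self_eq_norm_sq]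
    simp only [inner_sub_left, inner_sub_right, inner_smul_left, inner_smul_right,
      real_inner_self_eq_norm_sq, real_inner_comm p x, h1, hp1]
    rw [real_inner_self_eq_norm_sq] at h2
    rw [real_inner_comm] at h1
    simp only [h2, conj_trivial]
    rw [mul_pow, Real.sin_sq]
    have := Real.sin_sq_add_cos_sq t
    linear_combination (deriv ψ (Real.cos t)) ^ 2 * Real.cos t ^ 2 * this
  case gradSq_support =>
    intro u Ω _
    exact ⟨sph n, isCompact_sphere 0 1, fun x hx hx' => absurd hx hx'⟩

theorem sphBall_eq {p : Ambient n} (hp : p ∈ sph n) (r : ℝ) :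
    sphBall n p r = IsPolarModel.ball (sph n) Real.arccos p r := by
  have hp1 : ‖p‖ = 1 := by simpa [sph] using hp
  ext x
  refine and_congr_right fun hx => ?_
  have hx1 : ‖x‖ = 1 := by simpa [sph] using hx
  rw [InnerProductGeometry.angle, hp1, hx1, mul_one, div_one]

end Sphere

/-! ### Polar coordinates on hyperbolic space -/

section Lorentz

variable {n : ℕ}

theorem lorentz_comm (x y : Ambient n) : lorentz x y = lorentz y x := by
  simp [lorentz, mul_comm]

theorem lorentz_add_left (x y z : Ambient n) : lorentz (x + y) z = lorentz x z + lorentz y z := by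
  simp only [lorentz, PiLp.add_apply, add_mul, Finset.sum_add_distrib]
  ring

theorem lorentz_smul_left (a : ℝ) (x y : Ambient n) : lorentz (a • x) y = a * lorentz x y := by
  simp only [lorentz, PiLp.smul_apply, smul_eq_mul, mul_assoc, ← Finset.mul_sum]
  ring

theorem lorentz_add_right (x y z : Ambient n) : lorentz x (y + z) = lorentz x y + lorentz x z := by
  rw [lorentz_comm, lorentz_add_left, lorentz_comm y, lorentz_comm z]

theorem lorentz_smul_right (a : ℝ) (x y : Ambient n) : lorentz x (a • y) = a * lorentz x y := by
  rw [lorentz_comm, lorentz_smul_left, lorentz_comm]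

theorem lorentz_joinCoord (a b : ℝ) (y z : EuclideanSpace ℝ (Fin n)) :
    lorentz (joinCoord a y) (joinCoord b z) = inner ℝ y z - a * b := by
  simp [lorentz, PiLp.inner_apply, mul_comm]

theorem lorentz_pole (x : Ambient n) : lorentz x (joinCoord 1 0) = -x 0 := by
  simp [lorentz]

theorem exists_eq_joinCoord (x : Ambient n) : ∃ y, x = joinCoord (x 0) y := by
  refine ⟨WithLp.toLp 2 fun i => x i.succ, ?_⟩
  ext i
  refine Fin.cases ?_ (fun i => ?_) i <;> simp

/-- The Lorentz form is positive semidefinite on the orthogonal complement of a timelike vector. -/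
theorem lorentz_self_nonneg {x v : Ambient n} (hx : x ∈ hyp n) (h : lorentz x v = 0) :
    0 ≤ lorentz v v := by
  obtain ⟨y, hy⟩ := exists_eq_joinCoord x
  obtain ⟨z, hz⟩ := exists_eq_joinCoord v
  obtain ⟨h1, h0⟩ := hx
  rw [hy, lorentz_joinCoord_self] at h1
  rw [hy, hz, lorentz_joinCoord] at h
  rw [hz, lorentz_joinCoord_self]
  have hcs := real_inner_mul_inner_self_le y z
  rw [real_inner_self_eq_norm_sq, real_inner_self_eq_norm_sq] at hcs
  have h2 : inner ℝ y z = x 0 * v 0 := by linarith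
  rw [h2] at hcs
  have h3 : x 0 ^ 2 = 1 + ‖y‖ ^ 2 := by linarith
  have h4 : (1 + ‖y‖ ^ 2) * v 0 ^ 2 ≤ ‖y‖ ^ 2 * ‖z‖ ^ 2 := by
    rw [← h3]; linarith
  nlinarith [sq_nonneg (v 0), sq_nonneg ‖y‖, sq_nonneg ‖z‖]

theorem lorentz_neg_of_timelike {x v : Ambient n} (hx0 : 0 < x 0) (hx : lorentz x x < 0)
    (hv0 : 0 < v 0) (hv : lorentz v v < 0) : lorentz x v < 0 := by
  obtain ⟨y, hy⟩ := exists_eq_joinCoord x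
  obtain ⟨z, hz⟩ := exists_eq_joinCoord v
  rw [hy, lorentz_joinCoord_self] at hx
  rw [hz, lorentz_joinCoord_self] at hv
  rw [hy, hz, lorentz_joinCoord]
  have h1 : ‖y‖ < x 0 := lt_of_pow_lt_pow_left₀ 2 hx0.le (by linarith)
  have h2 : ‖z‖ < v 0 := lt_of_pow_lt_pow_left₀ 2 hv0.le (by linarith)
  have h3 := real_inner_le_norm y z
  have h4 : ‖y‖ * ‖z‖ < x 0 * v 0 :=
    mul_lt_mul'' h1 h2 (norm_nonneg _) (norm_nonneg _)
  linarith

theorem lorentz_lorentzGrad (u : Ambient n → ℝ) (x v : Ambient n) :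
    lorentz (lorentzGrad u x) v = fderiv ℝ u x v := by
  rw [← inner_gradient]
  simp only [lorentz, lorentzGrad, PiLp.inner_apply, Fin.sum_univ_succ, Fin.cons_zero,
    Fin.cons_succ]
  simp [mul_comm, add_comm]

theorem lorentz_hypGrad {u : Ambient n → ℝ} {x v : Ambient n} (h : lorentz x v = 0) :
    lorentz (hypGrad u x) v = fderiv ℝ u x v := by
  rw [hypGrad, lorentz_add_left, lorentz_smul_left, h, lorentz_lorentzGrad]
  ring

theorem lorentz_hypGrad_tangent (u : Ambient n → ℝ) {x : Ambient n} (hx : x ∈ hyp n) :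
    lorentz x (hypGrad u x) = 0 := by
  rw [hypGrad, lorentz_add_right, lorentz_smul_right, hx.1, lorentz_comm x]
  ring

theorem isClosed_hyp : IsClosed (hyp n) := by
  have h : hyp n = {x | lorentz x x = -1} ∩ {x | 0 ≤ x 0} := by
    ext x
    refine and_congr_right fun hx => ⟨fun h => h.le, fun h => lt_of_le_of_ne h fun h0 => ?_⟩
    obtain ⟨y, hy⟩ := exists_eq_joinCoord x
    have hx' : lorentz x x = -1 := hx
    rw [hy, lorentz_joinCoord_self, ← h0] at hx'
    nlinarith [sq_nonneg ‖y‖]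
  rw [h]
  have h0 : Continuous fun x : Ambient n => x 0 := by fun_prop
  exact (isClosed_eq continuous_lorentz_self continuous_const).inter
    (isClosed_le continuous_const h0)

/-- The Lorentz transformation exchanging the pole `e` and the point `p` of `H^n`: minus the
reflection along `p + e`. -/
noncomputable def lorentzSwap (p : Ambient n) : Ambient n →ₗ[ℝ] Ambient n where
  toFun x := -x - (lorentz x (p + joinCoord 1 0) / (1 + p 0)) • (p + joinCoord 1 0)
  map_add' x y := by
    rw [lorentz_add_left, add_div, add_smul]
    abel
  map_smul' a x := by
    rw [lorentz_smul_left, mul_div_assoc, mul_smul, RingHom.id_apply, smul_sub, smul_neg]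

theorem lorentzSwap_apply (p x : Ambient n) : lorentzSwap p x
    = (-1 : ℝ) • x + (-(lorentz x (p + joinCoord 1 0) / (1 + p 0))) • (p + joinCoord 1 0) := by
  rw [neg_one_smul, neg_smul, ← sub_eq_add_neg]
  rfl

variable {p : Ambient n}

theorem lorentz_add_pole_self (hp : p ∈ hyp n) :
    lorentz (p + joinCoord 1 0) (p + joinCoord 1 0) = -(2 * (1 + p 0)) := by
  rw [lorentz_add_right, lorentz_pole, lorentz_add_left, hp.1, lorentz_comm, lorentz_pole]
  simp
  ring

theorem lorentzSwap_lorentz (hp : p ∈ hyp n) (x y : Ambient n) :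
    lorentz (lorentzSwap p x) (lorentzSwap p y) = lorentz x y := by
  have hp0 : 1 + p 0 ≠ 0 := by linarith [hp.2]
  simp only [lorentzSwap_apply]
  have hv := lorentz_add_pole_self hp
  generalize p + joinCoord 1 0 = v at hv ⊢
  simp only [lorentz_add_left, lorentz_add_right, lorentz_smul_left, lorentz_smul_right, hv,
    lorentz_comm v y]
  field_simp
  ring

theorem lorentzSwap_lorentzSwap (hp : p ∈ hyp n) (x : Ambient n) :
    lorentzSwap p (lorentzSwap p x) = x := by
  have hp0 : 1 + p 0 ≠ 0 := by linarith [hp.2]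
  have hv := lorentz_add_pole_self hp
  rw [lorentzSwap_apply p (lorentzSwap p x), lorentzSwap_apply p x]
  generalize p + joinCoord 1 0 = v at hv ⊢
  rw [lorentz_add_left, lorentz_smul_left, lorentz_smul_left, hv]
  have e : -((-1 * lorentz x v + -(lorentz x v / (1 + p 0)) * -(2 * (1 + p 0))) / (1 + p 0))
      = -(lorentz x v / (1 + p 0)) := by
    field_simp
    ring
  rw [e, smul_add, smul_smul, smul_smul, add_assoc, ← add_smul]
  simp

theorem lorentzSwap_pole (hp : p ∈ hyp n) : lorentzSwap p (joinCoord 1 0) = p := by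
  have hp0 : 1 + p 0 ≠ 0 := by linarith [hp.2]
  rw [lorentzSwap_apply, lorentz_comm, lorentz_pole]
  have e : -(-(p + joinCoord 1 0 : Ambient n) 0 / (1 + p 0)) = 1 := by
    rw [PiLp.add_apply, joinCoord_zero]
    field_simp
    ring
  rw [e]
  simp

theorem lorentzSwap_zero_coord (hp : p ∈ hyp n) (x : Ambient n) :
    lorentzSwap p x 0 = -lorentz x p := by
  rw [← neg_eq_iff_eq_neg, ← lorentz_pole, ← lorentzSwap_lorentz hp, lorentzSwap_lorentzSwap hp,
    lorentzSwap_pole hp]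

theorem measurePreserving_lorentzSwap (hp : p ∈ hyp n) :
    MeasurePreserving (lorentzSwap p) volume volume := by
  have hid : lorentzSwap p ∘ₗ lorentzSwap p = LinearMap.id :=
    LinearMap.ext fun x => lorentzSwap_lorentzSwap hp x
  have hdet : LinearMap.det (lorentzSwap p) * LinearMap.det (lorentzSwap p) = 1 := by
    rw [← LinearMap.det_comp, hid, LinearMap.det_id]
  have habs : |LinearMap.det (lorentzSwap p)| = 1 := by
    rw [← sq_eq_sq₀ (abs_nonneg _) zero_le_one, sq_abs, sq, hdet, one_pow]
  refine ⟨(lorentzSwap p).continuous_of_finiteDimensional.measurable, ?_⟩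
  rw [Measure.map_linearMap_addHaar_eq_smul_addHaar _ (left_ne_zero_of_mul_eq_one hdet), abs_inv,
    habs]
  simp

theorem lorentzSwap_mem (hp : p ∈ hyp n) {x : Ambient n} (hx : x ∈ hyp n) :
    lorentzSwap p x ∈ hyp n := by
  refine ⟨by rw [lorentzSwap_lorentz hp, hx.1], ?_⟩
  rw [lorentzSwap_zero_coord hp, neg_pos]
  exact lorentz_neg_of_timelike hx.2 (by rw [hx.1]; norm_num) hp.2 (by rw [hp.1]; norm_num)

theorem lintegral_hypVolume_lorentzSwap (hp : p ∈ hyp n) {F : Ambient n → ℝ≥0∞}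
    (hF : Measurable F) :
    ∫⁻ x, F (lorentzSwap p x) ∂hypVolume n = ∫⁻ x, F x ∂hypVolume n := by
  have hpos : ∀ x ∈ truncatedCone n, 0 < lorentzSwap p x 0 := by
    intro x hx
    rw [lorentzSwap_zero_coord hp, neg_pos]
    exact lorentz_neg_of_timelike hx.1 hx.2.2 hp.2 (by rw [hp.1]; norm_num)
  refine lintegral_hypVolume_comp (measurePreserving_lorentzSwap hp)
    (fun k x => map_smul _ k x) (fun x => lorentzSwap_lorentz hp x x) hpos
    (fun x hx => ?_) hF
  have := hpos _ hx
  rwa [lorentzSwap_lorentzSwap hp] at this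

theorem hypParam_mem (y : EuclideanSpace ℝ (Fin n)) : hypParam n y ∈ hyp n := by
  have h : 0 < 1 + ‖y‖ ^ 2 := by positivity
  rw [hypParam_eq]
  refine ⟨?_, Real.sqrt_pos.2 h⟩
  rw [lorentz_joinCoord_self, Real.sq_sqrt h.le]
  ring

theorem exists_eq_hypParam {x : Ambient n} (hx : x ∈ hyp n) : ∃ y, x = hypParam n y := by
  obtain ⟨y, hy⟩ := exists_eq_joinCoord x
  refine ⟨y, ?_⟩
  have h1 := hx.1
  rw [hy, lorentz_joinCoord_self] at h1
  rw [hypParam_eq, show 1 + ‖y‖ ^ 2 = x 0 ^ 2 by linarith, Real.sqrt_sq hx.2.le]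
  exact hy

theorem continuous_hypParam : Continuous (hypParam n) := by
  have h : Continuous fun y : EuclideanSpace ℝ (Fin n) => (√(1 + ‖y‖ ^ 2), y) := by fun_prop
  exact continuous_joinCoord.comp h

/-- The point of the Euclidean space representing the linear function `-⟨p, ·⟩`. -/
def lorentzDual (p : Ambient n) : Ambient n :=
  WithLp.toLp 2 (Fin.cons (p 0) (fun i => -p i.succ))

theorem inner_lorentzDual (p x : Ambient n) : inner ℝ (lorentzDual p) x = -lorentz p x := by
  simp only [lorentz, lorentzDual, PiLp.inner_apply, Fin.sum_univ_succ, Fin.cons_zero,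
    Fin.cons_succ]
  simp [mul_comm]
  ring

theorem lorentzGrad_comp_inner {ψ : ℝ → ℝ} (hψ : Differentiable ℝ ψ) (p x : Ambient n) :
    lorentzGrad (fun x => ψ (inner ℝ (lorentzDual p) x)) x
      = (-deriv ψ (-lorentz p x)) • p := by
  rw [lorentzGrad, gradient_comp_inner hψ, inner_lorentzDual]
  ext i
  refine Fin.cases ?_ (fun i => ?_) i <;> simp [lorentzDual]

/-- A function on `H^n` that vanishes near `x` has vanishing gradient at `x`: differentiate along
the curve `√(1 + τ² ⟨v, v⟩) x + τ v` in `H^n`, where `v` is the gradient. -/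
theorem lorentz_hypGrad_self_eq_zero {u : Ambient n → ℝ} (hu : Differentiable ℝ u)
    {x : Ambient n} (hx : x ∈ hyp n) (hux : ∀ᶠ y in 𝓝 x, y ∈ hyp n → u y = 0) :
    lorentz (hypGrad u x) (hypGrad u x) = 0 := by
  have htan := lorentz_hypGrad_tangent u hx
  have hq := lorentz_self_nonneg hx htan
  rw [lorentz_hypGrad htan]
  generalize hypGrad u x = v at htan hq
  set q := lorentz v v with hqdef
  set γ : ℝ → Ambient n := fun τ => √(1 + τ ^ 2 * q) • x + τ • v with hγ
  have hγ0 : γ 0 = x := by simp [hγ]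
  have hγd : HasDerivAt γ v 0 := by
    have h1 : HasDerivAt (fun τ : ℝ => 1 + τ ^ 2 * q) 0 0 := by
      refine (((hasDerivAt_pow 2 (0 : ℝ)).mul_const q).const_add 1).congr_deriv (by simp)
    have h2 := (h1.sqrt (by simp)).smul_const x
    refine (h2.add ((hasDerivAt_id (0 : ℝ)).smul_const v)).congr_deriv (by simp)
  have hγx : Tendsto γ (𝓝 0) (𝓝 x) := by
    have := hγd.continuousAt.tendsto
    rwa [hγ0] at this
  have hx0 : Continuous fun y : Ambient n => y 0 := by fun_prop
  have hev : (fun τ => u (γ τ)) =ᶠ[𝓝 0] fun _ => (0 : ℝ) := by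
    filter_upwards [hγx.eventually hux,
      hγx.eventually ((isOpen_lt continuous_const hx0).mem_nhds hx.2)] with τ h1 h2
    refine h1 ⟨?_, h2⟩
    have hpos : 0 ≤ 1 + τ ^ 2 * q := by positivity
    simp only [hγ, lorentz_add_left, lorentz_add_right, lorentz_smul_left, lorentz_smul_right,
      hx.1, htan, lorentz_comm v x, ← hqdef]
    have := Real.mul_self_sqrt hpos
    linear_combination -this
  have h1 := (hu (γ 0)).hasFDerivAt.comp_hasDerivAt 0 hγd
  rw [hγ0] at h1
  have h2 : HasDerivAt (fun τ => u (γ τ)) (fderiv ℝ u x v) 0 := h1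
  have h3 := h2.deriv
  rw [hev.deriv_eq] at h3
  simpa using h3.symm

theorem cosh_image_Ioi : Real.cosh '' Ioi 0 = Ioi 1 := by
  ext x
  constructor
  · rintro ⟨t, ht, rfl⟩
    exact Real.one_lt_cosh.2 (ne_of_gt ht)
  · intro hx
    exact ⟨Real.arcosh x, Real.arcosh_pos hx, Real.cosh_arcosh (le_of_lt hx)⟩

theorem exists_isPolarModel_hyp (hn : 1 ≤ n) (hp : p ∈ hyp n) :
    ∃ V, IsPolarModel (hyp n) (hypVolume n) (fun u x => lorentz (hypGrad u x) (hypGrad u x)) 1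
      Real.sinh Real.cosh Real.arcosh (Ioi 0) p (lorentzDual p) V := by
  set L := lorentzSwap p with hLdef
  have hLc : Continuous L := L.continuous_of_finiteDimensional
  have hcomb : ∀ (a b : ℝ) (θ : Direction n),
      a • p + b • L (joinCoord 0 θ) = L (joinCoord a (b • (θ : EuclideanSpace ℝ (Fin n)))) := by
    intro a b θ
    rw [joinCoord_eq_smul_add_smul, map_add, map_smul, map_smul, lorentzSwap_pole hp]
  have hlor : ∀ (a b a' b' : ℝ) (θ : Direction n),
      lorentz (a • p + b • L (joinCoord 0 θ)) (a' • p + b' • L (joinCoord 0 θ))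
        = b * b' - a * a' := by
    intro a b a' b' θ
    rw [hcomb, hcomb, lorentzSwap_lorentz hp, lorentz_joinCoord, inner_smul_left,
      inner_smul_right, real_inner_self_eq_norm_sq]
    simp
  have hlor_p : ∀ (a b : ℝ) (θ : Direction n),
      lorentz p (a • p + b • L (joinCoord 0 θ)) = -a := by
    intro a b θ
    simpa using hlor 1 0 a b θ
  have hmem : ∀ (t : ℝ) (θ : Direction n),
      geodesicPoint Real.sinh Real.cosh p (fun θ => L (joinCoord 0 θ)) t θ ∈ hyp n := by
    intro t θ
    rw [geodesicPoint, hcomb]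
    refine lorentzSwap_mem hp ⟨?_, Real.cosh_pos t⟩
    rw [lorentz_joinCoord_self, norm_smul, Real.cosh_sq]
    simp
  refine ⟨fun θ => L (joinCoord 0 θ), ?_⟩
  constructor
  case warp => exact isWarp_sinh
  case eps_sq => norm_num
  case isOpen_T => exact isOpen_Ioi
  case Ioc_subset => exact fun r _ t ht => ht.1
  case pos_of_mem => exact fun t ht => ht
  case s_pos => exact fun t ht => Real.sinh_pos_iff.2 ht
  case acc_c => exact fun t ht => Real.arcosh_cosh (le_of_lt ht)
  case contDiffAt_acc =>
    intro t ht
    exact Real.contDiffAt_arcosh (cosh_image_Ioi ▸ mem_image_of_mem _ ht)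
  case isOpen_image => rw [cosh_image_Ioi]; exact isOpen_Ioi
  case isClosed => exact isClosed_hyp
  case isBounded =>
    intro C
    refine ((isCompact_closedBall (0 : Ambient n) (2 * |C|)).image hLc).isBounded.subset ?_
    rintro x ⟨hx, hxC⟩
    refine ⟨L x, ?_, lorentzSwap_lorentzSwap hp x⟩
    have hLx := lorentzSwap_mem hp hx
    have h0 := lorentzSwap_zero_coord hp x
    rw [inner_lorentzDual, lorentz_comm, ← h0] at hxC
    rw [← hLdef] at hLx hxC
    obtain ⟨y, hy⟩ := exists_eq_joinCoord (L x)
    have h1 := hLx.1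
    have h2 := hLx.2
    rw [hy, lorentz_joinCoord_self] at h1
    have h3 := norm_joinCoord_sq (L x 0) y
    rw [← hy] at h3
    rw [mem_closedBall_zero_iff]
    refine le_of_abs_le (abs_le_of_sq_le_sq ?_ (by positivity))
    have h4 : L x 0 ^ 2 ≤ |C| ^ 2 := by
      gcongr
      exact hxC.trans (le_abs_self C)
    nlinarith
  case mem => exact fun t _ θ => hmem t θ
  case inner_eq =>
    intro t θ
    rw [inner_lorentzDual, geodesicPoint, hlor_p, neg_neg]
  case lintegral_eq =>
    intro F hF
    rw [← lintegral_hypVolume_lorentzSwap hp hF,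
      lintegral_hypVolume_polar hn (F := fun x => F (L x)) (hF.comp hLc.measurable)]
    simp only [geodesicPoint, hcomb]
  case ae_mem =>
    exact (ae_map_iff continuous_hypParam.measurable.aemeasurable (p := fun x => x ∈ hyp n)
      isClosed_hyp.measurableSet).2 (Eventually.of_forall fun y => hypParam_mem y)
  case compact_lt_top =>
    intro K hK
    obtain ⟨R, hR⟩ := hK.isBounded.subset_closedBall 0
    have hmeas : MeasurableSet (hypParam n ⁻¹' K) := continuous_hypParam.measurable hK.measurableSet
    rw [hypVolume, Measure.map_apply continuous_hypParam.measurable hK.measurableSet,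
      withDensity_apply _ hmeas]
    have hsub : hypParam n ⁻¹' K ⊆ Metric.closedBall 0 R := by
      intro y hy
      have h1 := mem_closedBall_zero_iff.1 (hR hy)
      have h2 := norm_joinCoord_sq (√(1 + ‖y‖ ^ 2)) y
      rw [← hypParam_eq] at h2
      rw [mem_closedBall_zero_iff]
      refine le_trans ?_ h1
      refine le_of_abs_le (abs_le_of_sq_le_sq ?_ (norm_nonneg _))
      rw [h2]
      nlinarith [sq_nonneg √(1 + ‖y‖ ^ 2)]
    calc ∫⁻ y in hypParam n ⁻¹' K, ENNReal.ofReal (1 / √(1 + ‖y‖ ^ 2))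
        ≤ ∫⁻ y in hypParam n ⁻¹' K, 1 := by
          refine lintegral_mono fun y => ?_
          rw [← ENNReal.ofReal_one]
          refine ENNReal.ofReal_le_ofReal ?_
          have : 1 ≤ √(1 + ‖y‖ ^ 2) := Real.one_le_sqrt.2 (by nlinarith [sq_nonneg ‖y‖])
          exact div_le_one_of_le₀ this (by positivity)
      _ = volume (hypParam n ⁻¹' K) := by simp
      _ ≤ volume (Metric.closedBall 0 R) := measure_mono hsub
      _ < ⊤ := measure_closedBall_lt_top
  case open_ne_zero =>
    rintro U hU ⟨x, hxU, hx⟩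
    obtain ⟨y, rfl⟩ := exists_eq_hypParam hx
    have hUo := hU.preimage continuous_hypParam
    rw [hypVolume, Measure.map_apply continuous_hypParam.measurable hU.measurableSet,
      withDensity_apply _ hUo.measurableSet]
    refine ((setLIntegral_pos_iff (by fun_prop)).2 ?_).ne'
    have hsupp : Function.support (fun y : EuclideanSpace ℝ (Fin n) =>
        ENNReal.ofReal (1 / √(1 + ‖y‖ ^ 2))) = univ := by
      refine eq_univ_of_forall fun z => (ENNReal.ofReal_pos.2 ?_).ne'
      positivity
    rw [hsupp, univ_inter]
    exact hUo.measure_pos _ ⟨y, hxU⟩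
  case continuous_gradSq =>
    intro u hu
    have hg := continuous_gradient hu
    have hl : Continuous (lorentzGrad u) := by
      refine (PiLp.continuous_toLp 2 _).comp (continuous_pi fun i => ?_)
      refine Fin.cases ?_ (fun i => ?_) i
      · simp only [Fin.cons_zero]
        fun_prop
      · simp only [Fin.cons_succ]
        fun_prop
    have hh : Continuous (hypGrad u) := by
      unfold hypGrad lorentz
      fun_prop
    exact continuous_lorentz_self.comp hh
  case gradSq_nonneg => exact fun u x hx => lorentz_self_nonneg hx (lorentz_hypGrad_tangent u hx)
  case sq_le_gradSq =>
    intro u _ t _ θ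
    have hx := hmem t θ
    have h0 : lorentz (geodesicPoint Real.sinh Real.cosh p (fun θ => L (joinCoord 0 θ)) t θ)
        ((1 * Real.sinh t) • p + Real.cosh t • L (joinCoord 0 θ)) = 0 := by
      rw [geodesicPoint, hlor]; ring
    have h1 : lorentz ((1 * Real.sinh t) • p + Real.cosh t • L (joinCoord 0 θ))
        ((1 * Real.sinh t) • p + Real.cosh t • L (joinCoord 0 θ)) = 1 := by
      rw [hlor]
      linarith [Real.cosh_sq t]
    generalize geodesicPoint Real.sinh Real.cosh p (fun θ => L (joinCoord 0 θ)) t θ = x at hx h0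
    generalize (1 * Real.sinh t) • p + Real.cosh t • L (joinCoord 0 θ) = e at h0 h1
    have h2 := lorentz_hypGrad (u := u) h0
    have htan := lorentz_hypGrad_tangent u hx
    -- the component of the gradient orthogonal to the radial direction `e` is spacelike
    have h3 := lorentz_self_nonneg (v := hypGrad u x + (-fderiv ℝ u x e) • e) hx (by
      rw [lorentz_add_right, lorentz_smul_right, h0, htan]; ring)
    simp only [lorentz_add_left, lorentz_add_right, lorentz_smul_left, lorentz_smul_right, h1,
      lorentz_comm e, h2] at h3
    nlinarith
  case gradSq_radial =>
    intro ψ hψ t _ θ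
    have hx := (hmem t θ).1
    have h1 : lorentz p (geodesicPoint Real.sinh Real.cosh p (fun θ => L (joinCoord 0 θ)) t θ)
        = -Real.cosh t := by
      rw [geodesicPoint, hlor_p]
    generalize geodesicPoint Real.sinh Real.cosh p (fun θ => L (joinCoord 0 θ)) t θ = x at hx h1
    rw [hypGrad, lorentzGrad_comp_inner hψ, h1, neg_neg]
    simp only [lorentz_add_left, lorentz_add_right, lorentz_smul_left, lorentz_smul_right, hx, h1,
      lorentz_comm x p, hp.1]
    linear_combination (deriv ψ (Real.cosh t)) ^ 2 * Real.cosh_sq t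
  case gradSq_support =>
    intro u Ω hu
    refine ⟨_, hu.compact_support, fun x hx hxK => ?_⟩
    refine lorentz_hypGrad_self_eq_zero (hu.smooth.differentiable (by simp)) hx ?_
    filter_upwards [isClosed_closure.isOpen_compl.mem_nhds hxK] with y hy hyM
    by_contra hne
    exact hy (subset_closure ⟨hyM, hne⟩)

theorem hypBall_eq (r : ℝ) :
    hypBall n p r = IsPolarModel.ball (hyp n) Real.arcosh (lorentzDual p) r := by
  ext x
  simp only [hypBall, IsPolarModel.ball, inner_lorentzDual]

end Lorentz

/-! ### Bounds for the eigenvalue -/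

/-- The range of `t ↦ 1 / s(t)² - 1 / t²` on `(0, r)`: this function increases, and it tends to
`-ε / 3` at `0`. -/
theorem IsPolarModel.inv_sq_sub_mem_Icc {n : ℕ} {M : Set (Ambient n)} {vol : Measure (Ambient n)}
    {gradSq : (Ambient n → ℝ) → Ambient n → ℝ} {ε : ℝ} {s c acc : ℝ → ℝ} {T : Set ℝ}
    {p w : Ambient n} {V : Direction n → Ambient n}
    (h : IsPolarModel M vol gradSq ε s c acc T p w V) {r t : ℝ} (hr : r ∈ T) (ht : t ∈ Ioo 0 r) :
    1 / s t ^ 2 - 1 / t ^ 2 ∈ Icc (-(ε / 3)) (1 / s r ^ 2 - 1 / r ^ 2) := by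
  have hpos : ∀ x ∈ Ioc 0 r, 0 < s x := fun x hx => h.s_pos x (h.Ioc_subset r hr hx)
  have ht' : t ∈ Ioc 0 r := ⟨ht.1, ht.2.le⟩
  exact ⟨h.warp.neg_third_le_inv_sq_sub ht.1 (hpos t ht'),
    h.warp.monotoneOn_inv_sq_sub hpos ht' ⟨h.pos_of_mem r hr, le_rfl⟩ ht.2.le⟩

/-- For `n = 2` the coefficient `a (a - 1)` with `a = (n - 1) / 2` is `-1 / 4`, so that the
potential decreases from its limit at `0`, which gives the upper bound. -/
theorem IsPolarModel.eigenvalue_mem_Icc_dim_two {M : Set (Ambient 2)} {vol : Measure (Ambient 2)}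
    {gradSq : (Ambient 2 → ℝ) → Ambient 2 → ℝ} {ε : ℝ} {s c acc : ℝ → ℝ} {T : Set ℝ}
    {p w : Ambient 2} {V : Direction 2 → Ambient 2}
    (h : IsPolarModel M vol gradSq ε s c acc T p w V) {r : ℝ} (hr : r ∈ T) :
    firstDirichletEigenvalue M vol gradSq (IsPolarModel.ball M acc w r)
      ∈ Icc (besselZero 0 ^ 2 / r ^ 2 + 1 / 4 * (1 / r ^ 2 - 1 / s r ^ 2 + ε))
        (besselZero 0 ^ 2 / r ^ 2 + ε / 3) := by
  obtain ⟨G, G', hG⟩ := exists_isBesselGroundState (le_refl (0 : ℝ)) (h.pos_of_mem r hr)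
  have hG' : IsBesselGroundState (((2 - 1 : ℕ) : ℝ) / 2) (besselZero 0 ^ 2 / r ^ 2) r G G' := by
    convert hG using 1
    norm_num
  refine h.eigenvalue_bounds le_rfl hr hG' fun t ht => ?_
  obtain ⟨h1, h2⟩ := h.inv_sq_sub_mem_Icc hr ht
  norm_num only [radialPotential]
  constructor <;> linarith

/-- For `n = 3` the potential is constant. -/
theorem IsPolarModel.eigenvalue_eq_dim_three {M : Set (Ambient 3)} {vol : Measure (Ambient 3)}
    {gradSq : (Ambient 3 → ℝ) → Ambient 3 → ℝ} {ε : ℝ} {s c acc : ℝ → ℝ} {T : Set ℝ}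
    {p w : Ambient 3} {V : Direction 3 → Ambient 3}
    (h : IsPolarModel M vol gradSq ε s c acc T p w V) {r : ℝ} (hr : r ∈ T) :
    firstDirichletEigenvalue M vol gradSq (IsPolarModel.ball M acc w r) = π ^ 2 / r ^ 2 + ε := by
  have hG := isBesselGroundState_sin (h.pos_of_mem r hr)
  rw [show (1 : ℝ) = ((3 - 1 : ℕ) : ℝ) / 2 by norm_num] at hG
  have key := h.eigenvalue_bounds (m₁ := π ^ 2 / r ^ 2 + ε) (m₂ := π ^ 2 / r ^ 2 + ε)
    (by norm_num) hr hG fun t _ => by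
      norm_num [radialPotential]
  exact le_antisymm key.2 key.1

/-- For `n ≥ 3` the coefficient `a (a - 1) = (n - 1) (n - 3) / 4` is nonnegative, so that the
potential increases from its limit at `0`, which gives the lower bound. -/
theorem IsPolarModel.eigenvalue_mem_Icc {n : ℕ} {M : Set (Ambient n)} {vol : Measure (Ambient n)}
    {gradSq : (Ambient n → ℝ) → Ambient n → ℝ} {ε : ℝ} {s c acc : ℝ → ℝ} {T : Set ℝ}
    {p w : Ambient n} {V : Direction n → Ambient n}
    (h : IsPolarModel M vol gradSq ε s c acc T p w V) (hn : 3 ≤ n) {r : ℝ} (hr : r ∈ T) :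
    firstDirichletEigenvalue M vol gradSq (IsPolarModel.ball M acc w r)
      ∈ Icc (besselZero (((n : ℝ) - 2) / 2) ^ 2 / r ^ 2 + ε * ((n : ℝ) * ((n : ℝ) - 1) / 6))
        (besselZero (((n : ℝ) - 2) / 2) ^ 2 / r ^ 2 + ε * (((n : ℝ) - 1) ^ 2 / 4)
          + ((n : ℝ) - 1) * ((n : ℝ) - 3) / 4 * (1 / s r ^ 2 - 1 / r ^ 2)) := by
  have hn' : (3 : ℝ) ≤ n := by exact_mod_cast hn
  have hcast : ((n - 1 : ℕ) : ℝ) = (n : ℝ) - 1 := by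
    rw [Nat.cast_sub (by omega), Nat.cast_one]
  obtain ⟨G, G', hG⟩ := exists_isBesselGroundState (ν := ((n : ℝ) - 2) / 2) (by linarith)
    (h.pos_of_mem r hr)
  rw [show ((n : ℝ) - 2) / 2 + 1 / 2 = ((n - 1 : ℕ) : ℝ) / 2 by rw [hcast]; ring] at hG
  refine h.eigenvalue_bounds (by omega) hr hG fun t ht => ?_
  obtain ⟨h1, h2⟩ := h.inv_sq_sub_mem_Icc hr ht
  have ha : 0 ≤ ((n : ℝ) - 1) * ((n : ℝ) - 3) / 4 :=
    div_nonneg (mul_nonneg (by linarith) (by linarith)) (by norm_num)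
  have h1' := mul_le_mul_of_nonneg_left h1 ha
  have h2' := mul_le_mul_of_nonneg_left h2 ha
  rw [radialPotential, hcast]
  constructor <;> linarith

end SpaceForm

theorem mainTheorem3 :
    (∀ (n : ℕ) (p : SpaceForm.Ambient n) (r : ℝ), p ∈ SpaceForm.hyp n → 0 < r →
      (n = 2 →
        SpaceForm.besselZero 0 ^ 2 / r ^ 2
            + 1 / 4 * (1 / r ^ 2 - 1 / Real.sinh r ^ 2 + 1) ≤ SpaceForm.hypEigenvalue n p r ∧
        SpaceForm.hypEigenvalue n p r ≤ SpaceForm.besselZero 0 ^ 2 / r ^ 2 + 1 / 3) ∧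
      (n = 3 → SpaceForm.hypEigenvalue n p r = Real.pi ^ 2 / r ^ 2 + 1) ∧
      (4 ≤ n →
        SpaceForm.besselZero (((n : ℝ) - 2) / 2) ^ 2 / r ^ 2 + (n : ℝ) * ((n : ℝ) - 1) / 6
            ≤ SpaceForm.hypEigenvalue n p r ∧
        SpaceForm.hypEigenvalue n p r
            ≤ SpaceForm.besselZero (((n : ℝ) - 2) / 2) ^ 2 / r ^ 2 + ((n : ℝ) - 1) ^ 2 / 4
              + ((n : ℝ) - 1) * ((n : ℝ) - 3) / 4 * (1 / Real.sinh r ^ 2 - 1 / r ^ 2))) ∧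
    (∀ (n : ℕ) (p : SpaceForm.Ambient n) (r : ℝ), p ∈ SpaceForm.sph n → 0 < r → r < Real.pi →
      (n = 2 →
        SpaceForm.besselZero 0 ^ 2 / r ^ 2
            + 1 / 4 * (1 / r ^ 2 - 1 / Real.sin r ^ 2 - 1) ≤ SpaceForm.sphEigenvalue n p r ∧
        SpaceForm.sphEigenvalue n p r ≤ SpaceForm.besselZero 0 ^ 2 / r ^ 2 - 1 / 3) ∧
      (n = 3 → SpaceForm.sphEigenvalue n p r = Real.pi ^ 2 / r ^ 2 - 1) ∧
      (4 ≤ n →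
        SpaceForm.besselZero (((n : ℝ) - 2) / 2) ^ 2 / r ^ 2 - (n : ℝ) * ((n : ℝ) - 1) / 6
            ≤ SpaceForm.sphEigenvalue n p r ∧
        SpaceForm.sphEigenvalue n p r
            ≤ SpaceForm.besselZero (((n : ℝ) - 2) / 2) ^ 2 / r ^ 2 - ((n : ℝ) - 1) ^ 2 / 4
              + ((n : ℝ) - 1) * ((n : ℝ) - 3) / 4 * (1 / Real.sin r ^ 2 - 1 / r ^ 2))) := by
  constructor
  · intro n p r hp hr
    refine ⟨?_, ?_, fun hn => ?_⟩
    · rintro rfl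
      obtain ⟨V, h⟩ := SpaceForm.exists_isPolarModel_hyp one_le_two hp
      rw [SpaceForm.hypEigenvalue, SpaceForm.hypBall_eq]
      exact h.eigenvalue_mem_Icc_dim_two hr
    · rintro rfl
      obtain ⟨V, h⟩ := SpaceForm.exists_isPolarModel_hyp (by norm_num) hp
      rw [SpaceForm.hypEigenvalue, SpaceForm.hypBall_eq]
      exact h.eigenvalue_eq_dim_three hr
    · obtain ⟨V, h⟩ := SpaceForm.exists_isPolarModel_hyp (by omega) hp
      rw [SpaceForm.hypEigenvalue, SpaceForm.hypBall_eq]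
      obtain ⟨h1, h2⟩ := h.eigenvalue_mem_Icc (by omega) hr
      constructor <;> linarith
  · intro n p r hp hr hrpi
    refine ⟨?_, ?_, fun hn => ?_⟩
    · rintro rfl
      obtain ⟨V, h⟩ := SpaceForm.exists_isPolarModel_sph one_le_two hp
      rw [SpaceForm.sphEigenvalue, SpaceForm.sphBall_eq hp]
      obtain ⟨h1, h2⟩ := h.eigenvalue_mem_Icc_dim_two ⟨hr, hrpi⟩
      constructor <;> linarith
    · rintro rfl
      obtain ⟨V, h⟩ := SpaceForm.exists_isPolarModel_sph (by norm_num) hp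
      rw [SpaceForm.sphEigenvalue, SpaceForm.sphBall_eq hp]
      exact h.eigenvalue_eq_dim_three ⟨hr, hrpi⟩
    · obtain ⟨V, h⟩ := SpaceForm.exists_isPolarModel_sph (by omega) hp
      rw [SpaceForm.sphEigenvalue, SpaceForm.sphBall_eq hp]
      obtain ⟨h1, h2⟩ := h.eigenvalue_mem_Icc (by omega) ⟨hr, hrpi⟩
      constructor <;> linarith
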